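/- Let $T>0$, and let $G$ be the fundamental solution either of the wave equation $\partial_t^2u-\Delta u=0$ on $\mathbb{R}^d$ with $d\in\{1,2,3\}$, or of the heat equation $\partial_t u-\frac12\Delta u=0$ on $\mathbb{R}^d$ with $d\ge 1$. That is, for $t>0$, $G_t(x)=\frac12\mathbf 1_{\{|x|<t\}}$ (wave, $d=1$), $G_t(x)=\frac1{2\pi}(t^2-|x|^2)^{-1/2}\mathbf 1_{\{|x|<t\}}$ (wave, $d=2$), $G_t(dx)=\frac1{4\pi t}\sigma_t(dx)$ with $\sigma_t$ the surface measure on the sphere of radius $t$ (wave, $d=3$), and $G_t(x)=(2\pi t)^{-d/2}e^{-|x|^2/(2t)}$ (heat). For a tempered non-negative Borel measure $\nu$ on $\mathbb{R}^d$, a spatially homogeneous Gaussian noise with spectral measure $\nu$ is a centered Gaussian process $\{W(\varphi):\varphi\in\mathcal C_0^\infty([0,\infty)\times\mathbb{R}^d)\}$ on a probability space with covariance $$\mathbb{E}[W(\varphi)W(\psi)]=\int_0^\infty\int_{\mathbb{R}^d}\mathcal F\varphi(t,\cdot)(\xi)\,\overline{\mathcal F\psi(t,\cdot)(\xi)}\,\nu(d\xi)\,dt,\qquad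 \mathcal Ff(\xi)=\int_{\mathbb{R}^d}e^{-i\langle\xi,x\rangle}f(x)\,dx .$$ The Wiener integral $\int_0^\infty\int_{\mathbb{R}^d} g\,dW$ is the extension of $\varphi\mapsto W(\varphi)$ by isometry: it is the $L^2$-limit of $W(\varphi_k)$ for test functions $\varphi_k$ with $\int_0^\infty\int_{\mathbb{R}^d}|\mathcal F\varphi_k(t,\cdot)(\xi)-\mathcal Fg(t)(\xi)|^2\,\nu(d\xi)\,dt\to0$. Let $W^n$, $n\ge1$, be such noises with spectral measures $\mu_n$, and assume: * **(H1)** there is $q\in(0,2)$ such that $\displaystyle\sup_{n\ge1}\int_{\mathbb{R}^d}\frac{\mu_n(d\xi)}{1+|\xi|^q}<\infty$; * **(H2)** there is a Borel measure $\mu$ on $\mathbb{R}^d$ such that, for every continuous $f:\mathbb{R}^d\to\mathbb{R}$ with $|f(\xi)|\le \frac{C}{1+|\xi|^2}$ for all $\xi$ and some constant $C>0$, $f$ is $\mu$-integrable and $\displaystyle\lim_{n\to\infty}\int_{\mathbb{R}^d} f\,d\mu_n=\int_{\mathbb{R}^d} f\,d\mu$. Let $W$ be a spatially homogeneous Gaussian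 noise with spectral measure $\mu$. Then, for $(t,x)\in[0,T]\times\mathbb{R}^d$, the Wiener integrals $$v^n(t,x)=\int_0^t\int_{\mathbb{R}^d}G_{t-s}(x-y)\,W^n(ds,dy),\qquad v(t,x)=\int_0^t\int_{\mathbb{R}^d}G_{t-s}(x-y)\,W(ds,dy)$$ exist, the random fields $v^n$ ($n\ge1$) and $v$ have versions with continuous paths, and, for any such versions, $v^n$ converges in law to $v$ as $n\to\infty$ in the space $\mathcal C([0,T]\times\mathbb{R}^d)$ endowed with the topology of uniform convergence on compact sets. -/

import Mathlib

open MeasureTheory ProbabilityTheory Filter Topology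
open scoped ENNReal

noncomputable section

namespace StochConv

/-- Euclidean space `ℝ^d`. -/
abbrev Space (d : ℕ) : Type := EuclideanSpace ℝ (Fin d)

/-- The test functions `C_0^∞([0,∞) × ℝ^d)`: real functions on `[0,∞) × ℝ^d` with compact support
that are smooth up to the boundary `t = 0`, i.e. restrictions to `t ≥ 0` of functions in
`C_0^∞(ℝ × ℝ^d)`. For convenience they are extended by `0` to negative times, so that this type is
in bijection with `C_0^∞([0,∞) × ℝ^d)`. -/
structure TestFun (d : ℕ) where
  toFun : ℝ → Space d → ℝ
  eq_zero_of_neg : ∀ t < 0, ∀ x, toFun t x = 0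
  smooth_compact : ∃ ψ : ℝ × Space d → ℝ,
    ContDiff ℝ ((⊤ : ℕ∞) : WithTop ℕ∞) ψ ∧ HasCompactSupport ψ ∧ ∀ t ≥ 0, ∀ x, toFun t x = ψ (t, x)

/-- Fourier transform of a function, `𝓕 f (ξ) = ∫ e^{-i⟨ξ,x⟩} f(x) dx`. -/
def fourierFun {d : ℕ} (f : Space d → ℝ) (ξ : Space d) : ℂ :=
  ∫ x, Complex.exp (-(Complex.I * ((inner ℝ ξ x : ℝ) : ℂ))) * (f x : ℂ)

/-- Fourier transform of a (finite) measure, `𝓕 ν (ξ) = ∫ e^{-i⟨ξ,x⟩} ν(dx)`. -/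
def fourierMeas {d : ℕ} (ν : Measure (Space d)) (ξ : Space d) : ℂ :=
  ∫ x, Complex.exp (-(Complex.I * ((inner ℝ ξ x : ℝ) : ℂ))) ∂ν

/-- `W = {W(φ)}` is a spatially homogeneous Gaussian noise, white in time, with spectral measure
`μ`: a centered Gaussian process indexed by test functions with covariance
`E[W(φ)W(ψ)] = ∫_0^∞ ∫ 𝓕φ(t,·)(ξ) conj(𝓕ψ(t,·)(ξ)) μ(dξ) dt`. (The identity holds in `ℂ`, and its
left side is real, which forces a tempered `μ` to be symmetric.) -/
structure IsHomogeneousNoise {d : ℕ} (μ : Measure (Space d)) {Ω : Type*} [MeasurableSpace Ω]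
    (P : Measure Ω) (W : TestFun d → Ω → ℝ) : Prop where
  gaussian : IsGaussianProcess W P
  centered : ∀ φ, ∫ ω, W φ ω ∂P = 0
  covariance : ∀ φ ψ : TestFun d,
    ((∫ ω, W φ ω * W ψ ω ∂P : ℝ) : ℂ) =
      ∫ t in Set.Ici (0 : ℝ), ∫ ξ,
        fourierFun (φ.toFun t) ξ * (starRingEnd ℂ) (fourierFun (ψ.toFun t) ξ) ∂μ

/-- `I` is (a version of) the Wiener integral `∫_0^∞ ∫ g(t,x) W(dt,dx)` of a measure-valued
integrand `t ↦ g(t)`: the `L²(P)`-limit of `W(φ_k)` for test functions `φ_k` that converge to `g`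
in the norm `‖g‖² = ∫_0^∞ ∫ |𝓕g(t)(ξ)|² μ(dξ) dt`. This is the extension of the isometry
`φ ↦ W(φ)` to the completion of the space of test functions, and it determines `I` up to almost
sure equality. -/
def IsWienerIntegral {d : ℕ} (μ : Measure (Space d)) {Ω : Type*} [MeasurableSpace Ω]
    (P : Measure Ω) (W : TestFun d → Ω → ℝ) (g : ℝ → Measure (Space d)) (I : Ω → ℝ) : Prop :=
  MemLp I 2 P ∧ ∃ φ : ℕ → TestFun d,
    Tendsto (fun k => ∫⁻ t in Set.Ici (0 : ℝ), ∫⁻ ξ,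
      ‖fourierFun ((φ k).toFun t) ξ - fourierMeas (g t) ξ‖ₑ ^ 2 ∂μ) atTop (𝓝 0) ∧
    Tendsto (fun k => eLpNorm (fun ω => W (φ k) ω - I ω) 2 P) atTop (𝓝 0)

/-- The heat kernel `G_t(x) dx = (2πt)^{-d/2} e^{-|x|²/(2t)} dx`, `t > 0` (fundamental solution of
`∂_t u - ½ Δu = 0`). -/
def heatKernel (d : ℕ) (t : ℝ) : Measure (Space d) :=
  volume.withDensity fun x =>
    ENNReal.ofReal (1 / (2 * Real.pi * t) ^ ((d : ℝ) / 2) * Real.exp (-‖x‖ ^ 2 / (2 * t)))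

/-- The surface measure on the sphere of radius `t > 0` centered at `0` in `ℝ³`
(total mass `4πt²`), obtained from the surface measure on the unit sphere by scaling. -/
def sphereMeasure (t : ℝ) : Measure (Space 3) :=
  ENNReal.ofReal (t ^ 2) •
    ((volume : Measure (Space 3)).toSphere).map
      (fun y : Metric.sphere (0 : Space 3) 1 => t • (y : Space 3))

/-- The fundamental solution `G_t`, `t > 0`, of the wave equation on `ℝ^d`, `d ∈ {1, 2, 3}`
(no meaning is attached to the default value in the other dimensions). -/
def waveKernel : (d : ℕ) → ℝ → Measure (Space d)
  | 1, t => volume.withDensity fun x => if ‖x‖ < t then ENNReal.ofReal (1 / 2) else 0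
  | 2, t => volume.withDensity fun x =>
      if ‖x‖ < t then ENNReal.ofReal (1 / (2 * Real.pi) * (1 / Real.sqrt (t ^ 2 - ‖x‖ ^ 2))) else 0
  | 3, t => ENNReal.ofReal (1 / (4 * Real.pi * t)) • sphereMeasure t
  | _, _ => 0

/-- The two equations under consideration. -/
inductive Equation where
  | wave
  | heat

/-- The fundamental solution `G_t(dx)`, `t > 0`, of the chosen equation. -/
def Equation.kernel : Equation → (d : ℕ) → ℝ → Measure (Space d)
  | .wave, d => waveKernel d
  | .heat, d => heatKernel d

open Classical in
/-- The integrand `(s, dy) ↦ 1_{0 ≤ s < t} G_{t-s}(x - dy)`: for `0 ≤ s < t` it is the image of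
`G_{t-s}` under `z ↦ x - z`, i.e. `G_{t-s}(x-y) dy` when `G_{t-s}` is a function. -/
def Equation.integrand (eqn : Equation) (d : ℕ) (t : ℝ) (x : Space d) (s : ℝ) :
    Measure (Space d) :=
  if 0 ≤ s ∧ s < t then (eqn.kernel d (t - s)).map (fun z => x - z) else 0

/-- `C([0,T] × ℝ^d)` with the compact-open topology, i.e. uniform convergence on compact sets. -/
abbrev PathSpace (d : ℕ) (T : ℝ) : Type := C(Set.Icc (0 : ℝ) T × Space d, ℝ)

/-- The path space carries its Borel `σ`-algebra. -/
instance (d : ℕ) (T : ℝ) : MeasurableSpace (PathSpace d T) := borel _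

instance (d : ℕ) (T : ℝ) : BorelSpace (PathSpace d T) := ⟨rfl⟩

/-- `v : Ω → C([0,T] × ℝ^d)` is a continuous version of the stochastic convolution
`v(t,x) = ∫_0^t ∫ G_{t-s}(x-y) W(ds,dy)`, `(t,x) ∈ [0,T] × ℝ^d`. -/
def IsContStochConv (eqn : Equation) {d : ℕ} (T : ℝ) (μ : Measure (Space d)) {Ω : Type*}
    [MeasurableSpace Ω] (P : Measure Ω) (W : TestFun d → Ω → ℝ) (v : Ω → PathSpace d T) : Prop :=
  ∀ (t : Set.Icc (0 : ℝ) T) (x : Space d),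
    IsWienerIntegral μ P W (eqn.integrand d t x) (fun ω => v ω (t, x))

/-- Hypothesis (H1): `sup_n ∫ μ_n(dξ) / (1 + |ξ|^q) < ∞` for some `q ∈ (0,2)`. -/
def HypH1 {d : ℕ} (μ : ℕ → Measure (Space d)) : Prop :=
  ∃ q : ℝ, 0 < q ∧ q < 2 ∧
    (⨆ n, ∫⁻ ξ, ENNReal.ofReal (1 / (1 + ‖ξ‖ ^ q)) ∂(μ n)) < ∞

/-- Hypothesis (H2): for every continuous `f` with `|f(ξ)| ≤ C / (1 + |ξ|²)`, the integral
`∫ f dμ` exists and is the limit of `∫ f dμ_n`. -/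
def HypH2 {d : ℕ} (μ : ℕ → Measure (Space d)) (μlim : Measure (Space d)) : Prop :=
  ∀ f : Space d → ℝ, Continuous f → (∃ C > 0, ∀ ξ, |f ξ| ≤ C * (1 / (1 + ‖ξ‖ ^ 2))) →
    Integrable f μlim ∧ Tendsto (fun n => ∫ ξ, f ξ ∂(μ n)) atTop (𝓝 (∫ ξ, f ξ ∂μlim))

end StochConv

end

open MeasureTheory ProbabilityTheory Filter Topology
open scoped ENNReal

noncomputable section

namespace StochConv

/-! Everything takes place on the Fourier side. In every admissible dimension the transform of `G_r`
is `r sinc(r|ξ|)` (wave) or `exp(-r|ξ|²/2)` (heat), so a value of the stochastic convolution is a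
centered Gaussian variable whose variance is the integral, against the spectral measure, of an
explicit function of `ξ` that does not depend on that measure.

Tightness comes from (H1). At frequency `ξ`, the time-integrated energy `D` of the increment between
`(t,x)` and `(t',x')` satisfies both `D ≤ A (|t-t'| + |x-x'|²)` and `|ξ|² D ≤ A`
(`Equation.exists_lintegral_convSymbol_sub_sq_le`). Interpolating the two (`interpolation_le`) gives
`D ≤ C δ^(1-q/2) / (1+|ξ|^q)`, and (H1) makes the resulting Hölder bound in mean square uniform in
`n`. Gaussian variables have moments of all orders controlled by the variance, so a high enough
moment feeds a dyadic chaining argument. The same chaining bound yields continuous versions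
(`exists_continuous_modification`) and, through Arzelà–Ascoli, tightness
(`isTightMeasureSet_pathSpace`).

The limit is identified by (H2). The variance of a finite combination of values is the integral of
`Equation.specVariance`, a continuous function of order `1/(1+|ξ|²)`, hence an admissible test
function in (H2). So the finite-dimensional characteristic functions converge, and with tightness
this gives weak convergence (`tendsto_of_tight_of_tendsto_integral_probChar`).

For the Wiener integrals to exist, the kernel's transform must lie in the `L²(dt μ(dξ))` closure of
the transforms of test functions (`Equation.isApproximable_convFun`). It is reached by mollifying in
space, freezing time on short intervals, replacing a finite measure by point masses, and smoothing
time indicators. The limit measure inherits the bound (H1) by truncation and Fatou's lemma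
(`HypH2.lintegral_le`). -/

/-! ### Fourier transforms of the fundamental solutions. -/

/-- In suitable orthonormal coordinates, `⟨ξ, x⟩ = ‖ξ‖ x₀`. -/
lemma exists_orthonormalBasis_inner_eq {n : ℕ} (ξ : Space (n + 1)) :
    ∃ b : OrthonormalBasis (Fin (n + 1)) ℝ (Space (n + 1)),
      ∀ x, inner ℝ ξ x = ‖ξ‖ * (b.repr x) 0 := by
  obtain ⟨e, he, hξ⟩ : ∃ e : Space (n + 1), ‖e‖ = 1 ∧ ξ = ‖ξ‖ • e := by
    by_cases h : ξ = 0
    · exact ⟨EuclideanSpace.single 0 1, by simp, by simp [h]⟩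
    · have h' : ‖ξ‖ ≠ 0 := norm_ne_zero_iff.2 h
      exact ⟨‖ξ‖⁻¹ • ξ, by simp [norm_smul, h'], by simp [smul_smul, h']⟩
  have hv : Orthonormal ℝ (({0} : Set (Fin (n + 1))).domRestrict fun _ => e) := by
    rw [orthonormal_iff_ite]
    rintro ⟨i, rfl⟩ ⟨j, rfl⟩
    simp [he]
  obtain ⟨b, hb⟩ := hv.exists_orthonormalBasis_extension_of_card_eq (by simp)
  refine ⟨b, fun x => ?_⟩
  rw [b.repr_apply_apply, hb 0 rfl, ← real_inner_smul_left, ← hξ]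

/-- Fubini along the first coordinate. -/
lemma lintegral_eq_lintegral_slice (n : ℕ) (F : ℝ → ℝ → ℝ≥0∞)
    (hF : Measurable (Function.uncurry F)) :
    ∫⁻ x : Space (n + 1), F (x 0) (‖x‖ ^ 2) =
      ∫⁻ u : ℝ, ∫⁻ y : Space n, F u (u ^ 2 + ‖y‖ ^ 2) := by
  have h1 := (PiLp.volume_preserving_toLp (Fin (n + 1))).lintegral_comp_emb
    (MeasurableEquiv.toLp 2 _).measurableEmbedding
    (fun x : Space (n + 1) => F (x 0) (‖x‖ ^ 2))
  rw [← h1]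
  have h2 := (volume_preserving_piFinSuccAbove (fun _ : Fin (n + 1) => ℝ) 0).symm.lintegral_comp_emb
    (MeasurableEquiv.measurableEmbedding _)
    (fun x => F ((WithLp.toLp 2 x : Space (n + 1)) 0) (‖(WithLp.toLp 2 x : Space (n + 1))‖ ^ 2))
  rw [← h2, Measure.volume_eq_prod, lintegral_prod]
  · refine lintegral_congr fun u => ?_
    have h3 := (PiLp.volume_preserving_toLp (Fin n)).lintegral_comp_emb
      (MeasurableEquiv.toLp 2 _).measurableEmbedding
      (fun y : Space n => F u (u ^ 2 + ‖y‖ ^ 2))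
    rw [← h3]
    refine lintegral_congr fun y => ?_
    simp [EuclideanSpace.norm_sq_eq, Fin.sum_univ_succ, MeasurableEquiv.piFinSuccAbove]
  · refine Measurable.aemeasurable ?_
    refine hF.comp (f := fun p : ℝ × (Fin n → ℝ) => (_, _)) ?_
    fun_prop

/-- The distribution of `⟨ξ, x⟩` under a radial density. -/
lemma map_inner_withDensity_radial {n : ℕ} (ρ : ℝ → ℝ≥0∞) (hρ : Measurable ρ) (ξ : Space (n + 1)) :
    ((volume : Measure (Space (n + 1))).withDensity fun x => ρ (‖x‖ ^ 2)).map (fun x => inner ℝ ξ x)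
      = ((volume : Measure ℝ).withDensity fun u => ∫⁻ y : Space n, ρ (u ^ 2 + ‖y‖ ^ 2)).map
        (fun u => ‖ξ‖ * u) := by
  have hm : Measurable fun u : ℝ => ∫⁻ y : Space n, ρ (u ^ 2 + ‖y‖ ^ 2) := by
    refine Measurable.lintegral_prod_right' (f := fun p : ℝ × Space n => ρ (p.1 ^ 2 + ‖p.2‖ ^ 2)) ?_
    fun_prop
  refine Measure.ext_of_lintegral _ fun g hg => ?_
  rw [lintegral_map hg (by fun_prop), lintegral_map hg (by fun_prop),
    lintegral_withDensity_eq_lintegral_mul _ (by fun_prop) (by fun_prop),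
    lintegral_withDensity_eq_lintegral_mul _ hm (by fun_prop)]
  obtain ⟨b, hb⟩ := exists_orthonormalBasis_inner_eq ξ
  have h1 := b.measurePreserving_repr.lintegral_comp_emb
    b.repr.toHomeomorph.measurableEmbedding
    (fun x : Space (n + 1) => ρ (‖x‖ ^ 2) * g (‖ξ‖ * x 0))
  have h2 := lintegral_eq_lintegral_slice n (fun u r => ρ r * g (‖ξ‖ * u)) (by fun_prop)
  simp only [Pi.mul_apply, hb]
  simp only [LinearIsometryEquiv.norm_map] at h1
  rw [h1, h2]
  refine lintegral_congr fun u => ?_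
  rw [lintegral_mul_const _ (by fun_prop)]

/-- The phase depends on `x` only through `⟨ξ, x⟩`, so only the one-dimensional projection of the
measure matters, and its density is the mass of a slice. -/
lemma fourierMeas_withDensity_radial {n : ℕ} (ρ : ℝ → ℝ≥0∞) (hρ : Measurable ρ)
    (ξ : Space (n + 1)) :
    fourierMeas ((volume : Measure (Space (n + 1))).withDensity fun x => ρ (‖x‖ ^ 2)) ξ =
      ∫ u, Complex.exp (-(Complex.I * ((‖ξ‖ * u : ℝ) : ℂ)))
        ∂((volume : Measure ℝ).withDensity fun u => ∫⁻ y : Space n, ρ (u ^ 2 + ‖y‖ ^ 2)) := by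
  have h := map_inner_withDensity_radial ρ hρ ξ
  have hE : Continuous fun u : ℝ => Complex.exp (-(Complex.I * (u : ℂ))) := by fun_prop
  unfold fourierMeas
  rw [← integral_map (φ := fun x => inner ℝ ξ x)
    (f := fun u : ℝ => Complex.exp (-(Complex.I * (u : ℂ)))) (by fun_prop)
    hE.aestronglyMeasurable, h, integral_map (by fun_prop) hE.aestronglyMeasurable]

lemma integral_cexp_neg_I_mul (c t : ℝ) :
    ∫ u in -t..t, Complex.exp (-(Complex.I * ((c * u : ℝ) : ℂ))) =
      ((2 * (t * Real.sinc (t * c)) : ℝ) : ℂ) := by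
  by_cases hc : c = 0
  · simp [hc]; ring
  · have h := intervalIntegral.integral_comp_mul_left (a := -t) (b := t)
      (fun u : ℝ => Complex.exp (u * Complex.I)) (neg_ne_zero.2 hc)
    have h2 : (fun u : ℝ => Complex.exp (-(Complex.I * ((c * u : ℝ) : ℂ)))) =
        fun u : ℝ => Complex.exp (((-c * u : ℝ) : ℂ) * Complex.I) := by
      funext u; congr 1; push_cast; ring
    rw [h2, h, show -c * -t = -(-c * t) by ring, integral_exp_mul_I_eq_sinc,
      show -c * t = -(t * c) by ring, Real.sinc_neg, Complex.real_smul]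
    have : (c : ℂ) ≠ 0 := by exact_mod_cast hc
    push_cast
    field_simp

/-- Density `1/2` on `(-t, t)` is the common one-dimensional projection of the wave kernels in
dimensions one and two (method of descent). -/
lemma integral_withDensity_half_indicator (c t : ℝ) (ht : 0 < t) :
    ∫ u, Complex.exp (-(Complex.I * ((c * u : ℝ) : ℂ)))
        ∂((volume : Measure ℝ).withDensity fun u => (Set.Ioo (-t) t).indicator
          (fun _ => ENNReal.ofReal (1 / 2)) u) = ((t * Real.sinc (t * c) : ℝ) : ℂ) := by
  rw [withDensity_indicator measurableSet_Ioo, withDensity_const, integral_smul_measure,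
    ← integral_Ioc_eq_integral_Ioo, ← intervalIntegral.integral_of_le (by linarith),
    integral_cexp_neg_I_mul, ENNReal.toReal_ofReal (by norm_num), Complex.real_smul]
  push_cast; ring

lemma fourierMeas_waveKernel_one (t : ℝ) (ht : 0 < t) (ξ : Space 1) :
    fourierMeas (waveKernel 1 t) ξ = ((t * Real.sinc (t * ‖ξ‖) : ℝ) : ℂ) := by
  set ρ : ℝ → ℝ≥0∞ := fun r => if r < t ^ 2 then ENNReal.ofReal (1 / 2) else 0 with hρ
  have hlt : ∀ x : Space 1, ‖x‖ < t ↔ ‖x‖ ^ 2 < t ^ 2 := fun x =>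
    (sq_lt_sq₀ (norm_nonneg _) ht.le).symm
  have hk : waveKernel 1 t = (volume : Measure (Space 1)).withDensity fun x => ρ (‖x‖ ^ 2) := by
    simp only [waveKernel, hρ, hlt]
  rw [hk, fourierMeas_withDensity_radial ρ
    (Measurable.ite measurableSet_Iio measurable_const measurable_const),
    ← integral_withDensity_half_indicator ‖ξ‖ t ht]
  congr 2
  funext u
  rw [volume_euclideanSpace_eq_dirac, lintegral_dirac]
  simp only [hρ, norm_zero, Set.indicator, Set.mem_Ioo, ← abs_lt]
  simp [sq_lt_sq, abs_of_pos ht]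

lemma lintegral_inv_sqrt_sq_sub_sq (a : ℝ) (ha : 0 < a) :
    ∫⁻ z in Set.Ioo (-a) a, ENNReal.ofReal (1 / Real.sqrt (a ^ 2 - z ^ 2)) =
      ENNReal.ofReal Real.pi := by
  have hcont : ContinuousOn (fun z => Real.arcsin (z / a)) (Set.Icc (-a) a) := by
    fun_prop
  have hder : ∀ z ∈ Set.Ioo (-a) a,
      HasDerivAt (fun z => Real.arcsin (z / a)) (1 / Real.sqrt (a ^ 2 - z ^ 2)) z := by
    rintro z ⟨h1, h2⟩
    have hz1 : z / a ≠ -1 := by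
      rw [ne_eq, div_eq_iff ha.ne']; linarith
    have hz2 : z / a ≠ 1 := by
      rw [ne_eq, div_eq_iff ha.ne']; linarith
    have := (Real.hasDerivAt_arcsin hz1 hz2).comp z ((hasDerivAt_id z).div_const a)
    convert! this using 1
    have : a ^ 2 - z ^ 2 = a ^ 2 * (1 - (z / a) ^ 2) := by field_simp
    rw [this, Real.sqrt_mul (by positivity), Real.sqrt_sq ha.le]
    field_simp
  have hnn : ∀ z ∈ Set.Ioo (-a) a, 0 ≤ 1 / Real.sqrt (a ^ 2 - z ^ 2) := fun z _ => by positivity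
  -- The integrand blows up at both endpoints. Its integrability follows from its sign and the
  -- continuity of the antiderivative `arcsin (z / a)` on the closed interval.
  have hint := intervalIntegral.integrableOn_deriv_of_nonneg hcont hder hnn
  have hle : -a ≤ a := by linarith
  have hval := intervalIntegral.integral_eq_sub_of_hasDerivAt_of_le hle hcont hder
    ((intervalIntegrable_iff_integrableOn_Ioc_of_le hle).2 hint)
  rw [intervalIntegral.integral_of_le hle, integral_Ioc_eq_integral_Ioo] at hval
  rw [← ofReal_integral_eq_lintegral_ofReal (hint.mono_set Set.Ioo_subset_Ioc_self)
    (ae_of_all _ fun z => by positivity), hval]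
  congr 1
  rw [neg_div, div_self ha.ne', Real.arcsin_neg, Real.arcsin_one]
  ring

lemma lintegral_space_one (f : ℝ → ℝ≥0∞) :
    ∫⁻ y : Space 1, f (‖y‖ ^ 2) = ∫⁻ z : ℝ, f (z ^ 2) := by
  rw [← (PiLp.volume_preserving_toLp (Fin 1)).lintegral_comp_emb
    (MeasurableEquiv.toLp 2 _).measurableEmbedding (fun y : Space 1 => f (‖y‖ ^ 2)),
    ← (volume_preserving_funUnique (Fin 1) ℝ).lintegral_comp_emb
    (MeasurableEquiv.measurableEmbedding _)]
  simp only [EuclideanSpace.norm_sq_eq, MeasurableEquiv.funUnique]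
  simp
  congr!

/-- The slice at height `u` is a chord of half-length `a = √(t² - u²)`. The integral of `1/√(a² -
z²)` over it is `π` whatever `a` is, so every slice has mass `1/2`, as in dimension one. -/
lemma fourierMeas_waveKernel_two (t : ℝ) (ht : 0 < t) (ξ : Space 2) :
    fourierMeas (waveKernel 2 t) ξ = ((t * Real.sinc (t * ‖ξ‖) : ℝ) : ℂ) := by
  set ρ : ℝ → ℝ≥0∞ := fun r => if r < t ^ 2 then
    ENNReal.ofReal (1 / (2 * Real.pi) * (1 / Real.sqrt (t ^ 2 - r))) else 0 with hρ
  have hlt : ∀ x : Space 2, ‖x‖ < t ↔ ‖x‖ ^ 2 < t ^ 2 := fun x =>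
    (sq_lt_sq₀ (norm_nonneg _) ht.le).symm
  have hk : waveKernel 2 t = (volume : Measure (Space 2)).withDensity fun x => ρ (‖x‖ ^ 2) := by
    simp only [waveKernel, hρ, hlt]
  rw [hk, fourierMeas_withDensity_radial ρ
    (Measurable.ite measurableSet_Iio (by fun_prop) measurable_const),
    ← integral_withDensity_half_indicator ‖ξ‖ t ht]
  congr 2
  funext u
  rw [lintegral_space_one (fun r => ρ (u ^ 2 + r))]
  by_cases hu : u ∈ Set.Ioo (-t) t
  · rw [Set.indicator_of_mem hu]
    have hpos : 0 < t ^ 2 - u ^ 2 := by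
      have := sq_lt_sq.2 ((abs_lt.2 hu).trans_le (le_abs_self t)); linarith
    set a := Real.sqrt (t ^ 2 - u ^ 2) with ha
    have ha0 : 0 < a := Real.sqrt_pos.2 hpos
    have ha2 : a ^ 2 = t ^ 2 - u ^ 2 := Real.sq_sqrt hpos.le
    have : (fun z : ℝ => ρ (u ^ 2 + z ^ 2)) = (Set.Ioo (-a) a).indicator
        (fun z => ENNReal.ofReal (1 / (2 * Real.pi)) *
          ENNReal.ofReal (1 / Real.sqrt (a ^ 2 - z ^ 2))) := by
      funext z
      have hz : z ∈ Set.Ioo (-a) a ↔ u ^ 2 + z ^ 2 < t ^ 2 := by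
        rw [Set.mem_Ioo, ← abs_lt, ← abs_of_pos ha0, ← sq_lt_sq, ha2, lt_sub_iff_add_lt']
      by_cases h : u ^ 2 + z ^ 2 < t ^ 2
      · rw [Set.indicator_of_mem (hz.2 h)]
        simp only [hρ, if_pos h]
        rw [ENNReal.ofReal_mul (by positivity), ha2, sub_sub]
      · rw [Set.indicator_of_notMem (fun h' => h (hz.1 h'))]
        simp only [hρ, if_neg h]
    rw [this, lintegral_indicator measurableSet_Ioo, lintegral_const_mul _ (by fun_prop),
      lintegral_inv_sqrt_sq_sub_sq a ha0, ← ENNReal.ofReal_mul (by positivity)]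
    congr 1
    field_simp
  · rw [Set.indicator_of_notMem hu]
    have : ∀ z : ℝ, ρ (u ^ 2 + z ^ 2) = 0 := by
      intro z
      refine if_neg ?_
      have : ¬ u ^ 2 < t ^ 2 := by
        rwa [sq_lt_sq, abs_of_pos ht, abs_lt]
      nlinarith [sq_nonneg z]
    simp [this]

lemma fourierMeas_heatKernel (d : ℕ) (t : ℝ) (ht : 0 < t) (ξ : Space d) :
    fourierMeas (heatKernel d t) ξ = ((Real.exp (-(t * ‖ξ‖ ^ 2 / 2)) : ℝ) : ℂ) := by
  unfold fourierMeas heatKernel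
  rw [integral_withDensity_eq_integral_toReal_smul (by fun_prop) (by simp)]
  have h := GaussianFourier.integral_cexp_neg_mul_sq_norm_add (V := Space d)
    (b := ((1 / (2 * t) : ℝ) : ℂ)) (by rw [Complex.ofReal_re]; positivity) (-Complex.I) ξ
  have hpos : 0 < 2 * Real.pi * t := by positivity
  have h2 : ∀ x : Space d, (ENNReal.ofReal (1 / (2 * Real.pi * t) ^ ((d : ℝ) / 2) *
      Real.exp (-‖x‖ ^ 2 / (2 * t)))).toReal •
        Complex.exp (-(Complex.I * ((inner ℝ ξ x : ℝ) : ℂ))) =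
      ((1 / (2 * Real.pi * t) ^ ((d : ℝ) / 2) : ℝ) : ℂ) *
      Complex.exp (-((1 / (2 * t) : ℝ) : ℂ) * ‖x‖ ^ 2 + -Complex.I * (inner ℝ ξ x : ℝ)) := by
    intro x
    rw [ENNReal.toReal_ofReal (by positivity), Complex.real_smul, Complex.ofReal_mul, mul_assoc,
      Complex.ofReal_exp, ← Complex.exp_add]
    congr 2
    push_cast
    field_simp
  simp_rw [h2]
  rw [integral_const_mul, h]
  have h3 : ((Real.pi : ℂ) / ((1 / (2 * t) : ℝ) : ℂ)) ^ ((Module.finrank ℝ (Space d) : ℂ) / 2) =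
      (((2 * Real.pi * t) ^ ((d : ℝ) / 2) : ℝ) : ℂ) := by
    rw [Complex.ofReal_cpow hpos.le]
    congr 1
    · push_cast; field_simp
    · simp
  rw [h3, ← mul_assoc, ← Complex.ofReal_mul, one_div_mul_cancel (by positivity), Complex.ofReal_one,
    one_mul, Complex.ofReal_exp]
  congr 1
  have : (t : ℂ) ≠ 0 := by exact_mod_cast ht.ne'
  push_cast
  field_simp
  norm_num

lemma integral_eq_integral_polar {n : ℕ} (f : Space (n + 1) → ℂ) (hf : Integrable f) :
    ∫ x, f x = ∫ r in Set.Ioi (0 : ℝ), (r ^ n : ℝ) •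
      ∫ y : Metric.sphere (0 : Space (n + 1)) 1, f (r • (y : Space (n + 1)))
        ∂(volume : Measure (Space (n + 1))).toSphere := by
  set σ := (volume : Measure (Space (n + 1))).toSphere
  set g : Metric.sphere (0 : Space (n + 1)) 1 × Set.Ioi (0 : ℝ) → ℂ :=
    fun p => f ((p.2 : ℝ) • (p.1 : Space (n + 1))) with hg
  have hmp := (volume : Measure (Space (n + 1))).measurePreserving_homeomorphUnitSphereProd
  have hemb := (homeomorphUnitSphereProd (Space (n + 1))).measurableEmbedding
  have hgf : g ∘ homeomorphUnitSphereProd (Space (n + 1)) = fun x : ({0}ᶜ : Set (Space (n + 1))) => f x := by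
    funext x
    have hx : ‖(x : Space (n + 1))‖ ≠ 0 := norm_ne_zero_iff.2 x.2
    simp [hg, smul_smul, hx]
  have hcomap : Integrable (fun x : ({0}ᶜ : Set (Space (n + 1))) => f x)
      (Measure.comap Subtype.val volume) := by
    have := (integrableOn_iff_comap_subtypeVal (f := f) (μ := volume)
      (measurableSet_singleton (0 : Space (n + 1))).compl).1 hf.integrableOn
    exact this
  have hgint : Integrable g (σ.prod (Measure.volumeIoiPow (Module.finrank ℝ (Space (n + 1)) - 1))) := by
    rw [← hmp.integrable_comp_emb hemb, hgf]
    exact hcomap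
  have h1 : ∫ x, f x = ∫ p, g p ∂(σ.prod (Measure.volumeIoiPow (Module.finrank ℝ (Space (n + 1)) - 1))) := by
    rw [← hmp.integral_comp hemb]
    change _ = ∫ x, (g ∘ homeomorphUnitSphereProd (Space (n + 1))) x ∂_
    rw [hgf, integral_subtype_comap (measurableSet_singleton _).compl fun x ↦ f x,
        restrict_compl_singleton]
  rw [h1, integral_prod_symm _ hgint, finrank_euclideanSpace_fin, Nat.add_sub_cancel]
  simp only [Measure.volumeIoiPow, ENNReal.ofReal]
  rw [integral_withDensity_eq_integral_smul (by fun_prop),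
    integral_subtype_comap measurableSet_Ioi fun a : ℝ ↦
      Real.toNNReal (a ^ n) • ∫ y : Metric.sphere (0 : Space (n + 1)) 1, f (a • (y : Space (n + 1))) ∂σ]
  refine setIntegral_congr_fun measurableSet_Ioi fun x hx ↦ ?_
  simp only [NNReal.smul_def]
  rw [Real.coe_toNNReal _ (pow_nonneg (le_of_lt hx) _)]

/-- The slices of a ball in `ℝ³` are discs of area `π (R² - u²)`. -/
lemma integral_ball_cexp_inner (ξ : Space 3) (R : ℝ) (hR : 0 < R) :
    ∫ x in Metric.ball (0 : Space 3) R, Complex.exp (-(Complex.I * ((inner ℝ ξ x : ℝ) : ℂ))) =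
      ∫ u in -R..R, ((Real.pi * (R ^ 2 - u ^ 2) : ℝ) : ℂ) *
        Complex.exp (-(Complex.I * ((‖ξ‖ * u : ℝ) : ℂ))) := by
  set ρ : ℝ → ℝ≥0∞ := fun r => if r < R ^ 2 then 1 else 0 with hρ
  have hlt : ∀ x : Space 3, ‖x‖ < R ↔ ‖x‖ ^ 2 < R ^ 2 := fun x =>
    (sq_lt_sq₀ (norm_nonneg _) hR.le).symm
  have hk : (volume : Measure (Space 3)).restrict (Metric.ball 0 R) =
      (volume : Measure (Space 3)).withDensity fun x => ρ (‖x‖ ^ 2) := by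
    rw [← withDensity_indicator_one measurableSet_ball]
    congr 1
    funext x
    simp [hρ, ← hlt, Set.indicator]
  have h := fourierMeas_withDensity_radial ρ
    (Measurable.ite measurableSet_Iio measurable_const measurable_const) ξ
  rw [← hk] at h
  change fourierMeas _ ξ = _
  rw [h]
  have hden : (fun u : ℝ => ∫⁻ y : Space 2, ρ (u ^ 2 + ‖y‖ ^ 2)) =
      (Set.Ioo (-R) R).indicator (fun u => ENNReal.ofReal (Real.pi * (R ^ 2 - u ^ 2))) := by
    funext u
    have hball : ∫⁻ y : Space 2, ρ (u ^ 2 + ‖y‖ ^ 2) =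
        volume (Metric.ball (0 : Space 2) (Real.sqrt (R ^ 2 - u ^ 2))) := by
      rw [← lintegral_indicator_one measurableSet_ball]
      refine lintegral_congr fun y => ?_
      have : u ^ 2 + ‖y‖ ^ 2 < R ^ 2 ↔ y ∈ Metric.ball (0 : Space 2) (Real.sqrt (R ^ 2 - u ^ 2)) := by
        rw [mem_ball_zero_iff, Real.lt_sqrt (norm_nonneg _), lt_sub_iff_add_lt']
      simp [hρ, this, Set.indicator]
    rw [hball, EuclideanSpace.volume_ball_fin_two]
    by_cases hu : u ∈ Set.Ioo (-R) R
    · have hpos : 0 ≤ R ^ 2 - u ^ 2 := by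
        have := sq_lt_sq.2 ((abs_lt.2 hu).trans_le (le_abs_self R)); linarith
      rw [Set.indicator_of_mem hu, ← ENNReal.ofReal_pow (by positivity), Real.sq_sqrt hpos,
        ← ENNReal.ofReal_mul hpos, mul_comm]
    · have hneg : R ^ 2 - u ^ 2 ≤ 0 := by
        have : ¬ u ^ 2 < R ^ 2 := by rwa [sq_lt_sq, abs_of_pos hR, abs_lt]
        linarith
      rw [Set.indicator_of_notMem hu, Real.sqrt_eq_zero_of_nonpos hneg]
      simp
  rw [hden, withDensity_indicator measurableSet_Ioo,
    integral_withDensity_eq_integral_toReal_smul (by fun_prop) (by simp),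
    intervalIntegral.integral_of_le (by linarith), integral_Ioc_eq_integral_Ioo]
  refine setIntegral_congr_fun measurableSet_Ioo fun u hu => ?_
  have hpos : 0 ≤ R ^ 2 - u ^ 2 := by
    have := sq_lt_sq.2 ((abs_lt.2 hu).trans_le (le_abs_self R)); linarith
  rw [ENNReal.toReal_ofReal (by positivity), Complex.real_smul]

/-- The slice area vanishes at `u = ±R`, so the moving endpoints contribute nothing, and only the
factor `R²` is differentiated: the derivative is `2πR` times the integral of the exponential over
`[-R, R]`. -/
lemma hasDerivAt_integral_slices (c R : ℝ) :
    HasDerivAt (fun R : ℝ => ∫ u in -R..R, ((Real.pi * (R ^ 2 - u ^ 2) : ℝ) : ℂ) *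
        Complex.exp (-(Complex.I * ((c * u : ℝ) : ℂ))))
      ((4 * Real.pi * R ^ 2 * Real.sinc (R * c) : ℝ) : ℂ) R := by
  set E : ℝ → ℂ := fun u => Complex.exp (-(Complex.I * ((c * u : ℝ) : ℂ))) with hE
  have hEc : Continuous E := by fun_prop
  -- Folding onto `[0, R]` leaves a single moving endpoint, so that the fundamental theorem of
  -- calculus applies.
  have hsym : ∀ (g : ℝ → ℂ), Continuous g → ∀ R : ℝ,
      ∫ u in -R..R, g u = ∫ u in (0 : ℝ)..R, (g u + g (-u)) := by
    intro g hg R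
    rw [← intervalIntegral.integral_add_adjacent_intervals (b := 0)
      (hg.intervalIntegrable _ _) (hg.intervalIntegrable _ _),
      intervalIntegral.integral_add (hg.intervalIntegrable _ _)
        ((by fun_prop : Continuous fun u => g (-u)).intervalIntegrable _ _),
      intervalIntegral.integral_comp_neg, neg_zero, add_comm]
  set S : ℝ → ℂ := fun u => E u + E (-u) with hS
  have hSc : Continuous S := by fun_prop
  have hJ : (fun R : ℝ => ∫ u in -R..R, ((Real.pi * (R ^ 2 - u ^ 2) : ℝ) : ℂ) * E u) =
      fun R : ℝ => (Real.pi : ℂ) * ((R : ℂ) ^ 2 * (∫ u in (0 : ℝ)..R, S u) -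
        ∫ u in (0 : ℝ)..R, (u : ℂ) ^ 2 * S u) := by
    funext R
    rw [hsym _ (by fun_prop), ← intervalIntegral.integral_const_mul,
      ← intervalIntegral.integral_sub ((by fun_prop : Continuous _).intervalIntegrable _ _)
      ((by fun_prop : Continuous _).intervalIntegrable _ _), ← intervalIntegral.integral_const_mul]
    refine intervalIntegral.integral_congr fun u _ => ?_
    simp only [hS]
    push_cast
    ring
  have hA := hSc.integral_hasStrictDerivAt 0 R |>.hasDerivAt
  have hB := (by fun_prop : Continuous fun u : ℝ => (u : ℂ) ^ 2 * S u).integral_hasStrictDerivAt 0 R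
    |>.hasDerivAt
  have hR2 : HasDerivAt (fun R : ℝ => (R : ℂ) ^ 2) (2 * (R : ℂ)) R := by
    simpa using (HasDerivAt.ofReal_comp (hasDerivAt_id R)).fun_pow 2
  rw [hJ]
  convert! ((hR2.mul hA).sub hB).const_mul (Real.pi : ℂ) using 1
  rw [← hsym E hEc, integral_cexp_neg_I_mul]
  push_cast
  ring

/-- The sphere is the derivative of the ball with respect to its radius. The Fourier integral over
the ball is computed once by slices and once by shells, and the two derivatives at radius `t` are
compared. -/
lemma integral_toSphere_cexp_inner (ξ : Space 3) (t : ℝ) (ht : 0 < t) :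
    ∫ y : Metric.sphere (0 : Space 3) 1,
      Complex.exp (-(Complex.I * ((inner ℝ ξ (t • (y : Space 3)) : ℝ) : ℂ)))
        ∂(volume : Measure (Space 3)).toSphere =
      ((4 * Real.pi * Real.sinc (t * ‖ξ‖) : ℝ) : ℂ) := by
  set σ := (volume : Measure (Space 3)).toSphere
  set Φ : ℝ → ℂ := fun r => ∫ y : Metric.sphere (0 : Space 3) 1,
      Complex.exp (-(Complex.I * ((inner ℝ ξ (r • (y : Space 3)) : ℝ) : ℂ))) ∂σ with hΦ
  have hΦc : Continuous Φ := by
    refine continuous_of_dominated (bound := fun _ => 1) (fun r => ?_) (fun r => ?_)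
      (integrable_const _) ?_
    · exact (by fun_prop : Continuous _).aestronglyMeasurable
    · refine ae_of_all _ fun y => ?_
      rw [Complex.norm_exp]; simp
    · exact ae_of_all _ fun y => by fun_prop
  have key : ∀ R : ℝ, 0 < R → ∫ u in -R..R, ((Real.pi * (R ^ 2 - u ^ 2) : ℝ) : ℂ) *
        Complex.exp (-(Complex.I * ((‖ξ‖ * u : ℝ) : ℂ))) =
      ∫ r in (0 : ℝ)..R, ((r ^ 2 : ℝ) : ℂ) * Φ r := by
    intro R hR
    rw [← integral_ball_cexp_inner ξ R hR, ← integral_indicator measurableSet_ball,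
      integral_eq_integral_polar]
    · rw [intervalIntegral.integral_of_le hR.le, integral_Ioc_eq_integral_Ioo,
        ← integral_indicator measurableSet_Ioi, ← integral_indicator measurableSet_Ioo]
      congr 1
      funext r
      by_cases hr : 0 < r
      · rw [Set.indicator_of_mem (Set.mem_Ioi.2 hr)]
        have hmem : ∀ y : Metric.sphere (0 : Space 3) 1,
            r • (y : Space 3) ∈ Metric.ball (0 : Space 3) R ↔ r < R := by
          intro y
          rw [mem_ball_zero_iff, norm_smul, norm_eq_of_mem_sphere, Real.norm_eq_abs,
            abs_of_pos hr, mul_one]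
        by_cases hrR : r < R
        · rw [Set.indicator_of_mem (Set.mem_Ioo.2 ⟨hr, hrR⟩), Complex.real_smul]
          congr 1
          refine integral_congr_ae (ae_of_all _ fun y => ?_)
          exact Set.indicator_of_mem ((hmem y).2 hrR) _
        · rw [Set.indicator_of_notMem (fun h => hrR h.2)]
          simp [Set.indicator, hmem, hrR, -Metric.mem_ball]
      · rw [Set.indicator_of_notMem (show r ∉ Set.Ioi (0 : ℝ) from hr),
          Set.indicator_of_notMem (show r ∉ Set.Ioo (0 : ℝ) R from fun h => hr h.1)]
    · rw [integrable_indicator_iff measurableSet_ball]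
      refine IntegrableOn.of_bound (C := 1) measure_ball_lt_top ?_ ?_
      · exact (by fun_prop : Continuous _).aestronglyMeasurable
      · refine ae_of_all _ fun y => ?_
        rw [Complex.norm_exp]; simp
  have hd1 := (hasDerivAt_integral_slices ‖ξ‖ t)
  have hd2 := ((by fun_prop : Continuous fun r : ℝ => ((r ^ 2 : ℝ) : ℂ) * Φ r).integral_hasStrictDerivAt
    0 t).hasDerivAt
  have hEq := hd1.unique (hd2.congr_of_eventuallyEq
    ((eventually_gt_nhds ht).mono fun R hR => key R hR))
  change Φ t = _
  have ht' : (t : ℂ) ^ 2 ≠ 0 := by exact_mod_cast (pow_pos ht 2).ne'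
  apply mul_left_cancel₀ ht'
  rw [show (t : ℂ) ^ 2 * Φ t = ((t ^ 2 : ℝ) : ℂ) * Φ t by push_cast; rfl, ← hEq]
  push_cast
  ring

lemma fourierMeas_waveKernel_three (t : ℝ) (ht : 0 < t) (ξ : Space 3) :
    fourierMeas (waveKernel 3 t) ξ = ((t * Real.sinc (t * ‖ξ‖) : ℝ) : ℂ) := by
  simp only [fourierMeas, waveKernel, sphereMeasure]
  rw [integral_smul_measure, integral_smul_measure, integral_map (by fun_prop)
    (by fun_prop : Continuous _).aestronglyMeasurable, integral_toSphere_cexp_inner ξ t ht,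
    ENNReal.toReal_ofReal (by positivity), ENNReal.toReal_ofReal (by positivity),
    Complex.real_smul, Complex.real_smul]
  have : (t : ℂ) ≠ 0 := by exact_mod_cast ht.ne'
  push_cast
  field_simp

/-! ### The symbol of the equation and of the integrand. -/

/-- The Fourier transform of the fundamental solution, as a function of time and frequency. -/
def Equation.symbol (eqn : Equation) {d : ℕ} (r : ℝ) (ξ : Space d) : ℝ :=
  match eqn with
  | .wave => r * Real.sinc (r * ‖ξ‖)
  | .heat => Real.exp (-(r * ‖ξ‖ ^ 2 / 2))

/-- The dimensions in which the fundamental solution is considered. -/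
def Equation.Admissible (eqn : Equation) (d : ℕ) : Prop :=
  1 ≤ d ∧ (eqn = .wave → d ≤ 3)

lemma Equation.fourierMeas_kernel {eqn : Equation} {d : ℕ} (h : eqn.Admissible d) {t : ℝ}
    (ht : 0 < t) (ξ : Space d) : fourierMeas (eqn.kernel d t) ξ = (eqn.symbol t ξ : ℂ) := by
  cases eqn with
  | heat => exact fourierMeas_heatKernel d t ht ξ
  | wave =>
    obtain ⟨h1, h2⟩ := h
    have h3 := h2 rfl
    interval_cases d
    · exact fourierMeas_waveKernel_one t ht ξ
    · exact fourierMeas_waveKernel_two t ht ξ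
    · exact fourierMeas_waveKernel_three t ht ξ

/-- The Fourier transform of the integrand of the stochastic convolution at `(t, x)`. -/
def Equation.convSymbol (eqn : Equation) {d : ℕ} (t : ℝ) (x : Space d) (s : ℝ) (ξ : Space d) : ℂ :=
  (Set.Ico 0 t).indicator
    (fun s => Complex.exp (-(Complex.I * ((inner ℝ ξ x : ℝ) : ℂ))) * (eqn.symbol (t - s) ξ : ℂ)) s

lemma Equation.fourierMeas_integrand {eqn : Equation} {d : ℕ} (h : eqn.Admissible d) (t : ℝ)
    (x : Space d) (s : ℝ) (ξ : Space d) :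
    fourierMeas (eqn.integrand d t x s) ξ = eqn.convSymbol t x s ξ := by
  unfold Equation.integrand Equation.convSymbol
  by_cases hs : 0 ≤ s ∧ s < t
  · rw [if_pos hs, Set.indicator_of_mem (Set.mem_Ico.2 hs), ← fourierMeas_kernel h (sub_pos.2 hs.2)]
    -- The transform of the kernel is real, hence equal to its conjugate. This absorbs the
    -- reflection in `z ↦ x - z`.
    have hreal : fourierMeas (eqn.kernel d (t - s)) ξ =
        (starRingEnd ℂ) (fourierMeas (eqn.kernel d (t - s)) ξ) := by
      rw [fourierMeas_kernel h (sub_pos.2 hs.2), Complex.conj_ofReal]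
    rw [hreal]
    unfold fourierMeas
    rw [integral_map (by fun_prop) (by fun_prop : Continuous _).aestronglyMeasurable,
      ← integral_conj, ← integral_const_mul]
    congr 1
    funext z
    rw [← Complex.exp_conj, ← Complex.exp_add]
    congr 1
    simp only [inner_sub_right, map_neg, map_mul, Complex.conj_I, Complex.conj_ofReal]
    push_cast
    ring
  · rw [if_neg hs, Set.indicator_of_notMem (fun h' => hs (Set.mem_Ico.1 h'))]
    simp [fourierMeas]

/-- The total mass is read off from the transform at frequency `0`: for infinite mass the integral
of the constant `1` would take the default value `0`, whereas the symbol at `0` is `t - s` or `1`.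
-/
lemma Equation.isFiniteMeasure_integrand {eqn : Equation} {d : ℕ} (h : eqn.Admissible d) (t : ℝ)
    (x : Space d) (s : ℝ) : IsFiniteMeasure (eqn.integrand d t x s) := by
  unfold Equation.integrand
  split_ifs with hs
  · have : IsFiniteMeasure (eqn.kernel d (t - s)) := by
      by_contra hinf
      have h0 : 0 < t - s := sub_pos.2 hs.2
      have h1 := fourierMeas_kernel h h0 0
      have htop : eqn.kernel d (t - s) Set.univ = ∞ := by
        by_contra hne
        exact hinf ⟨lt_top_iff_ne_top.2 hne⟩
      have h2 : fourierMeas (eqn.kernel d (t - s)) 0 = 0 := by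
        simp [fourierMeas, Measure.real, htop]
      rw [h2] at h1
      cases eqn with
      | wave =>
        have h3 : ((t - s : ℝ) : ℂ) ≠ 0 := by exact_mod_cast h0.ne'
        simp only [symbol, norm_zero, mul_zero, Real.sinc_zero, mul_one] at h1
        exact h3 h1.symm
      | heat => simp [symbol] at h1
    infer_instance
  · infer_instance

lemma Equation.continuous_symbol (eqn : Equation) {d : ℕ} :
    Continuous fun p : ℝ × Space d => eqn.symbol p.1 p.2 := by
  have := Real.continuous_sinc
  cases eqn <;> simp only [symbol] <;> fun_prop

lemma Equation.abs_symbol_le (eqn : Equation) {d : ℕ} {r : ℝ} (hr : 0 ≤ r) (ξ : Space d) :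
    |eqn.symbol r ξ| ≤ 1 + r := by
  cases eqn with
  | wave =>
    simp only [symbol, abs_mul, abs_of_nonneg hr]
    nlinarith [Real.abs_sinc_le_one (r * ‖ξ‖), abs_nonneg (Real.sinc (r * ‖ξ‖))]
  | heat =>
    simp only [symbol, Real.abs_exp]
    have : Real.exp (-(r * ‖ξ‖ ^ 2 / 2)) ≤ 1 := Real.exp_le_one_iff.2 (by
      have : 0 ≤ r * ‖ξ‖ ^ 2 / 2 := by positivity
      linarith)
    linarith

lemma Equation.measurable_convSymbol (eqn : Equation) {d : ℕ} (t : ℝ) (x : Space d) :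
    Measurable fun p : ℝ × Space d => eqn.convSymbol t x p.1 p.2 := by
  have hc : Continuous fun p : ℝ × Space d => eqn.symbol (t - p.1) p.2 :=
    eqn.continuous_symbol.comp (f := fun p : ℝ × Space d => (t - p.1, p.2)) (by fun_prop)
  have : (fun p : ℝ × Space d => eqn.convSymbol t x p.1 p.2) =
      (Prod.fst ⁻¹' Set.Ico 0 t).indicator fun p : ℝ × Space d =>
        Complex.exp (-(Complex.I * ((inner ℝ p.2 x : ℝ) : ℂ))) * (eqn.symbol (t - p.1) p.2 : ℂ) := by
    funext p
    simp [convSymbol, Set.indicator]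
  rw [this]
  refine Measurable.indicator ?_ (measurableSet_Ico.preimage measurable_fst)
  exact (by fun_prop : Continuous _).measurable

lemma norm_cexp_neg_I_mul (r : ℝ) : ‖Complex.exp (-(Complex.I * (r : ℂ)))‖ = 1 := by
  rw [Complex.norm_exp]; simp

lemma Equation.norm_convSymbol (eqn : Equation) {d : ℕ} (t : ℝ) (x : Space d) (s : ℝ)
    (ξ : Space d) :
    ‖eqn.convSymbol t x s ξ‖ = (Set.Ico 0 t).indicator (fun s => |eqn.symbol (t - s) ξ|) s := by
  unfold convSymbol
  by_cases hs : s ∈ Set.Ico 0 t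
  · simp only [Set.indicator_of_mem hs, norm_mul, norm_cexp_neg_I_mul, one_mul, Complex.norm_real,
      Real.norm_eq_abs]
  · simp only [Set.indicator_of_notMem hs, norm_zero]

/-! ### Fourier transforms of test functions. -/

lemma norm_fourierFun_le_integral {d : ℕ} (f : Space d → ℝ) (ξ : Space d) :
    ‖fourierFun f ξ‖ ≤ ∫ x, ‖f x‖ := by
  refine (norm_integral_le_integral_norm _).trans (le_of_eq ?_)
  refine integral_congr_ae (ae_of_all _ fun x => ?_)
  simp only [norm_mul, norm_cexp_neg_I_mul, one_mul, Complex.norm_real]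

lemma fourierFun_eq_fourier {d : ℕ} (f : Space d → ℝ) (w : Space d) :
    fourierFun f ((2 * Real.pi) • w) = FourierTransform.fourier (fun x => (f x : ℂ)) w := by
  rw [Real.fourier_eq']
  unfold fourierFun
  congr 1
  funext x
  rw [smul_eq_mul, real_inner_smul_left, real_inner_comm]
  congr 2
  push_cast
  ring

/-- The Fourier transform of a `C¹` function with compact support decays at least linearly. -/
lemma norm_mul_norm_fourierFun_le {d : ℕ} (f : Space d → ℝ) (hf : ContDiff ℝ 1 f)
    (hc : HasCompactSupport f) (ξ : Space d) :
    ‖ξ‖ * ‖fourierFun f ξ‖ ≤ ∫ x, ‖fderiv ℝ f x‖ := by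
  set g : Space d → ℂ := fun x => (f x : ℂ) with hg
  have hgd : ∀ x, HasFDerivAt g (Complex.ofRealCLM.comp (fderiv ℝ f x)) x := fun x =>
    Complex.ofRealCLM.hasFDerivAt.comp x ((hf.differentiable one_ne_zero) x).hasFDerivAt
  have hgd' : fderiv ℝ g = fun x => Complex.ofRealCLM.comp (fderiv ℝ f x) :=
    funext fun x => (hgd x).fderiv
  have hfd : Continuous (fderiv ℝ f) := hf.continuous_fderiv one_ne_zero
  have hint : Integrable g := (hf.continuous.integrable_of_hasCompactSupport hc).ofReal
  have hint' : Integrable (fderiv ℝ g) := by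
    rw [hgd']
    exact (ContinuousLinearMap.compL ℝ (Space d) ℝ ℂ Complex.ofRealCLM).integrable_comp
      (hfd.integrable_of_hasCompactSupport (hc.fderiv (𝕜 := ℝ)))
  have hle : ∫ x, ‖fderiv ℝ g x‖ ≤ ∫ x, ‖fderiv ℝ f x‖ := by
    refine integral_mono hint'.norm
      (hfd.integrable_of_hasCompactSupport (hc.fderiv (𝕜 := ℝ))).norm fun x => ?_
    rw [hgd']
    refine (ContinuousLinearMap.opNorm_comp_le _ _).trans ?_
    simp
  by_cases hξ : ξ = 0
  · rw [hξ, norm_zero, zero_mul]; exact integral_nonneg fun x => norm_nonneg _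
  -- The rescaling passes from the phase `e^{-i⟨ξ,x⟩}` to the phase `e^{-2πi⟨w,x⟩}`.
  set w := (2 * Real.pi)⁻¹ • ξ with hw
  have hξw : ξ = (2 * Real.pi) • w := by
    rw [hw, smul_smul, mul_inv_cancel₀ (by positivity), one_smul]
  have hw0 : 0 < ‖w‖ := norm_pos_iff.2 fun h => hξ (by rw [hξw, h, smul_zero])
  have h := congrFun (Real.fourier_fderiv hint (fun x => (hgd x).differentiableAt) hint') w
  have h2 := congrArg (fun A : Space d →L[ℝ] ℂ => ‖A w‖) h
  simp only [VectorFourier.fourierSMulRight_apply] at h2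
  have h3 : ‖(FourierTransform.fourier (fderiv ℝ g) w) w‖ ≤ (∫ x, ‖fderiv ℝ g x‖) * ‖w‖ :=
    (ContinuousLinearMap.le_opNorm _ _).trans (mul_le_mul_of_nonneg_right
      (VectorFourier.norm_fourierIntegral_le_integral_norm _ _ _ _ _) (norm_nonneg _))
  rw [h2] at h3
  simp only [neg_apply, neg_smul, norm_neg, norm_smul, norm_mul, Complex.norm_I, Complex.norm_real,
    Complex.norm_ofNat, Real.norm_eq_abs, abs_of_pos Real.pi_pos, mul_one] at h3
  rw [show ((innerSL ℝ) w) w = ‖w‖ ^ 2 from real_inner_self_eq_norm_sq w,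
    abs_of_nonneg (sq_nonneg _)] at h3
  rw [← fourierFun_eq_fourier, ← hξw] at h3
  have h4 : ‖ξ‖ = 2 * Real.pi * ‖w‖ := by
    rw [hξw, norm_smul, Real.norm_eq_abs, abs_of_pos (by positivity)]
  rw [h4]
  refine le_trans ?_ hle
  refine le_of_mul_le_mul_right ?_ hw0
  calc _ = 2 * Real.pi * (‖w‖ ^ 2 * ‖fourierFun f ξ‖) := by ring
    _ ≤ _ := h3

namespace TestFun

variable {d : ℕ}

lemma exists_eq_smooth (φ : TestFun d) {t : ℝ} (ht : 0 ≤ t) :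
    ContDiff ℝ 1 (φ.toFun t) ∧ HasCompactSupport (φ.toFun t) := by
  obtain ⟨ψ, hψ, hc, h⟩ := φ.smooth_compact
  have heq : φ.toFun t = fun x => ψ (t, x) := funext fun x => h t ht x
  rw [heq]
  refine ⟨(hψ.of_le (by exact_mod_cast le_top)).comp (contDiff_const.prodMk contDiff_id), ?_⟩
  have hK : IsCompact (Prod.snd '' tsupport ψ) := hc.isCompact.image continuous_snd
  refine HasCompactSupport.intro hK fun x hx => ?_
  by_contra hne
  exact hx ⟨(t, x), subset_tsupport _ hne, rfl⟩

lemma measurable_uncurry (φ : TestFun d) : Measurable (Function.uncurry φ.toFun) := by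
  obtain ⟨ψ, hψ, hc, h⟩ := φ.smooth_compact
  have : Function.uncurry φ.toFun = (Prod.fst ⁻¹' Set.Ici (0 : ℝ)).indicator ψ := by
    funext ⟨t, x⟩
    by_cases ht : 0 ≤ t
    · rw [Set.indicator_of_mem (show (t, x) ∈ Prod.fst ⁻¹' Set.Ici (0 : ℝ) from ht)]
      exact h t ht x
    · rw [Set.indicator_of_notMem (show (t, x) ∉ Prod.fst ⁻¹' Set.Ici (0 : ℝ) from ht)]
      exact φ.eq_zero_of_neg t (not_le.1 ht) x
  rw [this]
  exact hψ.continuous.measurable.indicator (measurableSet_Ici.preimage measurable_fst)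

/-- The partial Fourier transform of a test function, as a function on space-time. -/
def ft (φ : TestFun d) (p : ℝ × Space d) : ℂ := fourierFun (φ.toFun p.1) p.2

lemma measurable_ft (φ : TestFun d) : Measurable φ.ft := by
  unfold ft fourierFun
  refine (StronglyMeasurable.integral_prod_right'
    (f := fun q : (ℝ × Space d) × Space d =>
      Complex.exp (-(Complex.I * ((inner ℝ q.1.2 q.2 : ℝ) : ℂ))) * (φ.toFun q.1.1 q.2 : ℂ))
      ?_).measurable
  refine Measurable.stronglyMeasurable ?_
  refine Measurable.mul (by fun_prop) (Complex.measurable_ofReal.comp ?_)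
  exact φ.measurable_uncurry.comp (f := fun q : (ℝ × Space d) × Space d => (q.1.1, q.2))
    (by fun_prop)

/-- One power of decay in `ξ` is enough, because its square is comparable to Dalang's weight. It
comes from sup bounds on a smooth extension and its derivative, multiplied by the volume of a ball
containing the support. -/
lemma exists_norm_ft_le (φ : TestFun d) : ∃ C R : ℝ, 0 ≤ C ∧ ∀ p : ℝ × Space d,
    ‖φ.ft p‖ ≤ (Set.Icc 0 R).indicator (fun _ => C / (1 + ‖p.2‖)) p.1 := by
  obtain ⟨ψ, hψ, hc, h⟩ := φ.smooth_compact
  have hψ1 : ContDiff ℝ 1 ψ := hψ.of_le (by exact_mod_cast le_top)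
  obtain ⟨R, hR⟩ := hc.isCompact.isBounded.subset_closedBall 0
  obtain ⟨A, hA⟩ := hψ.continuous.bounded_above_of_compact_support hc
  obtain ⟨B, hB⟩ := (hψ1.continuous_fderiv one_ne_zero).bounded_above_of_compact_support
    (hc.fderiv (𝕜 := ℝ))
  have hA0 : 0 ≤ A := (norm_nonneg _).trans (hA 0)
  have hB0 : 0 ≤ B := (norm_nonneg _).trans (hB 0)
  set V := (volume : Measure (Space d)).real (Metric.closedBall 0 R)
  have hV0 : 0 ≤ V := measureReal_nonneg
  have hzero : ∀ t x, (t, x) ∉ Metric.closedBall (0 : ℝ × Space d) R → ψ (t, x) = 0 :=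
    fun t x hx => image_eq_zero_of_notMem_tsupport fun h' => hx (hR h')
  refine ⟨(A + B) * V, R, by positivity, fun ⟨t, ξ⟩ => ?_⟩
  by_cases ht : t ∈ Set.Icc 0 R
  · rw [Set.indicator_of_mem ht, le_div_iff₀ (by positivity), mul_comm, add_mul, one_mul]
    obtain ⟨hcd, hcs⟩ := φ.exists_eq_smooth ht.1
    have heq : φ.toFun t = fun x => ψ (t, x) := funext fun x => h t ht.1 x
    have hbound : ∀ (F : Space d → ℝ) (D : ℝ), Continuous F →
        (∀ x, 0 ≤ F x) → (∀ x, F x ≤ D) → (∀ x, x ∉ Metric.closedBall (0 : Space d) R → F x = 0) →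
        ∫ x, F x ≤ D * V := by
      intro F D hF hF0 hFD hFz
      rw [← setIntegral_eq_integral_of_forall_compl_eq_zero (s := Metric.closedBall 0 R) hFz]
      calc _ ≤ ∫ x in Metric.closedBall (0 : Space d) R, D :=
            integral_mono_of_nonneg (ae_of_all _ hF0)
              (integrableOn_const (measure_closedBall_lt_top.ne) ) (ae_of_all _ hFD)
        _ = D * V := by rw [setIntegral_const, smul_eq_mul, mul_comm]
    have hsnd : ∀ x, x ∉ Metric.closedBall (0 : Space d) R →
        (t, x) ∉ Metric.closedBall (0 : ℝ × Space d) R := by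
      intro x hx hx'
      refine hx ?_
      rw [mem_closedBall_zero_iff] at hx' ⊢
      exact (le_max_right _ _).trans hx'
    rw [add_mul]
    refine add_le_add ?_ ?_
    · refine (norm_fourierFun_le_integral _ _).trans (hbound _ A ?_ (fun _ => norm_nonneg _) ?_ ?_)
      · exact hcd.continuous.norm
      · intro x; rw [heq]; exact hA _
      · intro x hx; rw [heq]; simp [hzero t x (hsnd x hx)]
    · refine (norm_mul_norm_fourierFun_le _ hcd hcs ξ).trans
        (hbound _ B ?_ (fun _ => norm_nonneg _) ?_ ?_)
      · exact (hcd.continuous_fderiv one_ne_zero).norm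
      · intro x
        have hder : HasFDerivAt (φ.toFun t)
            ((fderiv ℝ ψ (t, x)).comp (ContinuousLinearMap.inr ℝ ℝ (Space d))) x := by
          rw [heq]
          exact ((hψ1.differentiable one_ne_zero) (t, x)).hasFDerivAt.comp x
            (hasFDerivAt_prodMk_right t x)
        rw [hder.fderiv]
        refine (ContinuousLinearMap.opNorm_comp_le _ _).trans ?_
        calc _ ≤ B * 1 := mul_le_mul (hB _) (ContinuousLinearMap.norm_inr_le_one ℝ ℝ (Space d))
              (norm_nonneg _) hB0
          _ = B := mul_one B
      · intro x hx
        have : φ.toFun t =ᶠ[𝓝 x] fun _ => 0 := by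
          filter_upwards [Metric.isClosed_closedBall.isOpen_compl.mem_nhds hx] with y hy
          rw [heq]
          exact hzero t y (hsnd y hy)
        rw [this.fderiv_eq]
        simp
  · rw [Set.indicator_of_notMem ht]
    have : φ.toFun t = fun _ => 0 := by
      funext x
      by_cases ht0 : 0 ≤ t
      · rw [h t ht0]
        refine hzero t x fun hx => ht ⟨ht0, ?_⟩
        rw [mem_closedBall_zero_iff] at hx
        exact (le_abs_self t).trans ((le_max_left _ _).trans hx)
      · exact φ.eq_zero_of_neg t (not_le.1 ht0) x
    simp [ft, this, fourierFun]

instance : Add (TestFun d) where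
  add φ ψ :=
    { toFun := fun t x => φ.toFun t x + ψ.toFun t x
      eq_zero_of_neg := fun t ht x => by rw [φ.eq_zero_of_neg t ht, ψ.eq_zero_of_neg t ht, add_zero]
      smooth_compact := by
        obtain ⟨f, hf, hfc, h⟩ := φ.smooth_compact
        obtain ⟨g, hg, hgc, h'⟩ := ψ.smooth_compact
        exact ⟨f + g, hf.add hg, hfc.add hgc, fun t ht x => by
          rw [h t ht, h' t ht]; rfl⟩ }

instance : SMul ℝ (TestFun d) where
  smul c φ :=
    { toFun := fun t x => c * φ.toFun t x
      eq_zero_of_neg := fun t ht x => by rw [φ.eq_zero_of_neg t ht, mul_zero]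
      smooth_compact := by
        obtain ⟨f, hf, hfc, h⟩ := φ.smooth_compact
        exact ⟨fun p => c * f p, contDiff_const.mul hf, hfc.mul_left (f := fun _ => c), fun t ht x => by
          rw [h t ht]⟩ }

lemma integrable_fourier (φ : TestFun d) (t : ℝ) (ξ : Space d) :
    Integrable fun x => Complex.exp (-(Complex.I * ((inner ℝ ξ x : ℝ) : ℂ))) * (φ.toFun t x : ℂ) := by
  by_cases ht : 0 ≤ t
  · obtain ⟨h1, h2⟩ := φ.exists_eq_smooth ht
    refine ((h1.continuous.integrable_of_hasCompactSupport h2).ofReal (𝕜 := ℂ)).bdd_mul (c := 1)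
      (by fun_prop : Continuous _).aestronglyMeasurable (ae_of_all _ fun x => ?_)
    rw [norm_cexp_neg_I_mul]
  · have : φ.toFun t = fun _ => 0 := funext fun x => φ.eq_zero_of_neg t (not_le.1 ht) x
    simp [this]

lemma ft_add (φ ψ : TestFun d) (p : ℝ × Space d) : (φ + ψ).ft p = φ.ft p + ψ.ft p := by
  unfold ft fourierFun
  rw [← integral_add (φ.integrable_fourier _ _) (ψ.integrable_fourier _ _)]
  congr 1
  funext x
  change _ * ((φ.toFun p.1 x + ψ.toFun p.1 x : ℝ) : ℂ) = _
  push_cast; ring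

lemma ft_smul (c : ℝ) (φ : TestFun d) (p : ℝ × Space d) : (c • φ).ft p = (c : ℂ) * φ.ft p := by
  unfold ft fourierFun
  rw [← integral_const_mul]
  congr 1
  funext x
  change _ * ((c * φ.toFun p.1 x : ℝ) : ℂ) = _
  push_cast; ring

end TestFun

/-! ### The reference measure and the isometry of the noise. -/

/-- Dalang's condition `∫ μ(dξ) / (1 + |ξ|²) < ∞` on a spectral measure. -/
class IsDalang {d : ℕ} (μ : Measure (Space d)) : Prop where
  lintegral_lt_top : ∫⁻ ξ, ENNReal.ofReal (1 / (1 + ‖ξ‖ ^ 2)) ∂μ < ∞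

/-- Dalang's weight is bounded below on each ball, so Markov's inequality gives balls finite mass.
-/
instance {d : ℕ} (μ : Measure (Space d)) [hμ : IsDalang μ] : SigmaFinite μ := by
  have hfin : ∀ n : ℕ, μ (Metric.closedBall 0 n) < ∞ := by
    intro n
    have hpos : 0 < ENNReal.ofReal (1 / (1 + (n : ℝ) ^ 2)) := ENNReal.ofReal_pos.2 (by positivity)
    have h := meas_ge_le_lintegral_div (μ := μ)
      (f := fun ξ => ENNReal.ofReal (1 / (1 + ‖ξ‖ ^ 2))) (by fun_prop) hpos.ne' ENNReal.ofReal_ne_top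
    refine (measure_mono fun ξ hξ => ?_).trans_lt
      (h.trans_lt (ENNReal.div_lt_top hμ.lintegral_lt_top.ne hpos.ne'))
    rw [mem_closedBall_zero_iff] at hξ
    exact ENNReal.ofReal_le_ofReal (by gcongr)
  exact ⟨⟨⟨fun n => Metric.closedBall 0 n, fun _ => trivial, hfin, Metric.iUnion_closedBall_nat 0⟩⟩⟩

/-- The reference measure `dt μ(dξ)` on `[0,∞) × ℝ^d`. -/
def spaceTime {d : ℕ} (μ : Measure (Space d)) : Measure (ℝ × Space d) :=
  (volume.restrict (Set.Ici (0 : ℝ))).prod μ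

section

variable {d : ℕ} {μ : Measure (Space d)}

lemma sq_eLpNorm_two {α E : Type*} [MeasurableSpace α] [NormedAddCommGroup E] (ν : Measure α)
    (f : α → E) : eLpNorm f 2 ν ^ 2 = ∫⁻ a, ‖f a‖ₑ ^ 2 ∂ν := by
  rw [eLpNorm_eq_lintegral_rpow_enorm_toReal two_ne_zero ENNReal.ofNat_ne_top,
    ← ENNReal.rpow_natCast, ← ENNReal.rpow_mul]
  simp

lemma sq_eLpNorm_two_spaceTime [SigmaFinite μ] {f : ℝ × Space d → ℂ} (hf : Measurable f) :
    eLpNorm f 2 (spaceTime μ) ^ 2 = ∫⁻ t in Set.Ici (0 : ℝ), ∫⁻ ξ, ‖f (t, ξ)‖ₑ ^ 2 ∂μ := by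
  rw [sq_eLpNorm_two, spaceTime, lintegral_prod _ (by fun_prop)]

lemma memLp_two_of_norm_sq_le [IsDalang μ] {f : ℝ × Space d → ℂ}
    (hf : AEStronglyMeasurable f (spaceTime μ)) {C R : ℝ}
    (hle : ∀ p, ‖f p‖ ^ 2 ≤ (Set.Icc 0 R).indicator (fun _ => C * (1 / (1 + ‖p.2‖ ^ 2))) p.1) :
    MemLp f 2 (spaceTime μ) := by
  rw [memLp_two_iff_integrable_sq_norm hf]
  have h1 : Integrable (fun ξ : Space d => C * (1 / (1 + ‖ξ‖ ^ 2))) μ := by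
    refine Integrable.const_mul ⟨(by fun_prop : Measurable _).aestronglyMeasurable, ?_⟩ C
    rw [hasFiniteIntegral_iff_ofReal (ae_of_all _ fun ξ => by positivity)]
    exact IsDalang.lintegral_lt_top
  have h2 : Integrable (fun t => (Set.Icc 0 R).indicator (fun _ => (1 : ℝ)) t)
      (volume.restrict (Set.Ici (0 : ℝ))) :=
    (((integrableOn_const (by simp)).integrable_indicator measurableSet_Icc)).restrict
  refine (h2.mul_prod h1).mono' (hf.norm.pow 2) (ae_of_all _ fun p => ?_)
  rw [Real.norm_eq_abs, abs_of_nonneg (sq_nonneg _)]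
  refine (hle p).trans (le_of_eq ?_)
  by_cases hp : p.1 ∈ Set.Icc 0 R
  · simp [Set.indicator_of_mem hp]
  · simp [Set.indicator_of_notMem hp]

lemma TestFun.memLp_ft [IsDalang μ] (φ : TestFun d) : MemLp φ.ft 2 (spaceTime μ) := by
  obtain ⟨C, R, hC, h⟩ := φ.exists_norm_ft_le
  refine memLp_two_of_norm_sq_le (C := C ^ 2) (R := R) φ.measurable_ft.aestronglyMeasurable
    fun p => ?_
  refine (pow_le_pow_left₀ (norm_nonneg _) (h p) 2).trans ?_
  by_cases hp : p.1 ∈ Set.Icc 0 R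
  · rw [Set.indicator_of_mem hp, Set.indicator_of_mem hp, div_pow, div_eq_mul_one_div]
    gcongr
    nlinarith [norm_nonneg p.2]
  · simp [Set.indicator_of_notMem hp]

/-- Reverse triangle inequality, with truncated subtraction in `ℝ≥0∞` for the lower bound. -/
lemma tendsto_eLpNorm_of_tendsto_eLpNorm_sub {α E : Type*} [MeasurableSpace α]
    [NormedAddCommGroup E] {ν : Measure α} {f : ℕ → α → E} {g : α → E}
    (hf : ∀ n, MemLp (f n) 2 ν) (hg : MemLp g 2 ν)
    (h : Tendsto (fun n => eLpNorm (fun a => f n a - g a) 2 ν) atTop (𝓝 0)) :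
    Tendsto (fun n => eLpNorm (f n) 2 ν) atTop (𝓝 (eLpNorm g 2 ν)) := by
  have hlow : Tendsto (fun n => eLpNorm g 2 ν - eLpNorm (fun a => f n a - g a) 2 ν) atTop
      (𝓝 (eLpNorm g 2 ν)) := by
    simpa using ENNReal.Tendsto.sub (tendsto_const_nhds (x := eLpNorm g 2 ν)) h (Or.inr (by simp))
  have hup : Tendsto (fun n => eLpNorm g 2 ν + eLpNorm (fun a => f n a - g a) 2 ν) atTop
      (𝓝 (eLpNorm g 2 ν)) := by
    simpa using (tendsto_const_nhds (x := eLpNorm g 2 ν)).add h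
  refine tendsto_of_tendsto_of_tendsto_of_le_of_le hlow hup (fun n => ?_) (fun n => ?_)
  · rw [tsub_le_iff_right]
    have h1 : g = f n + fun a => -(f n a - g a) := by funext a; simp
    have h2 := eLpNorm_add_le (hf n).1 ((hf n).1.sub hg.1).neg one_le_two
    have h3 : eLpNorm (-(f n - g)) 2 ν = eLpNorm (fun a => f n a - g a) 2 ν := eLpNorm_neg _ _ _
    rw [h3] at h2
    exact (le_of_eq (congrArg (fun u => eLpNorm u 2 ν) h1)).trans h2
  · have h1 : f n = g + fun a => (f n a - g a) := by funext a; simp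
    exact (le_of_eq (congrArg (fun u => eLpNorm u 2 ν) h1)).trans
      (eLpNorm_add_le hg.1 ((hf n).1.sub hg.1) one_le_two)

end

namespace IsHomogeneousNoise

variable {d : ℕ} {μ : Measure (Space d)} [IsDalang μ] {Ω : Type*} [MeasurableSpace Ω]
  {P : Measure Ω} {W : TestFun d → Ω → ℝ}

omit [IsDalang μ] in
lemma memLp (hW : IsHomogeneousNoise μ P W) (φ : TestFun d) : MemLp (W φ) 2 P :=
  (hW.gaussian.hasGaussianLaw_eval φ).memLp_two

lemma covariance_eq (hW : IsHomogeneousNoise μ P W) (φ ψ : TestFun d) :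
    ((∫ ω, W φ ω * W ψ ω ∂P : ℝ) : ℂ) =
      ∫ p, φ.ft p * (starRingEnd ℂ) (ψ.ft p) ∂(spaceTime μ) := by
  rw [hW.covariance]
  have hint : Integrable (fun p => φ.ft p * (starRingEnd ℂ) (ψ.ft p)) (spaceTime μ) :=
    φ.memLp_ft.integrable_mul (MemLp.star ψ.memLp_ft)
  unfold spaceTime at hint ⊢
  rw [integral_prod _ hint]
  rfl

lemma covariance_add (hW : IsHomogeneousNoise μ P W) (φ φ' ψ : TestFun d) :
    ∫ ω, W (φ + φ') ω * W ψ ω ∂P = (∫ ω, W φ ω * W ψ ω ∂P) + ∫ ω, W φ' ω * W ψ ω ∂P := by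
  have h : ((∫ ω, W (φ + φ') ω * W ψ ω ∂P : ℝ) : ℂ) =
      ((∫ ω, W φ ω * W ψ ω ∂P : ℝ) : ℂ) + ((∫ ω, W φ' ω * W ψ ω ∂P : ℝ) : ℂ) := by
    rw [hW.covariance_eq, hW.covariance_eq, hW.covariance_eq, ← integral_add
      (f := fun p => φ.ft p * (starRingEnd ℂ) (ψ.ft p))
      (g := fun p => φ'.ft p * (starRingEnd ℂ) (ψ.ft p))
      (φ.memLp_ft.integrable_mul (MemLp.star ψ.memLp_ft))
      (φ'.memLp_ft.integrable_mul (MemLp.star ψ.memLp_ft))]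
    congr 1
    funext p
    rw [TestFun.ft_add, add_mul]
  exact_mod_cast h

lemma covariance_smul (hW : IsHomogeneousNoise μ P W) (c : ℝ) (φ ψ : TestFun d) :
    ∫ ω, W (c • φ) ω * W ψ ω ∂P = c * ∫ ω, W φ ω * W ψ ω ∂P := by
  have h : ((∫ ω, W (c • φ) ω * W ψ ω ∂P : ℝ) : ℂ) =
      (c : ℂ) * ((∫ ω, W φ ω * W ψ ω ∂P : ℝ) : ℂ) := by
    rw [hW.covariance_eq, hW.covariance_eq, ← integral_const_mul]
    congr 1
    funext p
    rw [TestFun.ft_smul, mul_assoc]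
  exact_mod_cast h

omit [IsDalang μ] in
lemma integrable_mul (hW : IsHomogeneousNoise μ P W) (φ ψ : TestFun d) :
    Integrable (fun ω => W φ ω * W ψ ω) P :=
  (hW.memLp φ).integrable_mul (hW.memLp ψ)

omit [IsDalang μ] in
lemma ae_eq_zero_of_sq {X : Ω → ℝ} (hX : Integrable (fun ω => X ω * X ω) P)
    (h : ∫ ω, X ω * X ω ∂P = 0) : X =ᵐ[P] 0 := by
  rw [integral_eq_zero_iff_of_nonneg (fun ω => mul_self_nonneg _) hX] at h
  filter_upwards [h] with ω hω using mul_self_eq_zero.1 hω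

/-- Linearity of the noise is not an assumption but follows from the covariance. The defect `X` is
orthogonal to every `W χ` and is itself a combination of such variables, so `E[X²] = 0`. -/
lemma add_ae_eq (hW : IsHomogeneousNoise μ P W) (φ ψ : TestFun d) :
    W (φ + ψ) =ᵐ[P] fun ω => W φ ω + W ψ ω := by
  set X : Ω → ℝ := fun ω => W (φ + ψ) ω - W φ ω - W ψ ω with hX
  have hi : ∀ χ, Integrable (fun ω => X ω * W χ ω) P := by
    intro χ
    have := ((hW.integrable_mul (φ + ψ) χ).sub (hW.integrable_mul φ χ)).sub (hW.integrable_mul ψ χ)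
    refine this.congr (ae_of_all _ fun ω => ?_)
    simp only [hX, Pi.sub_apply]; ring
  have h0 : ∀ χ, ∫ ω, X ω * W χ ω ∂P = 0 := by
    intro χ
    have : ∀ ω, X ω * W χ ω = W (φ + ψ) ω * W χ ω - W φ ω * W χ ω - W ψ ω * W χ ω := by
      intro ω; simp only [hX]; ring
    simp_rw [this]
    rw [integral_sub (f := fun ω => W (φ + ψ) ω * W χ ω - W φ ω * W χ ω)
      ((hW.integrable_mul _ _).sub (hW.integrable_mul _ _)) (hW.integrable_mul _ _),
      integral_sub (hW.integrable_mul _ _) (hW.integrable_mul _ _), hW.covariance_add]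
    ring
  have hXX : ∀ ω, X ω * X ω = X ω * W (φ + ψ) ω - X ω * W φ ω - X ω * W ψ ω := by
    intro ω; simp only [hX]; ring
  have hz : X =ᵐ[P] 0 := by
    refine ae_eq_zero_of_sq ?_ ?_
    · simp_rw [hXX]; exact ((hi _).sub (hi _)).sub (hi _)
    · simp_rw [hXX]
      rw [integral_sub (f := fun ω => X ω * W (φ + ψ) ω - X ω * W φ ω)
        ((hi _).sub (hi _)) (hi _), integral_sub (hi _) (hi _), h0, h0, h0]
      ring
  filter_upwards [hz] with ω hω
  have : W (φ + ψ) ω - W φ ω - W ψ ω = 0 := hω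
  linarith

lemma smul_ae_eq (hW : IsHomogeneousNoise μ P W) (c : ℝ) (φ : TestFun d) :
    W (c • φ) =ᵐ[P] fun ω => c * W φ ω := by
  set X : Ω → ℝ := fun ω => W (c • φ) ω - c * W φ ω with hX
  have hi : ∀ χ, Integrable (fun ω => X ω * W χ ω) P := by
    intro χ
    have := (hW.integrable_mul (c • φ) χ).sub ((hW.integrable_mul φ χ).const_mul c)
    refine this.congr (ae_of_all _ fun ω => ?_)
    simp only [hX, Pi.sub_apply]; ring
  have h0 : ∀ χ, ∫ ω, X ω * W χ ω ∂P = 0 := by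
    intro χ
    have : ∀ ω, X ω * W χ ω = W (c • φ) ω * W χ ω - c * (W φ ω * W χ ω) := by
      intro ω; simp only [hX]; ring
    simp_rw [this]
    rw [integral_sub (hW.integrable_mul _ _) ((hW.integrable_mul _ _).const_mul c),
      integral_const_mul, hW.covariance_smul, sub_self]
  have hXX : ∀ ω, X ω * X ω = X ω * W (c • φ) ω - c * (X ω * W φ ω) := by
    intro ω; simp only [hX]; ring
  have hz : X =ᵐ[P] 0 := by
    refine ae_eq_zero_of_sq ?_ ?_
    · simp_rw [hXX]; exact (hi _).sub ((hi _).const_mul c)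
    · simp_rw [hXX]
      rw [integral_sub (hi _) ((hi _).const_mul c), integral_const_mul, h0, h0]
      ring
  filter_upwards [hz] with ω hω
  have : W (c • φ) ω - c * W φ ω = 0 := hω
  linarith

lemma integral_sq (hW : IsHomogeneousNoise μ P W) (φ : TestFun d) :
    ∫ ω, W φ ω ^ 2 ∂P = ∫ p, ‖φ.ft p‖ ^ 2 ∂(spaceTime μ) := by
  have h := hW.covariance_eq φ φ
  have h2 : ∀ p, φ.ft p * (starRingEnd ℂ) (φ.ft p) = ((‖φ.ft p‖ ^ 2 : ℝ) : ℂ) := by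
    intro p; rw [Complex.mul_conj, Complex.normSq_eq_norm_sq]
  simp_rw [h2] at h
  rw [integral_complex_ofReal] at h
  simp_rw [pow_two (W φ _)]
  exact_mod_cast h

/-- The isometry property of the noise. -/
lemma eLpNorm_eq (hW : IsHomogeneousNoise μ P W) (φ : TestFun d) :
    eLpNorm (W φ) 2 P = eLpNorm φ.ft 2 (spaceTime μ) := by
  rw [(hW.memLp φ).eLpNorm_eq_integral_rpow_norm two_ne_zero ENNReal.ofNat_ne_top,
    φ.memLp_ft.eLpNorm_eq_integral_rpow_norm two_ne_zero ENNReal.ofNat_ne_top]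
  simp only [ENNReal.toReal_ofNat, Real.rpow_two, Real.norm_eq_abs, sq_abs]
  rw [hW.integral_sq φ]

lemma map_eq (hW : IsHomogeneousNoise μ P W) (φ : TestFun d) :
    P.map (W φ) = gaussianReal 0 ((eLpNorm φ.ft 2 (spaceTime μ) ^ 2).toNNReal) := by
  have hP := hW.gaussian.isProbabilityMeasure
  rw [(hW.gaussian.hasGaussianLaw_eval φ).map_eq_gaussianReal, hW.centered,
    variance_of_integral_eq_zero (hW.memLp φ).aemeasurable (hW.centered φ)]
  have : ∫⁻ ω, ‖W φ ω‖ₑ ^ 2 ∂P = ENNReal.ofReal (∫ ω, W φ ω ^ 2 ∂P) := by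
    rw [ofReal_integral_eq_lintegral_ofReal (hW.memLp φ).integrable_sq
      (ae_of_all _ fun ω => sq_nonneg _)]
    refine lintegral_congr fun ω => ?_
    rw [← ofReal_norm, ← ENNReal.ofReal_pow (norm_nonneg _), Real.norm_eq_abs, sq_abs]
  rw [← hW.eLpNorm_eq φ, sq_eLpNorm_two, this]
  rfl

end IsHomogeneousNoise

/-! ### Wiener integrals in Fourier variables. -/

/-- `I` is the Wiener integral of a random field with space-time Fourier transform `h`. -/
def IsFourierIntegral {d : ℕ} (μ : Measure (Space d)) {Ω : Type*} [MeasurableSpace Ω]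
    (P : Measure Ω) (W : TestFun d → Ω → ℝ) (h : ℝ × Space d → ℂ) (I : Ω → ℝ) : Prop :=
  MemLp I 2 P ∧ ∃ φ : ℕ → TestFun d,
    Tendsto (fun k => eLpNorm (fun p => (φ k).ft p - h p) 2 (spaceTime μ)) atTop (𝓝 0) ∧
    Tendsto (fun k => eLpNorm (fun ω => W (φ k) ω - I ω) 2 P) atTop (𝓝 0)

lemma tendsto_sq_nhds_zero_iff {u : ℕ → ℝ≥0∞} :
    Tendsto (fun k => u k ^ 2) atTop (𝓝 0) ↔ Tendsto u atTop (𝓝 0) := by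
  constructor
  · intro h
    have := (ENNReal.continuous_rpow_const (y := (1 / 2 : ℝ))).tendsto 0 |>.comp h
    rw [ENNReal.zero_rpow_of_pos (by norm_num)] at this
    refine this.congr fun k => ?_
    simp only [Function.comp]
    rw [← ENNReal.rpow_natCast, ← ENNReal.rpow_mul]
    norm_num
  · intro h
    simpa using ENNReal.Tendsto.pow (n := 2) h

/-- By Tonelli the iterated norm is the `L²(dt μ(dξ))` norm. This replaces the measure-valued
integrand by its transform, a plain function. -/
lemma isWienerIntegral_iff {d : ℕ} {μ : Measure (Space d)} [SigmaFinite μ] {Ω : Type*}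
    [MeasurableSpace Ω] {P : Measure Ω} {W : TestFun d → Ω → ℝ} {g : ℝ → Measure (Space d)}
    {h : ℝ × Space d → ℂ} (hh : Measurable h) (hg : ∀ t ξ, fourierMeas (g t) ξ = h (t, ξ))
    {I : Ω → ℝ} : IsWienerIntegral μ P W g I ↔ IsFourierIntegral μ P W h I := by
  unfold IsWienerIntegral IsFourierIntegral
  refine and_congr_right fun _ => exists_congr fun φ => and_congr_left fun _ => ?_
  rw [← tendsto_sq_nhds_zero_iff
    (u := fun k => eLpNorm (fun p => (φ k).ft p - h p) 2 (spaceTime μ))]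
  refine iff_of_eq ?_
  congr 1
  funext k
  rw [sq_eLpNorm_two_spaceTime (f := fun p => (φ k).ft p - h p) ((φ k).measurable_ft.sub hh)]
  simp only [hg]
  rfl

namespace IsFourierIntegral

variable {d : ℕ} {μ : Measure (Space d)} [IsDalang μ] {Ω : Type*} [MeasurableSpace Ω]
  {P : Measure Ω} {W : TestFun d → Ω → ℝ} {h h' : ℝ × Space d → ℂ} {I I' : Ω → ℝ}

/-- Finite distance to one test function, whose transform is in `L²`, suffices. -/
lemma memLp_symbol (hI : IsFourierIntegral μ P W h I) (hh : Measurable h) :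
    MemLp h 2 (spaceTime μ) := by
  obtain ⟨-, φ, hφ, -⟩ := hI
  obtain ⟨k, hk⟩ := (hφ.eventually (gt_mem_nhds (show (0 : ℝ≥0∞) < 1 by norm_num))).exists
  have h1 : MemLp (fun p => (φ k).ft p - h p) 2 (spaceTime μ) :=
    ⟨((φ k).measurable_ft.sub hh).aestronglyMeasurable, hk.trans ENNReal.one_lt_top⟩
  have h2 := (φ k).memLp_ft.sub h1
  refine h2.ae_eq (ae_of_all _ fun p => ?_)
  simp

omit [IsDalang μ] in
lemma congr_ae (hI : IsFourierIntegral μ P W h I) (hII : I =ᵐ[P] I') :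
    IsFourierIntegral μ P W h I' := by
  obtain ⟨h1, φ, h2, h3⟩ := hI
  refine ⟨h1.ae_eq hII, φ, h2, h3.congr fun k => eLpNorm_congr_ae ?_⟩
  filter_upwards [hII] with ω hω
  rw [hω]

lemma add (hW : IsHomogeneousNoise μ P W) (hI : IsFourierIntegral μ P W h I)
    (hI' : IsFourierIntegral μ P W h' I') (hh : Measurable h) (hh' : Measurable h') :
    IsFourierIntegral μ P W (fun p => h p + h' p) (fun ω => I ω + I' ω) := by
  obtain ⟨h1, φ, h2, h3⟩ := hI
  obtain ⟨h1', φ', h2', h3'⟩ := hI'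
  refine ⟨h1.add h1', fun k => φ k + φ' k, ?_, ?_⟩
  · have := h2.add h2'
    rw [add_zero] at this
    refine tendsto_of_tendsto_of_tendsto_of_le_of_le tendsto_const_nhds this (fun _ => zero_le)
      fun k => ?_
    have heq : (fun p => (φ k + φ' k).ft p - (h p + h' p)) =
        (fun p => (φ k).ft p - h p) + fun p => (φ' k).ft p - h' p := by
      funext p; rw [TestFun.ft_add, Pi.add_apply]; ring
    simp only [heq]
    exact eLpNorm_add_le ((φ k).measurable_ft.sub hh).aestronglyMeasurable
      ((φ' k).measurable_ft.sub hh').aestronglyMeasurable one_le_two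
  · have := h3.add h3'
    rw [add_zero] at this
    refine tendsto_of_tendsto_of_tendsto_of_le_of_le tendsto_const_nhds this (fun _ => zero_le)
      fun k => ?_
    have heq : (fun ω => W (φ k + φ' k) ω - (I ω + I' ω)) =ᵐ[P]
        (fun ω => W (φ k) ω - I ω) + fun ω => W (φ' k) ω - I' ω := by
      filter_upwards [hW.add_ae_eq (φ k) (φ' k)] with ω hω
      rw [hω, Pi.add_apply]; ring
    simp only [eLpNorm_congr_ae heq]
    exact eLpNorm_add_le ((hW.memLp _).1.sub h1.1) ((hW.memLp _).1.sub h1'.1) one_le_two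

lemma const_mul (hW : IsHomogeneousNoise μ P W) (hI : IsFourierIntegral μ P W h I) (c : ℝ) :
    IsFourierIntegral μ P W (fun p => (c : ℂ) * h p) (fun ω => c * I ω) := by
  obtain ⟨h1, φ, h2, h3⟩ := hI
  refine ⟨h1.const_mul c, fun k => c • φ k, ?_, ?_⟩
  · have := ENNReal.Tendsto.const_mul (a := ‖(c : ℂ)‖ₑ) h2 (Or.inr (by simp))
    rw [mul_zero] at this
    refine this.congr fun k => ?_
    rw [← eLpNorm_const_smul]
    congr 1
    funext p
    rw [TestFun.ft_smul, Pi.smul_apply, smul_eq_mul]; ring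
  · have := ENNReal.Tendsto.const_mul (a := ‖c‖ₑ) h3 (Or.inr (by simp))
    rw [mul_zero] at this
    refine this.congr fun k => ?_
    rw [← eLpNorm_const_smul]
    refine eLpNorm_congr_ae ?_
    filter_upwards [hW.smul_ae_eq c (φ k)] with ω hω
    rw [hω, Pi.smul_apply, smul_eq_mul]; ring

lemma zero (hW : IsHomogeneousNoise μ P W) :
    IsFourierIntegral μ P W (fun _ => 0) (fun _ => 0) := by
  let φ : TestFun d := ⟨fun _ _ => 0, fun _ _ _ => rfl, 0, contDiff_const, HasCompactSupport.zero,
    fun _ _ _ => rfl⟩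
  -- The test function is written as a multiple by `0` because almost sure homogeneity then gives
  -- that its noise vanishes.
  have hft : ∀ p, ((0 : ℝ) • φ).ft p = 0 := fun p => by rw [TestFun.ft_smul]; simp
  refine ⟨MemLp.zero, fun _ => (0 : ℝ) • φ, ?_, ?_⟩
  · simp [hft]
  · have : (fun ω => W ((0 : ℝ) • φ) ω - 0) =ᵐ[P] 0 := by
      filter_upwards [hW.smul_ae_eq 0 φ] with ω hω
      rw [hω]; simp
    simp only [eLpNorm_congr_ae this]
    simp

lemma sum {ι : Type*} (s : Finset ι) (hW : IsHomogeneousNoise μ P W) {h : ι → ℝ × Space d → ℂ}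
    {I : ι → Ω → ℝ} (hI : ∀ i, IsFourierIntegral μ P W (h i) (I i)) (hh : ∀ i, Measurable (h i))
    (a : ι → ℝ) : IsFourierIntegral μ P W (fun p => ∑ i ∈ s, (a i : ℂ) * h i p)
      (fun ω => ∑ i ∈ s, a i * I i ω) := by
  classical
  induction s using Finset.induction_on with
  | empty => simpa using zero hW
  | insert i s his ih =>
    simp only [Finset.sum_insert his]
    exact add hW ((hI i).const_mul hW (a i)) ih ((hh i).const_mul _)
      (Finset.measurable_sum _ fun j _ => (hh j).const_mul _)

lemma sub (hW : IsHomogeneousNoise μ P W) (hI : IsFourierIntegral μ P W h I)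
    (hI' : IsFourierIntegral μ P W h' I') (hh : Measurable h) (hh' : Measurable h') :
    IsFourierIntegral μ P W (fun p => h p - h' p) (fun ω => I ω - I' ω) := by
  have := hI.add hW (hI'.const_mul hW (-1)) hh (hh'.const_mul _)
  simpa [sub_eq_add_neg] using this

/-- A Wiener integral is a centered Gaussian variable, with variance given by the isometry. -/
lemma map_eq (hW : IsHomogeneousNoise μ P W) (hI : IsFourierIntegral μ P W h I)
    (hh : Measurable h) :
    P.map I = gaussianReal 0 ((eLpNorm h 2 (spaceTime μ) ^ 2).toNNReal) := by
  have hP := hW.gaussian.isProbabilityMeasure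
  have hmem := hI.memLp_symbol hh
  obtain ⟨h1, φ, h2, h3⟩ := hI
  have hN : Tendsto (fun k => ((eLpNorm (φ k).ft 2 (spaceTime μ) ^ 2).toNNReal : ℝ)) atTop
      (𝓝 ((eLpNorm h 2 (spaceTime μ) ^ 2).toNNReal : ℝ)) := by
    have := ENNReal.Tendsto.pow (n := 2)
      (tendsto_eLpNorm_of_tendsto_eLpNorm_sub (fun k => (φ k).memLp_ft) hmem h2)
    exact NNReal.tendsto_coe.2 ((ENNReal.tendsto_toNNReal (ENNReal.pow_ne_top hmem.2.ne)).comp this)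
  -- Convergence in `L²` implies convergence in law, and the approximating Gaussian variances
  -- converge, so the characteristic function of the limit is identified.
  have hdist : TendstoInDistribution (fun k => W (φ k)) atTop I (fun _ => P) P := by
    refine TendstoInMeasure.tendstoInDistribution ?_ fun k => (hW.memLp _).aemeasurable
    exact tendstoInMeasure_of_tendsto_eLpNorm two_ne_zero (fun k => (hW.memLp _).1) h1.1 h3
  have hmap := IsProbabilityMeasure.mk (μ := P.map I)
    (Measure.isProbabilityMeasure_map h1.aemeasurable).measure_univ
  refine Measure.ext_of_charFun (funext fun u => ?_)
  have hc := ProbabilityMeasure.tendsto_iff_tendsto_charFun.1 hdist.tendsto u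
  simp only [ProbabilityMeasure.coe_mk, hW.map_eq, charFun_gaussianReal] at hc
  rw [charFun_gaussianReal]
  refine tendsto_nhds_unique hc ?_
  refine (Complex.continuous_exp.tendsto _).comp ?_
  refine tendsto_const_nhds.sub (((Tendsto.mul ?_ tendsto_const_nhds)).div_const _)
  exact (Complex.continuous_ofReal.tendsto _).comp hN

end IsFourierIntegral

/-! ### Integrands approximable by test functions. -/

/-- `h` belongs to the closure of the Fourier transforms of test functions. -/
def IsApproximable {d : ℕ} (μ : Measure (Space d)) (h : ℝ × Space d → ℂ) : Prop :=
  ∀ ε : ℝ≥0∞, 0 < ε → ∃ φ : TestFun d, eLpNorm (fun p => φ.ft p - h p) 2 (spaceTime μ) ≤ ε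

namespace IsApproximable

variable {d : ℕ} {μ : Measure (Space d)} [IsDalang μ]

/-- The Wiener integral of an approximable integrand exists. -/
lemma exists_isFourierIntegral {Ω : Type*} [MeasurableSpace Ω] {P : Measure Ω}
    {W : TestFun d → Ω → ℝ} (hW : IsHomogeneousNoise μ P W) {h : ℝ × Space d → ℂ}
    (hh : Measurable h) (ha : IsApproximable μ h) : ∃ I, IsFourierIntegral μ P W h I := by
  choose φ hφ using fun k : ℕ => ha ((k + 1 : ℝ≥0∞)⁻¹) (by simp)
  have hlim0 : Tendsto (fun k : ℕ => ((k + 1 : ℝ≥0∞)⁻¹)) atTop (𝓝 0) := by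
    have := ENNReal.tendsto_inv_nat_nhds_zero.comp (tendsto_add_atTop_nat 1)
    refine this.congr fun k => ?_
    simp
  have hlim : Tendsto (fun k => eLpNorm (fun p => (φ k).ft p - h p) 2 (spaceTime μ)) atTop (𝓝 0) :=
    tendsto_of_tendsto_of_tendsto_of_le_of_le tendsto_const_nhds hlim0 (fun _ => zero_le) hφ
  have hdist : ∀ k l, eLpNorm (W (φ k) - W (φ l)) 2 P ≤
      eLpNorm (fun p => (φ k).ft p - h p) 2 (spaceTime μ) +
        eLpNorm (fun p => (φ l).ft p - h p) 2 (spaceTime μ) := by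
    intro k l
    -- The difference of two noise variables is almost surely the noise of one test function, so the
    -- isometry transports the Cauchy property from the integrands.
    have h1 : (W (φ k) - W (φ l)) =ᵐ[P] W (φ k + (-1 : ℝ) • φ l) := by
      filter_upwards [hW.add_ae_eq (φ k) ((-1 : ℝ) • φ l), hW.smul_ae_eq (-1) (φ l)] with ω h1 h2
      rw [h1, h2, Pi.sub_apply]; ring
    rw [eLpNorm_congr_ae h1, hW.eLpNorm_eq]
    have h2 : (φ k + (-1 : ℝ) • φ l).ft =
        (fun p => (φ k).ft p - h p) - fun p => (φ l).ft p - h p := by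
      funext p; rw [TestFun.ft_add, TestFun.ft_smul, Pi.sub_apply]; push_cast; ring
    rw [h2]
    exact eLpNorm_sub_le ((φ k).measurable_ft.sub hh).aestronglyMeasurable
      ((φ l).measurable_ft.sub hh).aestronglyMeasurable one_le_two
  have hcau : CauchySeq fun k => (hW.memLp (φ k)).toLp (W (φ k)) := by
    rw [EMetric.cauchySeq_iff]
    intro ε hε
    have hε2 : 0 < ε / 2 := ENNReal.half_pos hε.ne'
    obtain ⟨N, hN⟩ := eventually_atTop.1 (hlim.eventually (gt_mem_nhds hε2))
    refine ⟨N, fun m hm n hn => ?_⟩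
    rw [Lp.edist_toLp_toLp]
    calc _ ≤ _ := hdist m n
      _ < ε / 2 + ε / 2 := ENNReal.add_lt_add (hN m hm) (hN n hn)
      _ = ε := ENNReal.add_halves ε
  obtain ⟨I, hI⟩ := cauchySeq_tendsto_of_complete hcau
  refine ⟨I, Lp.memLp I, φ, hlim, ?_⟩
  have := (Lp.tendsto_Lp_iff_tendsto_eLpNorm' _ _).1 hI
  refine this.congr fun k => eLpNorm_congr_ae ?_
  filter_upwards [(hW.memLp (φ k)).coeFn_toLp] with ω hω
  rw [Pi.sub_apply, hω]

end IsApproximable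

lemma measurable_fourierFun {d : ℕ} {f : Space d → ℝ} (hf : Measurable f) :
    Measurable (fourierFun f) := by
  unfold fourierFun
  refine (StronglyMeasurable.integral_prod_right'
    (f := fun q : Space d × Space d =>
      Complex.exp (-(Complex.I * ((inner ℝ q.1 q.2 : ℝ) : ℂ))) * (f q.2 : ℂ)) ?_).measurable
  exact (by fun_prop : Measurable _).stronglyMeasurable

lemma exists_norm_fourierFun_sq_le {d : ℕ} {f : Space d → ℝ} (hf : ContDiff ℝ 1 f)
    (hc : HasCompactSupport f) : ∃ C, 0 ≤ C ∧ ∀ ξ, ‖fourierFun f ξ‖ ^ 2 ≤ C * (1 / (1 + ‖ξ‖ ^ 2)) := by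
  set A := ∫ x, ‖f x‖
  set B := ∫ x, ‖fderiv ℝ f x‖
  refine ⟨A ^ 2 + B ^ 2, by positivity, fun ξ => ?_⟩
  rw [mul_one_div, le_div_iff₀ (by positivity), mul_add, mul_one, ← mul_pow]
  refine add_le_add (pow_le_pow_left₀ (norm_nonneg _) (norm_fourierFun_le_integral f ξ) 2) ?_
  refine pow_le_pow_left₀ (by positivity) ?_ 2
  rw [mul_comm]
  exact norm_mul_norm_fourierFun_le f hf hc ξ

lemma fourierFun_comp_sub {d : ℕ} (f : Space d → ℝ) (y ξ : Space d) :
    fourierFun (fun x => f (x - y)) ξ =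
      Complex.exp (-(Complex.I * ((inner ℝ ξ y : ℝ) : ℂ))) * fourierFun f ξ := by
  unfold fourierFun
  rw [← integral_const_mul, ← integral_sub_right_eq_self (fun x =>
    Complex.exp (-(Complex.I * ((inner ℝ ξ y : ℝ) : ℂ))) *
      (Complex.exp (-(Complex.I * ((inner ℝ ξ x : ℝ) : ℂ))) * (f x : ℂ))) y]
  congr 1
  funext x
  rw [← mul_assoc, ← Complex.exp_add, inner_sub_right]
  congr 2
  push_cast; ring

lemma ae_fst_ne {d : ℕ} (μ : Measure (Space d)) [SigmaFinite μ] (a : ℝ) :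
    ∀ᵐ p ∂(spaceTime μ), p.1 ≠ a := by
  have : {p : ℝ × Space d | ¬ p.1 ≠ a} = {a} ×ˢ Set.univ := by
    ext p; simp
  rw [ae_iff, this, spaceTime, Measure.prod_prod]
  simp

/-- The product of a bump function in time and a smooth function in space. -/
def TestFun.tensor {d : ℕ} {a b : ℝ} (η : ContDiffBump ((a + b) / 2)) (ha : 0 ≤ a)
    (hη : η.rOut ≤ (b - a) / 2) (f : Space d → ℝ)
    (hf : ContDiff ℝ ((⊤ : ℕ∞) : WithTop ℕ∞) f) (hc : HasCompactSupport f) : TestFun d where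
  toFun t x := η t * f x
  eq_zero_of_neg t ht x := by
    rw [η.zero_of_le_dist, zero_mul]
    rw [Real.dist_eq]
    exact le_trans (by linarith) (neg_le_abs _)
  smooth_compact := by
    refine ⟨fun p => η p.1 * f p.2, ?_, ?_, fun t _ x => rfl⟩
    · exact (η.contDiff.comp contDiff_fst).mul (hf.comp contDiff_snd)
    · refine HasCompactSupport.intro (η.hasCompactSupport.isCompact.prod hc.isCompact) ?_
      rintro ⟨t, x⟩ hp
      rw [Set.mem_prod, not_and_or] at hp
      rcases hp with h | h
      · simp only [image_eq_zero_of_notMem_tsupport h, zero_mul]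
      · simp only [image_eq_zero_of_notMem_tsupport h, mul_zero]

lemma TestFun.ft_tensor {d : ℕ} {a b : ℝ} (η : ContDiffBump ((a + b) / 2)) (ha : 0 ≤ a)
    (hη : η.rOut ≤ (b - a) / 2) (f : Space d → ℝ)
    (hf : ContDiff ℝ ((⊤ : ℕ∞) : WithTop ℕ∞) f) (hc : HasCompactSupport f) (p : ℝ × Space d) :
    (TestFun.tensor η ha hη f hf hc).ft p = (η p.1 : ℂ) * fourierFun f p.2 := by
  unfold ft fourierFun tensor
  rw [← integral_const_mul]
  congr 1
  funext x
  push_cast; ring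

namespace IsApproximable

variable {d : ℕ} {μ : Measure (Space d)} [IsDalang μ] {h h' : ℝ × Space d → ℂ}

omit [IsDalang μ] in
omit [IsDalang μ] in
lemma of_tendsto {u : ℕ → ℝ × Space d → ℂ} (hu : ∀ n, IsApproximable μ (u n))
    (hum : ∀ n, Measurable (u n)) (hm : Measurable h)
    (hlim : Tendsto (fun n => eLpNorm (fun p => u n p - h p) 2 (spaceTime μ)) atTop (𝓝 0)) :
    IsApproximable μ h := by
  intro ε hε
  have hε2 : 0 < ε / 2 := ENNReal.half_pos hε.ne'
  obtain ⟨n, hn⟩ := (hlim.eventually (gt_mem_nhds hε2)).exists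
  obtain ⟨φ, hφ⟩ := hu n (ε / 2) hε2
  refine ⟨φ, ?_⟩
  have heq : (fun p => φ.ft p - h p) = (fun p => φ.ft p - u n p) + fun p => u n p - h p := by
    funext p; rw [Pi.add_apply]; ring
  rw [heq]
  calc _ ≤ _ := eLpNorm_add_le (φ.measurable_ft.sub (hum n)).aestronglyMeasurable
        ((hum n).sub hm).aestronglyMeasurable one_le_two
    _ ≤ ε / 2 + ε / 2 := add_le_add hφ hn.le
    _ = ε := ENNReal.add_halves ε

omit [IsDalang μ] in
-- The form in which all the approximations below are made: dominated convergence for `‖u n - h‖²`,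
-- where `2‖b‖` bounds the difference because the limit inherits the bound `‖b‖`.
lemma of_dominated {u : ℕ → ℝ × Space d → ℂ} (hu : ∀ n, IsApproximable μ (u n))
    (hum : ∀ n, Measurable (u n)) (hm : Measurable h) {b : ℝ × Space d → ℂ}
    (hb : MemLp b 2 (spaceTime μ)) (hle : ∀ n, ∀ᵐ p ∂(spaceTime μ), ‖u n p‖ ≤ ‖b p‖)
    (hlim : ∀ᵐ p ∂(spaceTime μ), Tendsto (fun n => u n p) atTop (𝓝 (h p))) :
    IsApproximable μ h := by
  refine of_tendsto hu hum hm ?_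
  rw [← tendsto_sq_nhds_zero_iff]
  simp only [sq_eLpNorm_two]
  have hb2 : ∫⁻ p, (2 * ‖b p‖ₑ) ^ 2 ∂(spaceTime μ) ≠ ∞ := by
    simp only [mul_pow]
    rw [lintegral_const_mul' _ _ (by simp), ← sq_eLpNorm_two]
    exact ENNReal.mul_ne_top (by simp) (ENNReal.pow_ne_top hb.2.ne)
  have := tendsto_lintegral_of_dominated_convergence (μ := spaceTime μ)
    (F := fun n p => ‖u n p - h p‖ₑ ^ 2) (f := fun _ => 0) (fun p => (2 * ‖b p‖ₑ) ^ 2)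
    (fun n => (((hum n).sub hm).enorm).pow_const 2) ?_ hb2 ?_
  · simpa using this
  · intro n
    filter_upwards [ae_all_iff.2 hle, hlim] with p hp hp'
    have h1 : ‖h p‖ ≤ ‖b p‖ := le_of_tendsto hp'.norm (Eventually.of_forall fun n => hp n)
    have h2 : ‖u n p - h p‖ₑ ≤ 2 * ‖b p‖ₑ := by
      refine enorm_sub_le.trans ?_
      rw [two_mul]
      exact add_le_add (enorm_le_iff_norm_le.2 (hp n)) (enorm_le_iff_norm_le.2 h1)
    exact pow_le_pow_left₀ zero_le h2 2
  · filter_upwards [hlim] with p hp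
    have h1 : Tendsto (fun n => ‖u n p - h p‖ₑ) atTop (𝓝 0) := by
      have := (hp.sub_const (h p)).enorm
      simpa using this
    simpa using ENNReal.Tendsto.pow (n := 2) h1

omit [IsDalang μ] in
lemma add (ha : IsApproximable μ h) (ha' : IsApproximable μ h') (hm : Measurable h)
    (hm' : Measurable h') : IsApproximable μ (fun p => h p + h' p) := by
  intro ε hε
  have hε2 : 0 < ε / 2 := ENNReal.half_pos hε.ne'
  obtain ⟨φ, hφ⟩ := ha _ hε2
  obtain ⟨ψ, hψ⟩ := ha' _ hε2
  refine ⟨φ + ψ, ?_⟩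
  have heq : (fun p => (φ + ψ).ft p - (h p + h' p)) =
      (fun p => φ.ft p - h p) + fun p => ψ.ft p - h' p := by
    funext p; rw [TestFun.ft_add, Pi.add_apply]; ring
  rw [heq]
  calc _ ≤ _ := eLpNorm_add_le (φ.measurable_ft.sub hm).aestronglyMeasurable
        (ψ.measurable_ft.sub hm').aestronglyMeasurable one_le_two
    _ ≤ ε / 2 + ε / 2 := add_le_add hφ hψ
    _ = ε := ENNReal.add_halves ε

omit [IsDalang μ] in
lemma zero : IsApproximable μ (fun _ => 0) := by
  let φ : TestFun d := ⟨fun _ _ => 0, fun _ _ _ => rfl, 0, contDiff_const, HasCompactSupport.zero,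
    fun _ _ _ => rfl⟩
  have hft : ∀ p, φ.ft p = 0 := fun p => by simp [TestFun.ft, fourierFun, φ]
  intro ε _
  exact ⟨φ, by simp [hft]⟩

omit [IsDalang μ] in
lemma const_mul (ha : IsApproximable μ h) (c : ℝ) : IsApproximable μ (fun p => (c : ℂ) * h p) := by
  by_cases hc : c = 0
  · simpa [hc] using zero
  intro ε hε
  have hc0 : ‖(c : ℂ)‖ₑ ≠ 0 := by simpa using hc
  obtain ⟨φ, hφ⟩ := ha (ε / ‖(c : ℂ)‖ₑ) (ENNReal.div_pos hε.ne' (by simp))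
  refine ⟨c • φ, ?_⟩
  have heq : (fun p => (c • φ).ft p - (c : ℂ) * h p) = (c : ℂ) • fun p => φ.ft p - h p := by
    funext p; rw [TestFun.ft_smul, Pi.smul_apply, smul_eq_mul]; ring
  rw [heq, eLpNorm_const_smul]
  calc _ ≤ ‖(c : ℂ)‖ₑ * (ε / ‖(c : ℂ)‖ₑ) := by gcongr
    _ = ε := ENNReal.mul_div_cancel hc0 (by simp)

omit [IsDalang μ] in
lemma sum {ι : Type*} (s : Finset ι) {h : ι → ℝ × Space d → ℂ}
    (ha : ∀ i, IsApproximable μ (h i)) (hm : ∀ i, Measurable (h i)) :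
    IsApproximable μ (fun p => ∑ i ∈ s, h i p) := by
  classical
  induction s using Finset.induction_on with
  | empty => simpa using zero
  | insert i s his ih =>
    simp only [Finset.sum_insert his]
    exact add (ha i) ih (hm i) (Finset.measurable_sum _ fun j _ => hm j)

end IsApproximable

section

variable {d : ℕ} {μ : Measure (Space d)} [IsDalang μ] {f : Space d → ℝ}

lemma memLp_indicator_mul_fourierFun (hf : ContDiff ℝ 1 f) (hc : HasCompactSupport f) (K R : ℝ) :
    MemLp (fun p : ℝ × Space d => (Set.Icc 0 R).indicator (fun _ => (K : ℂ)) p.1 * fourierFun f p.2)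
      2 (spaceTime μ) := by
  obtain ⟨C, hC, hle⟩ := exists_norm_fourierFun_sq_le hf hc
  refine memLp_two_of_norm_sq_le (C := K ^ 2 * C) (R := R) ?_ fun p => ?_
  · refine Measurable.aestronglyMeasurable ?_
    exact ((measurable_const.indicator measurableSet_Icc).comp measurable_fst).mul
      ((measurable_fourierFun hf.continuous.measurable).comp measurable_snd)
  · by_cases hp : p.1 ∈ Set.Icc 0 R
    · simp only [Set.indicator_of_mem hp, norm_mul, mul_pow, Complex.norm_real, Real.norm_eq_abs,
        sq_abs]
      rw [mul_assoc]
      exact mul_le_mul_of_nonneg_left (hle _) (sq_nonneg K)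
    · simp [Set.indicator_of_notMem hp]

/-- The time indicator is approximated by bumps centered at the midpoint. Their outer radius stays
equal to the half-length, which keeps the support in `[a, b]`, while the plateau grows to fill the
interval. -/
lemma isApproximable_indicator_mul_fourierFun (hf : ContDiff ℝ ((⊤ : ℕ∞) : WithTop ℕ∞) f)
    (hc : HasCompactSupport f) {a b : ℝ} (ha : 0 ≤ a) (hab : a < b) :
    IsApproximable μ (fun p => (Set.Ico a b).indicator (fun _ => 1) p.1 * fourierFun f p.2) := by
  have hf1 : ContDiff ℝ 1 f := hf.of_le (by exact_mod_cast le_top)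
  have hfm := measurable_fourierFun hf.continuous.measurable
  have hr : 0 < (b - a) / 2 := by linarith
  let η : ℕ → ContDiffBump ((a + b) / 2) := fun n =>
    -- With `n + 2` in the denominator the inner radius is already positive for `n = 0`.
    ⟨(b - a) / 2 * (1 - 1 / ((n : ℝ) + 2)), (b - a) / 2,
      mul_pos hr (by
        rw [sub_pos, div_lt_one (by positivity)]
        have : (0 : ℝ) ≤ n := n.cast_nonneg
        linarith),
      by
        have : 0 < 1 / ((n : ℝ) + 2) := by positivity
        nlinarith⟩
  refine IsApproximable.of_dominated
    (u := fun n => (TestFun.tensor (η n) ha le_rfl f hf hc).ft) (fun n ε _ => ⟨TestFun.tensor (η n) ha le_rfl f hf hc, by simp⟩)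
    (fun n => TestFun.measurable_ft _) ?_ (memLp_indicator_mul_fourierFun hf1 hc 1 b)
    (fun n => ae_of_all _ fun p => ?_) ?_
  · exact ((measurable_const.indicator measurableSet_Ico).comp measurable_fst).mul
      (hfm.comp measurable_snd)
  · rw [TestFun.ft_tensor, norm_mul, norm_mul]
    refine mul_le_mul_of_nonneg_right ?_ (norm_nonneg _)
    rw [Complex.norm_real, Real.norm_eq_abs, abs_of_nonneg (η n).nonneg]
    by_cases hp : p.1 ∈ Set.Icc 0 b
    · simp [Set.indicator_of_mem hp, (η n).le_one]
    · rw [(η n).zero_of_le_dist]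
      · exact norm_nonneg _
      · change (b - a) / 2 ≤ _
        rw [Real.dist_eq]
        by_contra hlt
        rw [not_le, abs_lt] at hlt
        exact hp ⟨by linarith [hlt.1], by linarith [hlt.2]⟩
  -- At time `a` all bumps vanish while the indicator of `[a, b)` is `1`, so this null time slice is
  -- discarded.
  · filter_upwards [ae_fst_ne μ a] with p hpa
    simp only [TestFun.ft_tensor]
    refine Tendsto.mul_const _ ?_
    by_cases hp : p.1 ∈ Set.Ico a b
    · rw [Set.indicator_of_mem hp]
      have hlt : |p.1 - (a + b) / 2| < (b - a) / 2 := by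
        have : a < p.1 := lt_of_le_of_ne hp.1 hpa.symm
        rw [abs_lt]; exact ⟨by linarith, by linarith [hp.2]⟩
      have hlim : Tendsto (fun n : ℕ => (b - a) / 2 * (1 - 1 / ((n : ℝ) + 2))) atTop
          (𝓝 ((b - a) / 2 * (1 - 0))) := by
        refine Tendsto.const_mul _ (tendsto_const_nhds.sub ?_)
        have := (tendsto_one_div_add_atTop_nhds_zero_nat (𝕜 := ℝ)).comp (tendsto_add_atTop_nat 1)
        refine this.congr fun n => ?_
        simp only [Function.comp]
        push_cast
        ring
      rw [sub_zero, mul_one] at hlim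
      refine tendsto_const_nhds.congr' ?_
      filter_upwards [hlim.eventually (lt_mem_nhds hlt)] with n hn
      rw [(η n).one_of_mem_closedBall]
      · simp
      · rw [Metric.mem_closedBall, Real.dist_eq]
        exact hn.le
    · rw [Set.indicator_of_notMem hp]
      have : ∀ n, η n p.1 = 0 := by
        intro n
        refine (η n).zero_of_le_dist ?_
        change (b - a) / 2 ≤ _
        rw [Real.dist_eq]
        by_contra hlt
        rw [not_le, abs_lt] at hlt
        exact hp ⟨by linarith [hlt.1], by linarith [hlt.2]⟩
      simp [this]

/-- The measure `m` is replaced by its image under a simple function, a finite combination of point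
masses. A point mass at `z` multiplies `𝓕 f` by a phase, which is the transform of a translate of
`f`, so the preceding lemma applies to each term. -/
lemma isApproximable_indicator_mul_fourierMeas (hf : ContDiff ℝ ((⊤ : ℕ∞) : WithTop ℕ∞) f)
    (hc : HasCompactSupport f) {a b : ℝ} (ha : 0 ≤ a) (hab : a < b) (m : Measure (Space d))
    [IsFiniteMeasure m] :
    IsApproximable μ (fun p => (Set.Ico a b).indicator (fun _ => 1) p.1 *
      (fourierMeas m p.2 * fourierFun f p.2)) := by
  have hf1 : ContDiff ℝ 1 f := hf.of_le (by exact_mod_cast le_top)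
  have hfm := measurable_fourierFun hf.continuous.measurable
  let π : ℕ → SimpleFunc (Space d) (Space d) := fun n =>
    SimpleFunc.approxOn id measurable_id Set.univ 0 (Set.mem_univ _) n
  have hπ : ∀ y, Tendsto (fun n => π n y) atTop (𝓝 y) := fun y =>
    SimpleFunc.tendsto_approxOn measurable_id (Set.mem_univ _) (by simp)
  let e : Space d → Space d → ℂ := fun ξ y => Complex.exp (-(Complex.I * ((inner ℝ ξ y : ℝ) : ℂ)))
  have hmeas : ∀ (g : Space d → Space d), Measurable g → Measurable fun ξ => ∫ y, e ξ (g y) ∂m := by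
    intro g hg
    refine (StronglyMeasurable.integral_prod_right' (f := fun q : Space d × Space d => e q.1 (g q.2))
      ?_).measurable
    exact (by fun_prop : Measurable _).stronglyMeasurable
  have hsum : ∀ n ξ, ∫ y, e ξ (π n y) ∂m =
      ∑ z ∈ (π n).range, ((m.real (π n ⁻¹' {z}) : ℝ) : ℂ) * e ξ z := by
    intro n ξ
    have hpt : ∀ y, e ξ (π n y) = ∑ z ∈ (π n).range, (π n ⁻¹' {z}).indicator (fun _ => e ξ z) y := by
      intro y
      rw [Finset.sum_eq_single (π n y)]
      · rw [Set.indicator_of_mem (by simp)]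
      · intro z _ hz
        exact Set.indicator_of_notMem (fun h => hz (by simpa using h.symm)) _
      · intro h
        exact absurd (SimpleFunc.mem_range_self _ y) h
    simp_rw [hpt]
    rw [integral_finsetSum]
    · refine Finset.sum_congr rfl fun z _ => ?_
      rw [integral_indicator_const _ ((π n).measurableSet_fiber z), Complex.real_smul]
    · intro z _
      exact (integrable_const _).indicator ((π n).measurableSet_fiber z)
  have hbound : ∀ (g : Space d → Space d) ξ, ‖∫ y, e ξ (g y) ∂m‖ ≤ m.real Set.univ := by
    intro g ξ
    refine (norm_integral_le_of_norm_le_const (C := 1) (ae_of_all _ fun y => ?_)).trans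
      (le_of_eq (one_mul _))
    rw [norm_cexp_neg_I_mul]
  have hind : Measurable fun p : ℝ × Space d => (Set.Ico a b).indicator (fun _ => (1 : ℂ)) p.1 :=
    (measurable_const.indicator measurableSet_Ico).comp measurable_fst
  refine IsApproximable.of_dominated (u := fun n p => (Set.Ico a b).indicator (fun _ => 1) p.1 *
      ((∫ y, e p.2 (π n y) ∂m) * fourierFun f p.2)) (fun n => ?_) (fun n => ?_) ?_
    (memLp_indicator_mul_fourierFun hf1 hc (m.real Set.univ) b) (fun n => ae_of_all _ fun p => ?_)
    (ae_of_all _ fun p => ?_)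
  · have : ∀ p : ℝ × Space d, (Set.Ico a b).indicator (fun _ => 1) p.1 *
        ((∫ y, e p.2 (π n y) ∂m) * fourierFun f p.2) =
        ∑ z ∈ (π n).range, ((m.real (π n ⁻¹' {z}) : ℝ) : ℂ) *
          ((Set.Ico a b).indicator (fun _ => 1) p.1 * fourierFun (fun x => f (x - z)) p.2) := by
      intro p
      rw [hsum, Finset.sum_mul, Finset.mul_sum]
      refine Finset.sum_congr rfl fun z _ => ?_
      rw [fourierFun_comp_sub]; ring
    simp_rw [this]
    have hcont : ∀ z, Continuous fun x => f (x - z) := fun z =>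
      hf.continuous.comp (continuous_id.sub continuous_const)
    refine IsApproximable.sum _ (fun z => IsApproximable.const_mul
      (isApproximable_indicator_mul_fourierFun ?_ ?_ ha hab) _) fun z => ?_
    · exact hf.comp (contDiff_id.sub contDiff_const)
    · exact hc.comp_homeomorph (Homeomorph.subRight z)
    · exact measurable_const.mul (hind.mul ((measurable_fourierFun (hcont z).measurable).comp
        measurable_snd))
  · exact hind.mul (((hmeas _ (π n).measurable).comp measurable_snd).mul (hfm.comp measurable_snd))
  · exact hind.mul (((hmeas _ measurable_id).comp measurable_snd).mul (hfm.comp measurable_snd))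
  · rw [norm_mul, norm_mul, norm_mul, ← mul_assoc]
    refine mul_le_mul_of_nonneg_right ?_ (norm_nonneg _)
    by_cases hp : p.1 ∈ Set.Ico a b
    · have hp' : p.1 ∈ Set.Icc 0 b := ⟨ha.trans hp.1, hp.2.le⟩
      rw [Set.indicator_of_mem hp, Set.indicator_of_mem hp', norm_one, one_mul, Complex.norm_real,
        Real.norm_eq_abs, abs_of_nonneg measureReal_nonneg]
      exact hbound _ _
    · rw [Set.indicator_of_notMem hp, norm_zero, zero_mul]
      exact norm_nonneg _
  · refine Tendsto.const_mul _ (Tendsto.mul_const _ ?_)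
    refine tendsto_integral_of_dominated_convergence (fun _ => 1) (fun n => ?_) (integrable_const _)
      (fun n => ae_of_all _ fun y => ?_) (ae_of_all _ fun y => ?_)
    · have := (π n).measurable
      exact (by fun_prop : Measurable _).aestronglyMeasurable
    · rw [norm_cexp_neg_I_mul]
    · exact ((by fun_prop : Continuous (e p.2)).tendsto y).comp (hπ y)

end

/-! ### Energy estimates at a fixed frequency. -/

section

variable {d : ℕ}

lemma mul_mul_sinc (r l : ℝ) : l * (r * Real.sinc (r * l)) = Real.sin (r * l) := by
  by_cases h : r * l = 0
  · rw [h, Real.sinc_zero, Real.sin_zero, mul_one, mul_comm, h]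
  · rw [Real.sinc_of_ne_zero h]
    have h1 : r ≠ 0 := left_ne_zero_of_mul h
    have h2 : l ≠ 0 := right_ne_zero_of_mul h
    field_simp

lemma abs_mul_sinc_le (r l : ℝ) : |r * Real.sinc (r * l)| ≤ |r| := by
  rw [abs_mul]
  exact mul_le_of_le_one_right (abs_nonneg _) (Real.abs_sinc_le_one _)

/-- Multiplied by `l`, the two terms become `sin (s l)` and `sin (r l)`, and sine is 1-Lipschitz.
The bound is uniform in `l`. -/
lemma abs_mul_sinc_sub_le (r s l : ℝ) :
    |s * Real.sinc (s * l) - r * Real.sinc (r * l)| ≤ |s - r| := by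
  by_cases hl : l = 0
  · simp [hl]
  · have h1 : |l| * |s * Real.sinc (s * l) - r * Real.sinc (r * l)| ≤ |l| * |s - r| := by
      rw [← abs_mul, mul_sub, mul_mul_sinc, mul_mul_sinc, ← abs_mul]
      have := Real.abs_sin_sub_sin_le (s * l) (r * l)
      rwa [← sub_mul, mul_comm (s - r)] at this
    exact le_of_mul_le_mul_left h1 (abs_pos.2 hl)

/-- The constant in the energy estimates up to time `T`. -/
def energyConst (T : ℝ) : ℝ := 4 * (1 + T) ^ 2

lemma integral_le_of_le {g : ℝ → ℝ} (hg : Continuous g) {t C : ℝ} (ht : 0 ≤ t)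
    (h : ∀ r ∈ Set.Icc 0 t, g r ≤ C) : ∫ r in 0..t, g r ≤ C * t := by
  have := intervalIntegral.integral_mono_on (μ := volume) ht (hg.intervalIntegrable 0 t)
    ((continuous_const (y := C)).intervalIntegrable 0 t) h
  rw [intervalIntegral.integral_const, sub_zero, smul_eq_mul] at this
  linarith

lemma mul_integral_exp_eq (a t : ℝ) :
    a * ∫ r in 0..t, Real.exp (-(r * a)) = 1 - Real.exp (-(t * a)) := by
  rw [← intervalIntegral.integral_const_mul]
  have hder : ∀ r ∈ Set.uIcc 0 t, HasDerivAt (fun r => -Real.exp (-(r * a)))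
      (a * Real.exp (-(r * a))) r := by
    intro r _
    have := ((hasDerivAt_mul_const (x := r) a).fun_neg.exp).fun_neg
    convert! this using 1
    ring
  rw [intervalIntegral.integral_eq_sub_of_hasDerivAt hder
    ((by fun_prop : Continuous _).intervalIntegrable _ _)]
  simp; ring

lemma Equation.continuous_symbol_left (eqn : Equation) (ξ : Space d) :
    Continuous fun r => eqn.symbol r ξ :=
  eqn.continuous_symbol.comp (f := fun r : ℝ => (r, ξ)) (by fun_prop)

/-- For the wave equation, the symbol is at most `r`, and `|ξ|` times it is a sine. For the heat
equation, the squared symbol is `exp(-r|ξ|²)`, which is at most `1` and whose integral times `|ξ|²`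
is at most `1`. -/
lemma Equation.integral_symbol_sq_le (eqn : Equation) {T h : ℝ} (h0 : 0 ≤ h) (hT : h ≤ T)
    (ξ : Space d) :
    ∫ r in 0..h, eqn.symbol r ξ ^ 2 ≤ energyConst T * h ∧
      ‖ξ‖ ^ 2 * ∫ r in 0..h, eqn.symbol r ξ ^ 2 ≤ energyConst T := by
  have hc : Continuous fun r => eqn.symbol r ξ ^ 2 := (eqn.continuous_symbol_left ξ).pow 2
  have hT0 : 0 ≤ T := h0.trans hT
  unfold energyConst
  cases eqn with
  | wave =>
    constructor
    · refine integral_le_of_le hc h0 fun r hr => ?_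
      have h1 : |Equation.wave.symbol r ξ| ≤ T :=
        (abs_mul_sinc_le r ‖ξ‖).trans (by rw [abs_of_nonneg hr.1]; exact hr.2.trans hT)
      have h2 := pow_le_pow_left₀ (abs_nonneg _) h1 2
      rw [sq_abs] at h2
      nlinarith
    · rw [← intervalIntegral.integral_const_mul]
      refine (integral_le_of_le (C := 1) (continuous_const.mul hc) h0 fun r _ => ?_).trans
        (by nlinarith)
      change ‖ξ‖ ^ 2 * Equation.wave.symbol r ξ ^ 2 ≤ 1
      rw [← mul_pow, symbol, mul_mul_sinc]
      exact Real.sin_sq_le_one _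
  | heat =>
    have hsq : ∀ r, Equation.heat.symbol r ξ ^ 2 = Real.exp (-(r * ‖ξ‖ ^ 2)) := by
      intro r
      rw [symbol, ← Real.exp_nat_mul]
      congr 1
      push_cast; ring
    simp_rw [hsq] at hc ⊢
    constructor
    · refine (integral_le_of_le (C := 1) hc h0 fun r hr => ?_).trans
        (mul_le_mul_of_nonneg_right (by nlinarith) h0)
      rw [Real.exp_le_one_iff, neg_nonpos]
      exact mul_nonneg hr.1 (sq_nonneg _)
    · rw [mul_integral_exp_eq]
      have := Real.exp_pos (-(h * ‖ξ‖ ^ 2))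
      nlinarith

/-- For the wave equation, the Lipschitz bound gives `h² ≤ T h`, and sines bound the weighted
version. For the heat equation, the semigroup property factors out `(1 - e^{-y})²` with `y =
h|ξ|²/2`. This factor is at most `min 1 y`, and the `|ξ|²` in `y` is absorbed by the weighted energy
of the symbol. -/
lemma Equation.integral_symbol_sub_sq_le (eqn : Equation) {T h t : ℝ} (h0 : 0 ≤ h) (hT : h ≤ T)
    (ht0 : 0 ≤ t) (htT : t ≤ T) (ξ : Space d) :
    ∫ r in 0..t, (eqn.symbol (r + h) ξ - eqn.symbol r ξ) ^ 2 ≤ energyConst T * h ∧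
      ‖ξ‖ ^ 2 * ∫ r in 0..t, (eqn.symbol (r + h) ξ - eqn.symbol r ξ) ^ 2 ≤ energyConst T := by
  have hc0 := eqn.continuous_symbol_left ξ
  have hc : Continuous fun r => (eqn.symbol (r + h) ξ - eqn.symbol r ξ) ^ 2 :=
    ((hc0.comp (continuous_id.add continuous_const)).sub hc0).pow 2
  have hT0 : 0 ≤ T := h0.trans hT
  cases eqn with
  | wave =>
    unfold energyConst
    constructor
    · refine (integral_le_of_le (C := T * h) hc ht0 fun r hr => ?_).trans ?_
      · have h1 := abs_mul_sinc_sub_le r (r + h) ‖ξ‖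
        rw [add_sub_cancel_left, abs_of_nonneg h0] at h1
        have h2 := pow_le_pow_left₀ (abs_nonneg _) h1 2
        rw [sq_abs] at h2
        simp only [symbol]
        nlinarith
      · have : T * h * t ≤ T * h * T := by gcongr
        nlinarith [mul_nonneg hT0 h0, mul_nonneg hT0 (mul_nonneg hT0 h0)]
    · rw [← intervalIntegral.integral_const_mul]
      refine (integral_le_of_le (C := 4) (continuous_const.mul hc) ht0 fun r _ => ?_).trans
        (by nlinarith)
      change ‖ξ‖ ^ 2 * (Equation.wave.symbol (r + h) ξ - Equation.wave.symbol r ξ) ^ 2 ≤ 4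
      rw [← mul_pow, mul_sub]
      simp only [symbol, mul_mul_sinc]
      have h1 := Real.sin_le_one ((r + h) * ‖ξ‖)
      have h2 := Real.neg_one_le_sin ((r + h) * ‖ξ‖)
      have h3 := Real.sin_le_one (r * ‖ξ‖)
      have h4 := Real.neg_one_le_sin (r * ‖ξ‖)
      nlinarith
  | heat =>
    have hprod : ∀ r, (Equation.heat.symbol (r + h) ξ - Equation.heat.symbol r ξ) ^ 2 =
        (1 - Real.exp (-(h * ‖ξ‖ ^ 2 / 2))) ^ 2 * Equation.heat.symbol r ξ ^ 2 := by
      intro r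
      simp only [symbol]
      rw [show -((r + h) * ‖ξ‖ ^ 2 / 2) = -(r * ‖ξ‖ ^ 2 / 2) + -(h * ‖ξ‖ ^ 2 / 2) by ring,
        Real.exp_add]
      ring
    simp_rw [hprod, intervalIntegral.integral_const_mul]
    obtain ⟨-, h2⟩ := Equation.heat.integral_symbol_sq_le ht0 htT ξ
    set E := ∫ r in 0..t, Equation.heat.symbol r ξ ^ 2
    have hE : 0 ≤ E := intervalIntegral.integral_nonneg ht0 fun r _ => sq_nonneg _
    set y := h * ‖ξ‖ ^ 2 / 2 with hy
    have hy0 : 0 ≤ y := by positivity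
    have hy1 : 0 ≤ 1 - Real.exp (-y) := sub_nonneg.2 (Real.exp_le_one_iff.2 (by linarith))
    have hy2 : 1 - Real.exp (-y) ≤ 1 := by linarith [Real.exp_pos (-y)]
    have hy3 : 1 - Real.exp (-y) ≤ y := by linarith [Real.add_one_le_exp (-y)]
    have hsq : (1 - Real.exp (-y)) ^ 2 ≤ 1 := pow_le_one₀ hy1 hy2
    have hsq' : (1 - Real.exp (-y)) ^ 2 ≤ y := by nlinarith
    constructor
    · calc _ ≤ y * E := by gcongr
        _ = (‖ξ‖ ^ 2 * E) * h / 2 := by rw [hy]; ring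
        _ ≤ energyConst T * h / 2 := by gcongr
        _ ≤ _ := by
          have : 0 ≤ energyConst T * h := by unfold energyConst; positivity
          linarith
    · calc _ = (1 - Real.exp (-y)) ^ 2 * (‖ξ‖ ^ 2 * E) := by ring
        _ ≤ 1 * (‖ξ‖ ^ 2 * E) := by gcongr
        _ ≤ _ := by rw [one_mul]; exact h2

/-- Reversal of time in an integral over `[a, b)`. -/
lemma lintegral_indicator_comp_sub {g : ℝ → ℝ} (hg : Continuous g) (hg0 : ∀ r, 0 ≤ g r)
    {a b c : ℝ} (ha : 0 ≤ a) (hab : a ≤ b) :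
    ∫⁻ s in Set.Ici (0 : ℝ), (Set.Ico a b).indicator (fun s => ENNReal.ofReal (g (c - s))) s =
      ENNReal.ofReal (∫ r in (c - b)..(c - a), g r) := by
  have hsub : Set.Ico a b ∩ Set.Ici 0 = Set.Ico a b :=
    Set.inter_eq_left.2 fun s hs => ha.trans hs.1
  rw [lintegral_indicator measurableSet_Ico, Measure.restrict_restrict measurableSet_Ico, hsub,
    ← intervalIntegral.integral_comp_sub_left, intervalIntegral.integral_of_le hab,
    integral_Ioc_eq_integral_Ioo, ← integral_Ico_eq_integral_Ioo,
    ofReal_integral_eq_lintegral_ofReal]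
  · exact ((hg.comp (continuous_const.sub continuous_id)).continuousOn.integrableOn_Icc).mono_set
      Set.Ico_subset_Icc_self
  · exact ae_of_all _ fun s => hg0 _

lemma enorm_sq_eq_ofReal (z : ℂ) : ‖z‖ₑ ^ 2 = ENNReal.ofReal (‖z‖ ^ 2) := by
  rw [← ofReal_norm, ENNReal.ofReal_pow (norm_nonneg _)]

lemma Equation.lintegral_convSymbol_sq (eqn : Equation) {t : ℝ} (ht : 0 ≤ t) (x ξ : Space d) :
    ∫⁻ s in Set.Ici (0 : ℝ), ‖eqn.convSymbol t x s ξ‖ₑ ^ 2 =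
      ENNReal.ofReal (∫ r in 0..t, eqn.symbol r ξ ^ 2) := by
  have h := lintegral_indicator_comp_sub (g := fun r => eqn.symbol r ξ ^ 2) (c := t)
    ((eqn.continuous_symbol_left ξ).pow 2) (fun _ => sq_nonneg _) le_rfl ht
  rw [sub_self, sub_zero] at h
  rw [← h]
  refine lintegral_congr fun s => ?_
  rw [enorm_sq_eq_ofReal, eqn.norm_convSymbol]
  by_cases hs : s ∈ Set.Ico 0 t
  · rw [Set.indicator_of_mem hs, Set.indicator_of_mem hs, sq_abs]
  · rw [Set.indicator_of_notMem hs, Set.indicator_of_notMem hs]; simp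

lemma norm_cexp_sub_cexp_sq_le (ξ x x' : Space d) :
    ‖Complex.exp (-(Complex.I * ((inner ℝ ξ x : ℝ) : ℂ))) -
      Complex.exp (-(Complex.I * ((inner ℝ ξ x' : ℝ) : ℂ)))‖ ^ 2 ≤ 4 ∧
    ‖Complex.exp (-(Complex.I * ((inner ℝ ξ x : ℝ) : ℂ))) -
      Complex.exp (-(Complex.I * ((inner ℝ ξ x' : ℝ) : ℂ)))‖ ^ 2 ≤ ‖ξ‖ ^ 2 * ‖x - x'‖ ^ 2 := by
  constructor
  · have h := norm_sub_le (Complex.exp (-(Complex.I * ((inner ℝ ξ x : ℝ) : ℂ))))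
      (Complex.exp (-(Complex.I * ((inner ℝ ξ x' : ℝ) : ℂ))))
    rw [norm_cexp_neg_I_mul, norm_cexp_neg_I_mul] at h
    nlinarith [norm_nonneg (Complex.exp (-(Complex.I * ((inner ℝ ξ x : ℝ) : ℂ))) -
      Complex.exp (-(Complex.I * ((inner ℝ ξ x' : ℝ) : ℂ))))]
  · rw [← mul_pow]
    refine pow_le_pow_left₀ (norm_nonneg _) ?_ 2
    have h1 : Complex.exp (-(Complex.I * ((inner ℝ ξ x : ℝ) : ℂ))) -
        Complex.exp (-(Complex.I * ((inner ℝ ξ x' : ℝ) : ℂ))) =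
        Complex.exp (-(Complex.I * ((inner ℝ ξ x' : ℝ) : ℂ))) *
          (Complex.exp (Complex.I * ((-inner ℝ ξ (x - x') : ℝ) : ℂ)) - 1) := by
      rw [mul_sub, mul_one, ← Complex.exp_add]
      congr 2
      rw [inner_sub_right]; push_cast; ring
    rw [h1, norm_mul, norm_cexp_neg_I_mul, one_mul]
    refine Real.norm_exp_I_mul_ofReal_sub_one_le.trans ?_
    rw [Real.norm_eq_abs, abs_neg]
    exact abs_real_inner_le_norm _ _

/-- The energy of a space-time increment at frequency `ξ`. -/
lemma Equation.exists_lintegral_convSymbol_sub_sq_le (eqn : Equation) {T t t' : ℝ} (ht : 0 ≤ t)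
    (htt' : t ≤ t') (ht' : t' ≤ T) (x x' ξ : Space d) :
    ∃ D : ℝ, 0 ≤ D ∧
      ∫⁻ s in Set.Ici (0 : ℝ), ‖eqn.convSymbol t x s ξ - eqn.convSymbol t' x' s ξ‖ₑ ^ 2 ≤
        ENNReal.ofReal D ∧
      D ≤ 12 * energyConst T * ((t' - t) + ‖x - x'‖ ^ 2) ∧ ‖ξ‖ ^ 2 * D ≤ 12 * energyConst T := by
  have htT : t ≤ T := htt'.trans ht'
  have hc := eqn.continuous_symbol_left ξ
  set E : Space d → ℂ := fun x => Complex.exp (-(Complex.I * ((inner ℝ ξ x : ℝ) : ℂ))) with hE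
  set a := ‖E x - E x'‖ ^ 2 with ha
  set h := t' - t with hh
  have h0 : 0 ≤ h := sub_nonneg.2 htt'
  have hhT : h ≤ T := by linarith
  set A := ∫ r in 0..t, eqn.symbol r ξ ^ 2
  set B := ∫ r in 0..t, (eqn.symbol (r + h) ξ - eqn.symbol r ξ) ^ 2
  set B' := ∫ r in 0..h, eqn.symbol r ξ ^ 2
  have hA0 : 0 ≤ A := intervalIntegral.integral_nonneg ht fun r _ => sq_nonneg _
  have hB0 : 0 ≤ B := intervalIntegral.integral_nonneg ht fun r _ => sq_nonneg _
  have hB'0 : 0 ≤ B' := intervalIntegral.integral_nonneg h0 fun r _ => sq_nonneg _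
  have ha0 : 0 ≤ a := sq_nonneg _
  obtain ⟨hA1, hA2⟩ := eqn.integral_symbol_sq_le ht htT ξ
  obtain ⟨hB1, hB2⟩ := eqn.integral_symbol_sub_sq_le h0 hhT ht htT ξ
  obtain ⟨hB'1, hB'2⟩ := eqn.integral_symbol_sq_le h0 hhT ξ
  obtain ⟨ha1, ha2⟩ := norm_cexp_sub_cexp_sq_le ξ x x'
  have hK : 0 ≤ energyConst T := by unfold energyConst; positivity
  -- On `[0, t)` both integrands are present, and the difference splits into a space and a time
  -- increment via `(u + v)² ≤ 2u² + 2v²`, giving `2aA + 2B`. On `[t, t')` only the later one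
  -- survives, giving `B'`. Since `a ≤ 4`, the weighted sum is at most `8 + 2 + 1 = 11` energy
  -- constants, rounded up to `12`.
  refine ⟨2 * (a * A) + 2 * B + B', by positivity, ?_, ?_, ?_⟩
  · have e1 := lintegral_indicator_comp_sub (g := fun r => 2 * (a * eqn.symbol r ξ ^ 2) +
        2 * (eqn.symbol (r + h) ξ - eqn.symbol r ξ) ^ 2) (c := t) (by fun_prop)
        (fun _ => by positivity) le_rfl ht
    have e2 := lintegral_indicator_comp_sub (g := fun r => eqn.symbol r ξ ^ 2) (c := t')
        (by fun_prop) (fun _ => by positivity) ht htt'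
    rw [sub_self, sub_zero, intervalIntegral.integral_add
      ((by fun_prop : Continuous _).intervalIntegrable _ _)
      ((by fun_prop : Continuous _).intervalIntegrable _ _), intervalIntegral.integral_const_mul,
      intervalIntegral.integral_const_mul, intervalIntegral.integral_const_mul] at e1
    rw [sub_self] at e2
    rw [ENNReal.ofReal_add (by positivity) hB'0, ← e1, ← e2, ← lintegral_add_right _
      ((Measurable.indicator (by fun_prop) measurableSet_Ico))]
    refine lintegral_mono fun s => ?_
    simp only
    rw [enorm_sq_eq_ofReal]
    by_cases hs1 : s ∈ Set.Ico 0 t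
    · have hs2 : s ∈ Set.Ico 0 t' := ⟨hs1.1, hs1.2.trans_le htt'⟩
      rw [Set.indicator_of_mem hs1]
      refine le_trans (ENNReal.ofReal_le_ofReal ?_) (le_self_add)
      unfold convSymbol
      rw [Set.indicator_of_mem hs1, Set.indicator_of_mem hs2]
      have hdec : E x * (eqn.symbol (t - s) ξ : ℂ) - E x' * (eqn.symbol (t' - s) ξ : ℂ) =
          (E x - E x') * (eqn.symbol (t - s) ξ : ℂ) +
            E x' * ((eqn.symbol (t - s) ξ - eqn.symbol (t' - s) ξ : ℝ) : ℂ) := by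
        push_cast; ring
      rw [show t - s + h = t' - s by rw [hh]; ring]
      refine le_trans (b := (‖E x - E x'‖ * |eqn.symbol (t - s) ξ| +
        |eqn.symbol (t - s) ξ - eqn.symbol (t' - s) ξ|) ^ 2) ?_ ?_
      · refine pow_le_pow_left₀ (norm_nonneg _) ?_ 2
        change ‖E x * (eqn.symbol (t - s) ξ : ℂ) - E x' * (eqn.symbol (t' - s) ξ : ℂ)‖ ≤ _
        rw [hdec]
        refine (norm_add_le _ _).trans (le_of_eq ?_)
        rw [norm_mul, norm_mul, hE, norm_cexp_neg_I_mul, one_mul, Complex.norm_real,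
          Complex.norm_real, Real.norm_eq_abs, Real.norm_eq_abs]
      · refine add_sq_le.trans (le_of_eq ?_)
        rw [mul_pow, sq_abs, sq_abs, ← ha, mul_add, ← neg_sq (eqn.symbol (t - s) ξ - _), neg_sub]
    · rw [Set.indicator_of_notMem hs1, zero_add]
      unfold convSymbol
      rw [Set.indicator_of_notMem hs1, zero_sub, norm_neg]
      by_cases hs2 : s ∈ Set.Ico 0 t'
      · have hs3 : s ∈ Set.Ico t t' := ⟨not_lt.1 fun hlt => hs1 ⟨hs2.1, hlt⟩, hs2.2⟩
        rw [Set.indicator_of_mem hs2, Set.indicator_of_mem hs3, norm_mul, norm_cexp_neg_I_mul,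
          one_mul, Complex.norm_real, Real.norm_eq_abs, sq_abs]
      · rw [Set.indicator_of_notMem hs2]; simp
  · have h1 : a * A ≤ energyConst T * ‖x - x'‖ ^ 2 := by
      calc a * A ≤ (‖ξ‖ ^ 2 * ‖x - x'‖ ^ 2) * A := by gcongr
        _ = (‖ξ‖ ^ 2 * A) * ‖x - x'‖ ^ 2 := by ring
        _ ≤ _ := by gcongr
    nlinarith [mul_nonneg hK h0, mul_nonneg hK (sq_nonneg ‖x - x'‖)]
  · have h1 : ‖ξ‖ ^ 2 * (a * A) ≤ 4 * energyConst T := by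
      calc ‖ξ‖ ^ 2 * (a * A) = a * (‖ξ‖ ^ 2 * A) := by ring
        _ ≤ 4 * energyConst T := mul_le_mul ha1 hA2 (by positivity) (by norm_num)
    nlinarith

/-- Write `D = D^(1-q/2) D^(q/2)`. The first factor is estimated by the increment bound and keeps a
power of `δ`, positive since `q < 2`. The second is estimated by the increment bound with `δ₀`, and,
once multiplied by `l^q`, by the weighted bound. -/
lemma interpolation_le {D A δ δ₀ l q : ℝ} (hD : 0 ≤ D) (hA : 0 ≤ A) (hδ : 0 ≤ δ) (hδ₀ : δ ≤ δ₀)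
    (hl : 0 ≤ l) (hq0 : 0 < q) (hq2 : q < 2) (h1 : D ≤ A * δ) (h2 : l ^ 2 * D ≤ A) :
    D ≤ A ^ (1 - q / 2) * ((A * δ₀) ^ (q / 2) + A ^ (q / 2)) * δ ^ (1 - q / 2) *
      (1 / (1 + l ^ q)) := by
  have hlq : 0 ≤ l ^ q := Real.rpow_nonneg hl q
  rw [mul_one_div, le_div_iff₀ (by positivity)]
  have hDD : D = D ^ (1 - q / 2) * D ^ (q / 2) := by
    rw [← Real.rpow_add' hD (by norm_num)]; simp
  have e1 : D ^ (1 - q / 2) ≤ A ^ (1 - q / 2) * δ ^ (1 - q / 2) := by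
    rw [← Real.mul_rpow hA hδ]
    exact Real.rpow_le_rpow hD h1 (by linarith)
  have e2 : D ^ (q / 2) ≤ (A * δ₀) ^ (q / 2) :=
    Real.rpow_le_rpow hD (h1.trans (by gcongr)) (by linarith)
  have e3 : D ^ (q / 2) * l ^ q ≤ A ^ (q / 2) := by
    have : l ^ q = (l ^ 2) ^ (q / 2) := by
      rw [← Real.rpow_natCast, ← Real.rpow_mul hl]; congr 1; push_cast; ring
    rw [this, ← Real.mul_rpow hD (sq_nonneg l), mul_comm D]
    exact Real.rpow_le_rpow (by positivity) h2 (by linarith)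
  have hA1 : 0 ≤ A ^ (1 - q / 2) * δ ^ (1 - q / 2) := by positivity
  calc D * (1 + l ^ q) = D ^ (1 - q / 2) * (D ^ (q / 2) + D ^ (q / 2) * l ^ q) := by
        conv_lhs => rw [hDD]
        ring
    _ ≤ (A ^ (1 - q / 2) * δ ^ (1 - q / 2)) * ((A * δ₀) ^ (q / 2) + A ^ (q / 2)) := by
        gcongr
    _ = _ := by ring

end

/-! ### The kernel is approximable by test functions. -/

section

variable {d : ℕ} {μ : Measure (Space d)}

lemma sq_eLpNorm_two_spaceTime_swap [SigmaFinite μ] {f : ℝ × Space d → ℂ} (hf : Measurable f) :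
    eLpNorm f 2 (spaceTime μ) ^ 2 = ∫⁻ ξ, ∫⁻ t in Set.Ici (0 : ℝ), ‖f (t, ξ)‖ₑ ^ 2 ∂volume ∂μ := by
  rw [sq_eLpNorm_two, spaceTime, lintegral_prod_symm _ (by fun_prop)]

/-- `convSymbol` as a function on space-time. -/
abbrev Equation.convFun (eqn : Equation) (t : ℝ) (x : Space d) (p : ℝ × Space d) : ℂ :=
  eqn.convSymbol t x p.1 p.2

lemma energyConst_nonneg (T : ℝ) : 0 ≤ energyConst T := by unfold energyConst; positivity

lemma Equation.lintegral_convSymbol_sq_le (eqn : Equation) {t : ℝ} (ht : 0 ≤ t) (x ξ : Space d) :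
    ∫⁻ s in Set.Ici (0 : ℝ), ‖eqn.convSymbol t x s ξ‖ₑ ^ 2 ≤
      ENNReal.ofReal (energyConst t * t + energyConst t) *
        ENNReal.ofReal (1 / (1 + ‖ξ‖ ^ 2)) := by
  have hK := energyConst_nonneg t
  obtain ⟨h1, h2⟩ := eqn.integral_symbol_sq_le ht le_rfl ξ
  rw [eqn.lintegral_convSymbol_sq ht, ← ENNReal.ofReal_mul (by positivity)]
  refine ENNReal.ofReal_le_ofReal ?_
  rw [mul_one_div, le_div_iff₀ (by positivity)]
  linarith

lemma Equation.memLp_convFun [hμ : IsDalang μ] (eqn : Equation) {t : ℝ} (ht : 0 ≤ t) (x : Space d) :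
    MemLp (eqn.convFun t x) 2 (spaceTime μ) := by
  refine ⟨(eqn.measurable_convSymbol t x).aestronglyMeasurable, ?_⟩
  have h : eLpNorm (eqn.convFun t x) 2 (spaceTime μ) ^ 2 < ∞ := by
    rw [sq_eLpNorm_two_spaceTime_swap (eqn.measurable_convSymbol t x)]
    refine (lintegral_mono fun ξ => eqn.lintegral_convSymbol_sq_le ht x ξ).trans_lt ?_
    rw [lintegral_const_mul _ (by fun_prop)]
    exact ENNReal.mul_lt_top ENNReal.ofReal_lt_top hμ.lintegral_lt_top
  by_contra htop
  rw [not_lt, top_le_iff] at htop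
  simp [htop] at h

lemma Equation.norm_convSymbol_le (eqn : Equation) {t : ℝ} (x : Space d) (s : ℝ)
    (ξ : Space d) :
    ‖eqn.convSymbol t x s ξ‖ ≤ (Set.Icc 0 t).indicator (fun _ => 1 + t) s := by
  rw [eqn.norm_convSymbol]
  by_cases hs : s ∈ Set.Ico 0 t
  · rw [Set.indicator_of_mem hs, Set.indicator_of_mem (Set.Ico_subset_Icc_self hs)]
    refine (eqn.abs_symbol_le (sub_nonneg.2 hs.2.le) ξ).trans ?_
    linarith [hs.1]
  · rw [Set.indicator_of_notMem hs]
    refine Set.indicator_nonneg (fun s hs => ?_) s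
    linarith [hs.1.trans hs.2]

/-- Time is frozen at the left endpoint of each of `n + 1` equal subintervals. A frozen slice is the
transform of a finite measure, so each term is approximable, and continuity of the symbol in time
gives convergence. The factor `𝓕 f` supplies the square-integrable dominating function: the frozen
symbols alone are only bounded by `1 + t`. -/
lemma Equation.isApproximable_convFun_mul_fourierFun [IsDalang μ] {eqn : Equation}
    (hadm : eqn.Admissible d) {t : ℝ} (ht : 0 < t) (x : Space d) {f : Space d → ℝ}
    (hf : ContDiff ℝ ((⊤ : ℕ∞) : WithTop ℕ∞) f) (hc : HasCompactSupport f) :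
    IsApproximable μ (fun p => eqn.convFun t x p * fourierFun f p.2) := by
  have hf1 : ContDiff ℝ 1 f := hf.of_le (by exact_mod_cast le_top)
  have hfm := measurable_fourierFun hf.continuous.measurable
  let τ : ℕ → ℕ → ℝ := fun n j => j * (t / ((n : ℝ) + 1))
  have hstep : ∀ n : ℕ, 0 < t / ((n : ℝ) + 1) := fun n => by positivity
  let u : ℕ → ℝ × Space d → ℂ := fun n p => ∑ j ∈ Finset.range (n + 1),
    (Set.Ico (τ n j) (τ n (j + 1))).indicator (fun _ => 1) p.1 *
      (eqn.convSymbol t x (τ n j) p.2 * fourierFun f p.2)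
  have hterm : ∀ n j, Measurable fun p : ℝ × Space d =>
      (Set.Ico (τ n j) (τ n (j + 1))).indicator (fun _ => (1 : ℂ)) p.1 *
      (eqn.convSymbol t x (τ n j) p.2 * fourierFun f p.2) := by
    intro n j
    refine ((measurable_const.indicator measurableSet_Ico).comp measurable_fst).mul
      (Measurable.mul ?_ (hfm.comp measurable_snd))
    exact (eqn.measurable_convSymbol t x).comp (f := fun p : ℝ × Space d => (τ n j, p.2))
      (by fun_prop)
  have hfloor : ∀ n s, 0 ≤ s → ∀ j : ℕ, s ∈ Set.Ico (τ n j) (τ n (j + 1)) ↔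
      ⌊s / (t / ((n : ℝ) + 1))⌋₊ = j := by
    intro n s hs j
    rw [Nat.floor_eq_iff (div_nonneg hs (hstep n).le), le_div_iff₀ (hstep n),
      div_lt_iff₀ (hstep n)]
    simp [τ]
  -- At each time in `[0, t)` exactly one term of the sum is present, the one indexed by the integer
  -- part.
  have hu : ∀ n p, u n p = (Set.Ico 0 t).indicator (fun s =>
      eqn.convSymbol t x (τ n ⌊s / (t / ((n : ℝ) + 1))⌋₊) p.2 * fourierFun f p.2) p.1 := by
    intro n p
    by_cases hp : p.1 ∈ Set.Ico 0 t
    · rw [Set.indicator_of_mem hp]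
      simp only [u]
      rw [Finset.sum_eq_single ⌊p.1 / (t / ((n : ℝ) + 1))⌋₊]
      · rw [Set.indicator_of_mem ((hfloor n p.1 hp.1 _).2 rfl), one_mul]
      · intro j _ hj
        rw [Set.indicator_of_notMem, zero_mul]
        exact fun h => hj ((hfloor n p.1 hp.1 j).1 h).symm
      · intro h
        refine absurd ?_ h
        rw [Finset.mem_range, Nat.floor_lt (div_nonneg hp.1 (hstep n).le), div_lt_iff₀ (hstep n)]
        have : ((n + 1 : ℕ) : ℝ) * (t / ((n : ℝ) + 1)) = t := by push_cast; field_simp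
        rw [this]
        exact hp.2
    · rw [Set.indicator_of_notMem hp]
      refine Finset.sum_eq_zero fun j hj => ?_
      rw [Set.indicator_of_notMem, zero_mul]
      intro h
      refine hp ⟨le_trans (by positivity) h.1, h.2.trans_le ?_⟩
      have hj' : ((j + 1 : ℕ) : ℝ) ≤ (n : ℝ) + 1 := by
        exact_mod_cast Finset.mem_range.1 hj
      calc τ n (j + 1) ≤ ((n : ℝ) + 1) * (t / ((n : ℝ) + 1)) :=
            mul_le_mul_of_nonneg_right hj' (hstep n).le
        _ = t := by field_simp
  refine IsApproximable.of_dominated (u := u) (fun n => ?_)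
    (fun n => Finset.measurable_sum _ fun j _ => hterm n j)
    ((eqn.measurable_convSymbol t x).mul (hfm.comp measurable_snd))
    (memLp_indicator_mul_fourierFun hf1 hc (1 + t) t) (fun n => ae_of_all _ fun p => ?_)
    (ae_of_all _ fun p => ?_)
  · refine IsApproximable.sum _ (fun j => ?_) (hterm n)
    have hfin := eqn.isFiniteMeasure_integrand hadm t x (τ n j)
    have := isApproximable_indicator_mul_fourierMeas (μ := μ) hf hc (a := τ n j)
      (b := τ n (j + 1)) (by positivity) (by
        simp only [τ]; push_cast
        have := hstep n
        linarith) (eqn.integrand d t x (τ n j))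
    simpa only [eqn.fourierMeas_integrand hadm] using this
  · rw [hu]
    by_cases hp : p.1 ∈ Set.Ico 0 t
    · rw [Set.indicator_of_mem hp, Set.indicator_of_mem (Set.Ico_subset_Icc_self hp), norm_mul,
        norm_mul]
      refine mul_le_mul_of_nonneg_right ?_ (norm_nonneg _)
      rw [Complex.norm_real, Real.norm_eq_abs, abs_of_nonneg (by positivity)]
      refine (eqn.norm_convSymbol_le x _ p.2).trans ?_
      exact Set.indicator_le_self' (fun _ _ => by positivity) _
    · rw [Set.indicator_of_notMem hp, norm_zero]
      exact norm_nonneg _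
  · simp only [hu]
    by_cases hp : p.1 ∈ Set.Ico 0 t
    · simp only [Set.indicator_of_mem hp]
      refine Tendsto.mul_const _ ?_
      have hlim : Tendsto (fun n : ℕ => τ n ⌊p.1 / (t / ((n : ℝ) + 1))⌋₊) atTop (𝓝 p.1) := by
        have h1 := (tendsto_nat_floor_mul_div_atTop (R := ℝ) (a := p.1 / t)
          (div_nonneg hp.1 ht.le)).comp (tendsto_natCast_atTop_atTop.comp (tendsto_add_atTop_nat 1))
        have h2 := h1.mul_const t
        rw [div_mul_cancel₀ _ ht.ne'] at h2
        refine h2.congr fun n => ?_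
        simp only [Function.comp, τ]
        push_cast
        rw [show p.1 / (t / ((n : ℝ) + 1)) = p.1 / t * ((n : ℝ) + 1) by field_simp]
        ring
      have hmem : ∀ n : ℕ, τ n ⌊p.1 / (t / ((n : ℝ) + 1))⌋₊ ∈ Set.Ico 0 t := by
        intro n
        refine ⟨by positivity, lt_of_le_of_lt ?_ hp.2⟩
        have := Nat.floor_le (div_nonneg hp.1 (hstep n).le)
        rwa [le_div_iff₀ (hstep n)] at this
      unfold convFun convSymbol
      rw [Set.indicator_of_mem hp]
      simp only [Set.indicator_of_mem (hmem _)]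
      refine Tendsto.const_mul _ ((Complex.continuous_ofReal.tendsto _).comp ?_)
      exact ((eqn.continuous_symbol_left p.2).tendsto _).comp (tendsto_const_nhds.sub hlim)
    · simp only [Set.indicator_of_notMem hp]
      unfold convFun convSymbol
      rw [Set.indicator_of_notMem hp, zero_mul]
      exact tendsto_const_nhds

/-- Mollifying in space multiplies the symbol by `𝓕 fₙ`, of modulus at most `1` and tending to `1`
because `fₙ` has mass one in a ball of radius `1/(n+1)`. The symbol itself then dominates, being
square integrable by Dalang's condition. -/
lemma Equation.isApproximable_convFun [IsDalang μ] {eqn : Equation} (hadm : eqn.Admissible d)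
    {t : ℝ} (ht : 0 ≤ t) (x : Space d) : IsApproximable μ (eqn.convFun t x) := by
  rcases ht.eq_or_lt with rfl | ht
  · have : eqn.convFun (d := d) 0 x = fun _ => 0 := by
      funext p; simp [convFun, convSymbol]
    rw [this]
    exact IsApproximable.zero
  let η : ℕ → ContDiffBump (0 : Space d) := fun n =>
    ⟨1 / ((n : ℝ) + 1) / 2, 1 / ((n : ℝ) + 1), by positivity, half_lt_self (by positivity)⟩
  let f : ℕ → Space d → ℝ := fun n => (η n).normed volume
  have hf : ∀ n, ContDiff ℝ ((⊤ : ℕ∞) : WithTop ℕ∞) (f n) := fun n => (η n).contDiff_normed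
  have hc : ∀ n, HasCompactSupport (f n) := fun n => (η n).hasCompactSupport_normed
  have hint : ∀ n, Integrable (f n) := fun n =>
    (hf n).continuous.integrable_of_hasCompactSupport (hc n)
  have hone : ∀ n, ∫ y, f n y = 1 := fun n => (η n).integral_normed
  have hnn : ∀ n y, 0 ≤ f n y := fun n y => (η n).nonneg_normed y
  have hle1 : ∀ n ξ, ‖fourierFun (f n) ξ‖ ≤ 1 := by
    intro n ξ
    refine (norm_fourierFun_le_integral _ ξ).trans (le_of_eq ?_)
    rw [← hone n]
    refine integral_congr_ae (ae_of_all _ fun y => ?_)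
    simp only [Real.norm_eq_abs, abs_of_nonneg (hnn n y)]
  have hlim : ∀ ξ, Tendsto (fun n => fourierFun (f n) ξ) atTop (𝓝 1) := by
    intro ξ
    have hb : ∀ n, ‖fourierFun (f n) ξ - 1‖ ≤ ‖ξ‖ * (1 / ((n : ℝ) + 1)) := by
      intro n
      have hE : Integrable fun y => Complex.exp (-(Complex.I * ((inner ℝ ξ y : ℝ) : ℂ))) *
          (f n y : ℂ) := by
        refine ((hint n).ofReal (𝕜 := ℂ)).bdd_mul (c := 1)
          (by fun_prop : Continuous _).aestronglyMeasurable (ae_of_all _ fun y => ?_)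
        rw [norm_cexp_neg_I_mul]
      have h1 : fourierFun (f n) ξ - 1 = ∫ y, (Complex.exp (-(Complex.I * ((inner ℝ ξ y : ℝ) : ℂ))) *
          (f n y : ℂ) - (f n y : ℂ)) := by
        have h2 := integral_sub hE ((hint n).ofReal (𝕜 := ℂ))
        have h3 : ∫ y, ((f n y : ℝ) : ℂ) = 1 := by rw [integral_complex_ofReal, hone n]; simp
        exact (h2.trans (congrArg₂ _ rfl h3)).symm
      rw [h1]
      refine (norm_integral_le_of_norm_le ((hint n).const_mul (‖ξ‖ * (1 / ((n : ℝ) + 1))))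
        (ae_of_all _ fun y => ?_)).trans (le_of_eq ?_)
      · rw [← sub_one_mul, norm_mul, Complex.norm_real, Real.norm_eq_abs, abs_of_nonneg (hnn n y)]
        by_cases hy : y ∈ Metric.ball (0 : Space d) (1 / ((n : ℝ) + 1))
        · refine mul_le_mul_of_nonneg_right ?_ (hnn n y)
          have := Real.norm_exp_I_mul_ofReal_sub_one_le (x := -inner ℝ ξ y)
          rw [show Complex.I * ((-inner ℝ ξ y : ℝ) : ℂ) = -(Complex.I * ((inner ℝ ξ y : ℝ) : ℂ)) by
            push_cast; ring] at this
          refine this.trans ?_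
          rw [Real.norm_eq_abs, abs_neg]
          refine (abs_real_inner_le_norm _ _).trans ?_
          rw [mem_ball_zero_iff] at hy
          gcongr
        · have : f n y = 0 := by
            rw [← Function.notMem_support]
            rwa [show Function.support (f n) = _ from (η n).support_normed_eq]
          simp [this]
      · rw [integral_const_mul, hone n, mul_one]
    rw [tendsto_iff_norm_sub_tendsto_zero]
    refine squeeze_zero (fun _ => norm_nonneg _) hb ?_
    simpa using (tendsto_one_div_add_atTop_nhds_zero_nat (𝕜 := ℝ)).const_mul ‖ξ‖
  refine IsApproximable.of_dominated
    (u := fun n p => eqn.convFun t x p * fourierFun (f n) p.2)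
    (fun n => isApproximable_convFun_mul_fourierFun hadm ht x (hf n) (hc n))
    (fun n => (eqn.measurable_convSymbol t x).mul
      ((measurable_fourierFun (hf n).continuous.measurable).comp measurable_snd))
    (eqn.measurable_convSymbol t x) (eqn.memLp_convFun ht.le x) (fun n => ae_of_all _ fun p => ?_)
    (ae_of_all _ fun p => ?_)
  · rw [norm_mul]
    exact mul_le_of_le_one_right (norm_nonneg _) (hle1 n _)
  · simpa using (hlim p.2).const_mul (eqn.convFun t x p)

end

/-! ### Dyadic chaining for a fixed function. -/

section Chaining

variable {ι : Type*} [Fintype ι]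

/-- The point `2⁻ᵏ z` of the dyadic grid of level `k`. -/
def dyadicPoint (k : ℕ) (z : ι → ℤ) : ι → ℝ := fun i => (z i : ℝ) / 2 ^ k

/-- The lower corner of the dyadic cube of level `k` containing `s`, in grid coordinates. -/
def dyadicFloor (k : ℕ) (s : ι → ℝ) : ι → ℤ := fun i => ⌊2 ^ k * s i⌋

omit [Fintype ι] in
lemma dyadicPoint_succ (k : ℕ) (z : ι → ℤ) :
    dyadicPoint (k + 1) (fun i => 2 * z i) = dyadicPoint k z := by
  funext i
  simp only [dyadicPoint, pow_succ]
  push_cast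
  field_simp

omit [Fintype ι] in
lemma abs_dyadicPoint_dyadicFloor_sub_le (k : ℕ) (s : ι → ℝ) (i : ι) :
    |dyadicPoint k (dyadicFloor k s) i - s i| ≤ 1 / 2 ^ k := by
  have h2 : (0 : ℝ) < 2 ^ k := by positivity
  have h : dyadicPoint k (dyadicFloor k s) i - s i =
      ((⌊2 ^ k * s i⌋ : ℝ) - 2 ^ k * s i) / 2 ^ k := by
    simp only [dyadicPoint, dyadicFloor]
    field_simp
  rw [h, abs_div, abs_of_pos h2]
  gcongr
  rw [abs_le]
  constructor <;> linarith [Int.floor_le (2 ^ k * s i), Int.lt_floor_add_one (2 ^ k * s i)]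

omit [Fintype ι] in
lemma tendsto_dyadicPoint_dyadicFloor (s : ι → ℝ) :
    Tendsto (fun k => dyadicPoint k (dyadicFloor k s)) atTop (𝓝 s) := by
  rw [tendsto_pi_nhds]
  intro i
  rw [tendsto_iff_norm_sub_tendsto_zero]
  refine squeeze_zero (fun _ => norm_nonneg _)
    (fun k => abs_dyadicPoint_dyadicFloor_sub_le k s i) ?_
  have := tendsto_pow_atTop_nhds_zero_of_lt_one (r := (1 / 2 : ℝ)) (by norm_num) (by norm_num)
  simpa [one_div_pow] using this

variable [DecidableEq ι]

/-- The grid points of level `k` neighbouring `z`, including `z`. -/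
def dyadicNhd (z : ι → ℤ) : Finset (ι → ℤ) := Finset.Icc (fun i => z i - 1) (fun i => z i + 1)

/-- The grid points of level `k` in the cube `[-N, N]^ι`. -/
def dyadicBox (N k : ℕ) : Finset (ι → ℤ) :=
  Finset.Icc (fun _ => -((N : ℤ) * 2 ^ k)) (fun _ => (N : ℤ) * 2 ^ k)

lemma mem_dyadicNhd {z z' : ι → ℤ} :
    z' ∈ dyadicNhd z ↔ ∀ i, z i - 1 ≤ z' i ∧ z' i ≤ z i + 1 := by
  simp only [dyadicNhd, Finset.mem_Icc, Pi.le_def, forall_and]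

lemma mem_dyadicBox {N k : ℕ} {z : ι → ℤ} :
    z ∈ dyadicBox N k ↔ ∀ i, -((N : ℤ) * 2 ^ k) ≤ z i ∧ z i ≤ (N : ℤ) * 2 ^ k := by
  simp only [dyadicBox, Finset.mem_Icc, Pi.le_def, forall_and]

lemma card_dyadicNhd (z : ι → ℤ) : (dyadicNhd z).card = 3 ^ Fintype.card ι := by
  simp only [dyadicNhd, Pi.card_Icc, Int.card_Icc]
  rw [Finset.prod_eq_pow_card (b := 3) fun i _ => by omega, Finset.card_univ]

lemma card_dyadicBox_le {N : ℕ} (hN : 1 ≤ N) (k : ℕ) :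
    (dyadicBox (ι := ι) N k).card ≤ (3 * N) ^ Fintype.card ι * (2 ^ k) ^ Fintype.card ι := by
  simp only [dyadicBox, Pi.card_Icc, Int.card_Icc]
  rw [Finset.prod_const, Finset.card_univ, ← mul_pow]
  refine Nat.pow_le_pow_left ?_ _
  have h1 : 1 ≤ N * 2 ^ k := Nat.one_le_iff_ne_zero.2 (by positivity)
  zify at h1
  rw [Int.toNat_le]
  push_cast
  linarith

lemma dyadicFloor_mem_dyadicBox {N : ℕ} {s : ι → ℝ} (hs : ‖s‖ ≤ N) (k : ℕ) :
    dyadicFloor k s ∈ dyadicBox N k := by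
  rw [mem_dyadicBox]
  intro i
  have h := abs_le.1 ((norm_le_pi_norm s i).trans hs)
  have h2 : (0 : ℝ) < 2 ^ k := by positivity
  constructor
  · rw [dyadicFloor, Int.le_floor]
    push_cast
    nlinarith
  · rw [dyadicFloor, ← Int.lt_add_one_iff, Int.floor_lt]
    push_cast
    nlinarith

/-- The integer part of `2u` is `2⌊u⌋` or `2⌊u⌋ + 1`, so successive dyadic approximations of `s` are
neighbours on the finer grid. -/
lemma dyadicFloor_succ_mem (k : ℕ) (s : ι → ℝ) :
    dyadicFloor (k + 1) s ∈ dyadicNhd (fun i => 2 * dyadicFloor k s i) := by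
  rw [mem_dyadicNhd]
  intro i
  simp only [dyadicFloor, pow_succ]
  have h1 := Int.floor_le (2 ^ k * s i)
  have h2 := Int.lt_floor_add_one (2 ^ k * s i)
  constructor
  · rw [Int.le_floor]
    push_cast
    linarith
  · rw [← Int.lt_add_one_iff, Int.floor_lt]
    push_cast
    linarith

lemma dyadicFloor_mem_dyadicNhd {k : ℕ} {s t : ι → ℝ} (h : ‖s - t‖ ≤ 1 / 2 ^ k) :
    dyadicFloor k s ∈ dyadicNhd (dyadicFloor k t) := by
  rw [mem_dyadicNhd]
  intro i
  have hi : |s i - t i| ≤ 1 / 2 ^ k := (norm_le_pi_norm (s - t) i).trans h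
  have h2 : (0 : ℝ) < 2 ^ k := by positivity
  rw [le_div_iff₀ h2] at hi
  replace hi : |(s i - t i) * 2 ^ k| ≤ 1 := by rwa [abs_mul, abs_of_pos h2]
  rw [abs_le] at hi
  simp only [dyadicFloor]
  have h3 := Int.floor_le (2 ^ k * t i)
  have h4 := Int.lt_floor_add_one (2 ^ k * t i)
  constructor
  · rw [Int.le_floor]
    push_cast
    linarith
  · rw [← Int.lt_add_one_iff]
    rw [Int.floor_lt]
    push_cast
    linarith

/-- The weighted sum of the `p`-th powers of the increments of `y` along dyadic neighbours in
`[-N, N]^ι`. -/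
def chainSum (p N : ℕ) (y : (ι → ℝ) → ℝ) : ℝ≥0∞ :=
  ∑' k : ℕ, 2 ^ k * ∑ z ∈ dyadicBox N k, ∑ z' ∈ dyadicNhd z,
    ‖y (dyadicPoint k z') - y (dyadicPoint k z)‖ₑ ^ p

/-- The ratio `2^{-1/p}`. -/
def chainRatio (p : ℕ) : ℝ := (1 / 2) ^ (1 / p : ℝ)

lemma chainRatio_pos (p : ℕ) : 0 < chainRatio p := Real.rpow_pos_of_pos (by norm_num) _

lemma chainRatio_lt_one {p : ℕ} (hp : p ≠ 0) : chainRatio p < 1 :=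
  Real.rpow_lt_one (by norm_num) (by norm_num) (by positivity)

lemma chainRatio_pow {p : ℕ} (hp : p ≠ 0) : chainRatio p ^ p = 1 / 2 := by
  rw [chainRatio, ← Real.rpow_natCast, ← Real.rpow_mul (by norm_num),
    one_div_mul_cancel (by exact_mod_cast hp), Real.rpow_one]

variable {p N : ℕ} {y : (ι → ℝ) → ℝ} {l : ℝ}

/-- A single term of the sum is at most the whole, so `2^k |a|^p ≤ l^p`. Taking the `p`-th root
turns the weight `2^k` into geometric decay, which makes the telescoping series along dyadic levels
summable. -/
lemma abs_sub_le_of_chainSum_le (hp : p ≠ 0) (hl : 0 ≤ l)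
    (h : chainSum p N y ≤ ENNReal.ofReal (l ^ p)) {k : ℕ} {z z' : ι → ℤ}
    (hz : z ∈ dyadicBox N k) (hz' : z' ∈ dyadicNhd z) :
    |y (dyadicPoint k z') - y (dyadicPoint k z)| ≤ l * chainRatio p ^ k := by
  set a := y (dyadicPoint k z') - y (dyadicPoint k z) with ha
  have h1 : 2 ^ k * ‖a‖ₑ ^ p ≤ ENNReal.ofReal (l ^ p) := by
    refine le_trans ?_ h
    refine le_trans ?_ (ENNReal.le_tsum k)
    gcongr
    refine le_trans ?_ (Finset.single_le_sum (f := fun z => ∑ z' ∈ dyadicNhd z,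
      ‖y (dyadicPoint k z') - y (dyadicPoint k z)‖ₑ ^ p) (fun _ _ => zero_le) hz)
    exact Finset.single_le_sum (f := fun z' =>
      ‖y (dyadicPoint k z') - y (dyadicPoint k z)‖ₑ ^ p) (fun _ _ => zero_le) hz'
  rw [← ofReal_norm, ← ENNReal.ofReal_pow (norm_nonneg _),
    show (2 : ℝ≥0∞) ^ k = ENNReal.ofReal (2 ^ k) by rw [ENNReal.ofReal_pow (by norm_num)]; simp,
    ← ENNReal.ofReal_mul (by positivity), ENNReal.ofReal_le_ofReal_iff (by positivity),
    Real.norm_eq_abs] at h1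
  have hr := chainRatio_pos p
  refine le_of_pow_le_pow_left₀ hp (by positivity) ?_
  rw [mul_pow, ← pow_mul, mul_comm k, pow_mul, chainRatio_pow hp, one_div_pow, mul_one_div,
    le_div_iff₀ (by positivity), mul_comm]
  exact h1

/-- The limit of `y` along the lower corners of the dyadic cubes containing `s`. -/
def dyadicLimit (y : (ι → ℝ) → ℝ) (s : ι → ℝ) : ℝ :=
  limUnder atTop fun k => y (dyadicPoint k (dyadicFloor k s))

omit [Fintype ι] [DecidableEq ι] in
lemma dyadicLimit_eq_self (hy : Continuous y) : dyadicLimit y = y :=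
  funext fun s => ((hy.tendsto s).comp (tendsto_dyadicPoint_dyadicFloor s)).limUnder_eq

lemma abs_succ_sub_le_of_chainSum_le (hp : p ≠ 0) (hl : 0 ≤ l)
    (h : chainSum p N y ≤ ENNReal.ofReal (l ^ p)) {s : ι → ℝ} (hs : ‖s‖ ≤ N) (k : ℕ) :
    dist (y (dyadicPoint k (dyadicFloor k s))) (y (dyadicPoint (k + 1) (dyadicFloor (k + 1) s))) ≤
      l * chainRatio p * chainRatio p ^ k := by
  have hb : (fun i => 2 * dyadicFloor k s i) ∈ dyadicBox N (k + 1) := by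
    have := dyadicFloor_mem_dyadicBox hs k
    rw [mem_dyadicBox] at this ⊢
    intro i
    have h1 := this i
    rw [pow_succ]
    constructor <;> linarith [h1.1, h1.2]
  have := abs_sub_le_of_chainSum_le hp hl h hb (dyadicFloor_succ_mem k s)
  rw [dyadicPoint_succ] at this
  rw [dist_comm, Real.dist_eq]
  refine this.trans (le_of_eq ?_)
  rw [pow_succ]; ring

lemma tendsto_dyadicLimit (hp : p ≠ 0) (hl : 0 ≤ l)
    (h : chainSum p N y ≤ ENNReal.ofReal (l ^ p)) {s : ι → ℝ} (hs : ‖s‖ ≤ N) :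
    Tendsto (fun k => y (dyadicPoint k (dyadicFloor k s))) atTop (𝓝 (dyadicLimit y s)) :=
  (cauchySeq_of_le_geometric _ _ (chainRatio_lt_one hp)
    (abs_succ_sub_le_of_chainSum_le hp hl h hs)).tendsto_limUnder

/-- **Chaining**: modulus of continuity of the dyadic limit. -/
theorem abs_dyadicLimit_sub_le (hp : p ≠ 0) (hl : 0 ≤ l)
    (h : chainSum p N y ≤ ENNReal.ofReal (l ^ p)) {s t : ι → ℝ} (hs : ‖s‖ ≤ N) (ht : ‖t‖ ≤ N)
    {k : ℕ} (hst : ‖s - t‖ ≤ 1 / 2 ^ k) :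
    |dyadicLimit y s - dyadicLimit y t| ≤
      l * (1 + 2 * chainRatio p / (1 - chainRatio p)) * chainRatio p ^ k := by
  -- A geometric tail leads from level `k` to the limit at each of `s` and `t`. At level `k` itself
  -- the two cube corners are neighbours and cost one more increment.
  have key : ∀ {s : ι → ℝ}, ‖s‖ ≤ N → dist (y (dyadicPoint k (dyadicFloor k s)))
      (dyadicLimit y s) ≤ l * chainRatio p * chainRatio p ^ k / (1 - chainRatio p) := fun {s} hs =>
    dist_le_of_le_geometric_of_tendsto _ _ (chainRatio_lt_one hp)
      (abs_succ_sub_le_of_chainSum_le hp hl h hs) (tendsto_dyadicLimit hp hl h hs) k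
  have h1 := key hs
  have h2 := key ht
  have h3 := abs_sub_le_of_chainSum_le hp hl h (dyadicFloor_mem_dyadicBox ht k)
    (dyadicFloor_mem_dyadicNhd hst)
  rw [← Real.dist_eq] at h3 ⊢
  rw [dist_comm] at h1
  have h4 := dist_triangle4 (dyadicLimit y s) (y (dyadicPoint k (dyadicFloor k s)))
    (y (dyadicPoint k (dyadicFloor k t))) (dyadicLimit y t)
  have h5 : l * (1 + 2 * chainRatio p / (1 - chainRatio p)) * chainRatio p ^ k =
    l * chainRatio p * chainRatio p ^ k / (1 - chainRatio p) + l * chainRatio p ^ k +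
      l * chainRatio p * chainRatio p ^ k / (1 - chainRatio p) := by ring
  linarith

lemma exists_chainSum_le (hp : p ≠ 0) (h : chainSum p N y < ∞) :
    ∃ l : ℝ, 0 ≤ l ∧ chainSum p N y ≤ ENNReal.ofReal (l ^ p) := by
  refine ⟨(chainSum p N y).toReal ^ (1 / p : ℝ), by positivity, ?_⟩
  rw [← Real.rpow_natCast, ← Real.rpow_mul (by positivity),
    one_div_mul_cancel (by exact_mod_cast hp), Real.rpow_one, ENNReal.ofReal_toReal h.ne]

omit [DecidableEq ι] in
/-- A modulus of continuity on bounded sets along dyadic scales gives continuity. -/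
lemma continuous_of_abs_sub_le {g : (ι → ℝ) → ℝ} {c : ℕ → ℝ} {r : ℝ} (hr0 : 0 ≤ r) (hr : r < 1)
    (h : ∀ (N : ℕ) (s t : ι → ℝ), ‖s‖ ≤ N → ‖t‖ ≤ N → ∀ k : ℕ, ‖s - t‖ ≤ 1 / 2 ^ k →
      |g s - g t| ≤ c N * r ^ k) : Continuous g := by
  rw [continuous_iff_continuousAt]
  intro t
  rw [Metric.continuousAt_iff]
  intro ε hε
  obtain ⟨N, hN⟩ := exists_nat_ge (‖t‖ + 1)
  have hlim : Tendsto (fun k => c N * r ^ k) atTop (𝓝 0) := by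
    simpa using (tendsto_pow_atTop_nhds_zero_of_lt_one hr0 hr).const_mul (c N)
  obtain ⟨k, hk⟩ := (hlim.eventually (gt_mem_nhds hε)).exists
  refine ⟨1 / 2 ^ k, by positivity, fun {s} hs => ?_⟩
  rw [dist_eq_norm] at hs
  have h1 : (1 : ℝ) / 2 ^ k ≤ 1 := by
    rw [div_le_one (by positivity)]
    exact one_le_pow₀ (by norm_num)
  have h2 : ‖s‖ ≤ N := by
    have := norm_le_norm_add_norm_sub' s t
    linarith
  exact (h N s t h2 (by linarith) k hs.le).trans_lt hk

lemma continuous_dyadicLimit (hp : p ≠ 0) (h : ∀ N, chainSum p N y < ∞) :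
    Continuous (dyadicLimit y) := by
  choose l hl0 hl using fun N => exists_chainSum_le hp (h N)
  exact continuous_of_abs_sub_le (chainRatio_pos p).le (chainRatio_lt_one hp)
    fun N s t hs ht k hst => abs_dyadicLimit_sub_le hp (hl0 N) (hl N) hs ht hst

end Chaining

/-! ### Kolmogorov's theorem along dyadic grids. -/

section ChainingProbability

variable {ι : Type*} [Fintype ι] [DecidableEq ι] {Ω : Type*} [MeasurableSpace Ω] {P : Measure Ω}
  {Y : (ι → ℝ) → Ω → ℝ} {p : ℕ} {M : ℝ≥0∞}

omit [Fintype ι] [DecidableEq ι] in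
lemma aemeasurable_enorm_sub_pow (hY : ∀ s, AEMeasurable (Y s) P) (p : ℕ) (s t : ι → ℝ) :
    AEMeasurable (fun ω => ‖Y s ω - Y t ω‖ₑ ^ p) P :=
  (((hY s).sub (hY t)).enorm).pow_const p

/-- Increments of moment `M 2^{-k(m+2)}` along the dyadic grids in dimension `m` bound the mean of
the chaining sum. -/
theorem lintegral_chainSum_le (hY : ∀ s, AEMeasurable (Y s) P)
    (hM : ∀ (k : ℕ) (z : ι → ℤ), ∀ z' ∈ dyadicNhd z,
      ∫⁻ ω, ‖Y (dyadicPoint k z') ω - Y (dyadicPoint k z) ω‖ₑ ^ p ∂P ≤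
        M * 2⁻¹ ^ (k * (Fintype.card ι + 2))) {N : ℕ} (hN : 1 ≤ N) :
    ∫⁻ ω, chainSum p N (fun s => Y s ω) ∂P ≤ (9 * N) ^ Fintype.card ι * M * 2 := by
  set m := Fintype.card ι with hm
  have hmeas : ∀ (k : ℕ) (z : ι → ℤ), AEMeasurable (fun ω => ∑ z' ∈ dyadicNhd z,
      ‖Y (dyadicPoint k z') ω - Y (dyadicPoint k z) ω‖ₑ ^ p) P := fun k z =>
    Finset.aemeasurable_fun_sum _ fun z' _ => aemeasurable_enorm_sub_pow hY p _ _
  have hmeas' : ∀ k : ℕ, AEMeasurable (fun ω => ∑ z ∈ dyadicBox N k, ∑ z' ∈ dyadicNhd z,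
      ‖Y (dyadicPoint k z') ω - Y (dyadicPoint k z) ω‖ₑ ^ p) P := fun k =>
    Finset.aemeasurable_fun_sum _ fun z _ => hmeas k z
  unfold chainSum
  rw [lintegral_tsum fun k => (hmeas' k).const_mul _]
  have hterm : ∀ k : ℕ, ∫⁻ ω, 2 ^ k * ∑ z ∈ dyadicBox N k, ∑ z' ∈ dyadicNhd z,
      ‖Y (dyadicPoint k z') ω - Y (dyadicPoint k z) ω‖ₑ ^ p ∂P ≤ (9 * N) ^ m * M * 2⁻¹ ^ k := by
    intro k
    rw [lintegral_const_mul'' _ (hmeas' k), lintegral_finsetSum' _ fun z _ => hmeas k z]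
    have h1 : ∀ z ∈ dyadicBox (ι := ι) N k, ∫⁻ ω, ∑ z' ∈ dyadicNhd z,
        ‖Y (dyadicPoint k z') ω - Y (dyadicPoint k z) ω‖ₑ ^ p ∂P ≤
          3 ^ m * (M * 2⁻¹ ^ (k * (m + 2))) := by
      intro z _
      rw [lintegral_finsetSum' _ fun z' _ => aemeasurable_enorm_sub_pow hY p _ _]
      refine (Finset.sum_le_card_nsmul _ _ _ (hM k z)).trans (le_of_eq ?_)
      rw [card_dyadicNhd, nsmul_eq_mul]
      push_cast
      rfl
    have h2 : ((dyadicBox (ι := ι) N k).card : ℝ≥0∞) ≤ (3 * N) ^ m * (2 ^ k) ^ m := by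
      exact_mod_cast card_dyadicBox_le hN k
    -- There are of order `2^{km}` grid points with `3^m` neighbours each. Against the moment
    -- `2^{-k(m+2)}`, one of the two spare powers of `2^{-k}` pays for the weight `2^k` and the
    -- other makes the series converge.
    calc _ ≤ 2 ^ k * ((dyadicBox (ι := ι) N k).card * (3 ^ m * (M * 2⁻¹ ^ (k * (m + 2))))) := by
          gcongr
          refine (Finset.sum_le_card_nsmul _ _ _ h1).trans (le_of_eq ?_)
          rw [nsmul_eq_mul]
      _ ≤ 2 ^ k * ((3 * N) ^ m * (2 ^ k) ^ m * (3 ^ m * (M * 2⁻¹ ^ (k * (m + 2))))) := by gcongr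
      _ = (3 * (3 * N)) ^ m * M * 2⁻¹ ^ k * (2 ^ (k * m + k) * 2⁻¹ ^ (k * m + k)) := by
          rw [mul_pow 3 (3 * (N : ℝ≥0∞)), show k * (m + 2) = (k * m + k) + k by ring,
            pow_add 2⁻¹ (k * m + k), pow_add 2 (k * m), pow_mul 2 k m]
          ring
      _ = (9 * N) ^ m * M * 2⁻¹ ^ k := by
          rw [← mul_pow, ENNReal.mul_inv_cancel (by norm_num) (by norm_num), one_pow, mul_one,
            ← mul_assoc]
          norm_num
  refine (ENNReal.tsum_le_tsum hterm).trans (le_of_eq ?_)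
  rw [ENNReal.tsum_mul_left, ENNReal.tsum_geometric, ENNReal.one_sub_inv_two, inv_inv]

lemma chainSum_mono {y : (ι → ℝ) → ℝ} {N N' : ℕ} (h : N ≤ N') :
    chainSum p N y ≤ chainSum p N' y := by
  unfold chainSum
  refine ENNReal.tsum_le_tsum fun k => ?_
  gcongr
  intro z hz
  rw [mem_dyadicBox] at hz ⊢
  have : (N : ℤ) * 2 ^ k ≤ (N' : ℤ) * 2 ^ k := by gcongr
  intro i
  have := hz i
  constructor <;> linarith

lemma aemeasurable_chainSum (hY : ∀ s, AEMeasurable (Y s) P) (N : ℕ) :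
    AEMeasurable (fun ω => chainSum p N fun s => Y s ω) P := by
  unfold chainSum
  exact AEMeasurable.tsum fun k => (Finset.aemeasurable_fun_sum _ fun z _ =>
    Finset.aemeasurable_fun_sum _ fun z' _ => aemeasurable_enorm_sub_pow hY p _ _).const_mul _

/-- **Kolmogorov's continuity theorem** along dyadic grids. -/
theorem exists_continuous_modification (hp : p ≠ 0) (hY : ∀ s, AEMeasurable (Y s) P)
    (hM : ∀ (k : ℕ) (z : ι → ℤ), ∀ z' ∈ dyadicNhd z,
      ∫⁻ ω, ‖Y (dyadicPoint k z') ω - Y (dyadicPoint k z) ω‖ₑ ^ p ∂P ≤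
        M * 2⁻¹ ^ (k * (Fintype.card ι + 2))) (hMtop : M ≠ ∞)
    (hlim : ∀ s, TendstoInMeasure P (fun k => Y (dyadicPoint k (dyadicFloor k s))) atTop (Y s)) :
    ∃ Z : Ω → C(ι → ℝ, ℝ), ∀ s, (fun ω => Z ω s) =ᵐ[P] Y s := by
  classical
  have hfin : ∀ᵐ ω ∂P, ∀ N, chainSum p N (fun s => Y s ω) < ∞ := by
    rw [ae_all_iff]
    intro N
    -- The count of grid points needs a box of positive size, so `N + 1` is used and the bound for
    -- `N` follows by monotonicity.
    have h : ∀ᵐ ω ∂P, chainSum p (N + 1) (fun s => Y s ω) < ∞ := by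
      refine ae_lt_top' (aemeasurable_chainSum hY _) (ne_of_lt ?_)
      refine (lintegral_chainSum_le hY hM (N := N + 1) (by omega)).trans_lt ?_
      exact ENNReal.mul_lt_top (ENNReal.mul_lt_top (ENNReal.pow_lt_top
        (ENNReal.mul_lt_top (by norm_num) (ENNReal.natCast_lt_top _))) hMtop.lt_top) (by norm_num)
    filter_upwards [h] with ω hω
    exact (chainSum_mono (Nat.le_succ N)).trans_lt hω
  refine ⟨fun ω => if h : ∀ N, chainSum p N (fun s => Y s ω) < ∞ then
    ⟨dyadicLimit fun s => Y s ω, continuous_dyadicLimit hp h⟩ else 0, fun s => ?_⟩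
  -- Along a subsequence the dyadic values converge almost surely to `Y s`. The whole sequence
  -- converges to the dyadic limit, so the two agree.
  obtain ⟨φ, hφ, hφlim⟩ := (hlim s).exists_seq_tendsto_ae
  filter_upwards [hfin, hφlim] with ω h1 h2
  rw [dif_pos h1]
  obtain ⟨N, hN⟩ := exists_nat_ge ‖s‖
  obtain ⟨l, hl0, hl⟩ := exists_chainSum_le hp (h1 N)
  exact tendsto_nhds_unique ((tendsto_dyadicLimit hp hl0 hl hN).comp hφ.tendsto_atTop) h2

end ChainingProbability

/-! ### Gaussian moments and bounds on spectral measures. -/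

/-- The moment of order `2n` of the standard Gaussian law. -/
def gaussianMoment (n : ℕ) : ℝ≥0∞ := ∫⁻ x, ‖x‖ₑ ^ (2 * n) ∂(gaussianReal 0 1)

lemma gaussianMoment_ne_top (n : ℕ) : gaussianMoment n ≠ ∞ := by
  have h := (memLp_id_gaussianReal (μ := 0) (v := 1) ((2 * n : ℕ) : NNReal)).integrable_norm_pow'
  have h2 := h.hasFiniteIntegral
  rw [HasFiniteIntegral] at h2
  simpa [gaussianMoment, enorm_pow] using h2.ne

lemma lintegral_pow_gaussianReal (n : ℕ) (v : NNReal) :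
    ∫⁻ x, ‖x‖ₑ ^ (2 * n) ∂(gaussianReal 0 v) = gaussianMoment n * (v : ℝ≥0∞) ^ n := by
  have hmap : gaussianReal 0 v = (gaussianReal 0 1).map (Real.sqrt v * ·) := by
    rw [gaussianReal_map_const_mul]
    congr 1
    · simp
    · ext
      simp
  rw [hmap, gaussianMoment, lintegral_map (by fun_prop) (by fun_prop), mul_comm (∫⁻ x, _ ∂_),
    ← lintegral_const_mul _ (by fun_prop)]
  refine lintegral_congr fun x => ?_
  rw [enorm_mul, mul_pow, pow_mul, ← ofReal_norm, Real.norm_eq_abs,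
    abs_of_nonneg (Real.sqrt_nonneg _), ← ENNReal.ofReal_pow (Real.sqrt_nonneg _),
    Real.sq_sqrt v.coe_nonneg, ENNReal.ofReal_coe_nnreal]

section SpectralMeasures

variable {d : ℕ}

lemma one_div_one_add_sq_le {l q : ℝ} (hl : 0 ≤ l) (hq0 : 0 < q) (hq2 : q < 2) :
    1 / (1 + l ^ 2) ≤ 2 * (1 / (1 + l ^ q)) := by
  have h0 : 0 ≤ l ^ q := Real.rpow_nonneg hl q
  have h : l ^ q ≤ 1 + l ^ 2 := by
    rcases le_total l 1 with h1 | h1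
    · have := Real.rpow_le_one hl h1 hq0.le
      nlinarith
    · have := Real.rpow_le_rpow_of_exponent_le h1 hq2.le
      rw [Real.rpow_two] at this
      linarith
  rw [mul_one_div, div_le_div_iff₀ (by positivity) (by positivity)]
  nlinarith

lemma IsDalang.of_rpow {μ : Measure (Space d)} {q : ℝ} (hq0 : 0 < q) (hq2 : q < 2)
    (h : ∫⁻ ξ, ENNReal.ofReal (1 / (1 + ‖ξ‖ ^ q)) ∂μ < ∞) : IsDalang μ := by
  refine ⟨lt_of_le_of_lt ?_ (ENNReal.mul_lt_top (ENNReal.ofNat_lt_top (n := 2)) h)⟩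
  rw [← lintegral_const_mul _ (by fun_prop)]
  refine lintegral_mono fun ξ => ?_
  rw [show (2 : ℝ≥0∞) * _ = _ from (by rw [ENNReal.ofReal_mul zero_le_two, ENNReal.ofReal_ofNat] :
    ENNReal.ofReal (2 * (1 / (1 + ‖ξ‖ ^ q))) = 2 * ENNReal.ofReal (1 / (1 + ‖ξ‖ ^ q))).symm]
  exact ENNReal.ofReal_le_ofReal (one_div_one_add_sq_le (norm_nonneg ξ) hq0 hq2)

/-- The uniform moment bound passes to the limit spectral measure. -/
lemma HypH2.lintegral_le {μ : ℕ → Measure (Space d)} {μlim : Measure (Space d)}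
    (h : HypH2 μ μlim) {q : ℝ} (hq0 : 0 < q) {K : ℝ≥0∞} (hK : K ≠ ∞)
    (hμ : ∀ n, ∫⁻ ξ, ENNReal.ofReal (1 / (1 + ‖ξ‖ ^ q)) ∂(μ n) ≤ K) :
    ∫⁻ ξ, ENNReal.ofReal (1 / (1 + ‖ξ‖ ^ q)) ∂μlim ≤ K := by
  -- The weight `1/(1+|ξ|^q)` decays too slowly for (H2). Capping it by `R/(1+|ξ|²)` makes it
  -- admissible, and the cap is removed by Fatou's lemma.
  let f : ℕ → Space d → ℝ := fun R ξ => min (1 / (1 + ‖ξ‖ ^ q)) (R * (1 / (1 + ‖ξ‖ ^ 2)))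
  have hq : ∀ ξ : Space d, 0 ≤ ‖ξ‖ ^ q := fun ξ => Real.rpow_nonneg (norm_nonneg _) _
  have hf0 : ∀ R ξ, 0 ≤ f R ξ := fun R ξ => le_min
    (one_div_nonneg.2 (add_nonneg zero_le_one (hq ξ))) (by positivity)
  have hfc : ∀ R, Continuous (f R) := fun R => by
    refine Continuous.min ?_ ?_
    · refine continuous_const.div (continuous_const.add
        (continuous_norm.rpow_const fun _ => Or.inr hq0.le)) fun ξ => ?_
      have := hq ξ
      positivity
    · exact continuous_const.mul (continuous_const.div (by fun_prop) fun ξ => by positivity)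
  have hfR : ∀ R, ∫⁻ ξ, ENNReal.ofReal (f R ξ) ∂μlim ≤ K := by
    intro R
    obtain ⟨hint, hlim⟩ := h (f R) (hfc R) ⟨R + 1, by positivity, fun ξ => by
      rw [abs_of_nonneg (hf0 R ξ)]
      refine (min_le_right _ _).trans ?_
      gcongr
      linarith⟩
    rw [← ofReal_integral_eq_lintegral_ofReal hint (ae_of_all _ (hf0 R)),
      ← ENNReal.ofReal_toReal hK]
    refine ENNReal.ofReal_le_ofReal (le_of_tendsto' hlim fun n => ?_)
    rw [integral_eq_lintegral_of_nonneg_ae (ae_of_all _ (hf0 R))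
      (hfc R).measurable.aestronglyMeasurable]
    refine ENNReal.toReal_mono hK (le_trans (lintegral_mono fun ξ => ?_) (hμ n))
    exact ENNReal.ofReal_le_ofReal (min_le_left _ _)
  have hlim : ∀ ξ, Tendsto (fun R => ENNReal.ofReal (f R ξ)) atTop
      (𝓝 (ENNReal.ofReal (1 / (1 + ‖ξ‖ ^ q)))) := by
    intro ξ
    refine tendsto_const_nhds.congr' ?_
    obtain ⟨R₀, hR₀⟩ := exists_nat_ge (1 + ‖ξ‖ ^ 2)
    filter_upwards [eventually_ge_atTop R₀] with R hR
    have hR' : 1 + ‖ξ‖ ^ 2 ≤ R := hR₀.trans (by exact_mod_cast hR)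
    congr 1
    refine (min_eq_left ?_).symm
    calc 1 / (1 + ‖ξ‖ ^ q) ≤ 1 := by
          have := hq ξ
          rw [div_le_one (by positivity)]
          linarith
      _ ≤ R * (1 / (1 + ‖ξ‖ ^ 2)) := by
          rw [mul_one_div, le_div_iff₀ (by positivity)]
          linarith
  calc ∫⁻ ξ, ENNReal.ofReal (1 / (1 + ‖ξ‖ ^ q)) ∂μlim
      = ∫⁻ ξ, liminf (fun R => ENNReal.ofReal (f R ξ)) atTop ∂μlim :=
        lintegral_congr fun ξ => (hlim ξ).liminf_eq.symm
    _ ≤ liminf (fun R => ∫⁻ ξ, ENNReal.ofReal (f R ξ) ∂μlim) atTop :=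
        lintegral_liminf_le fun R => (hfc R).measurable.ennreal_ofReal
    _ ≤ K := by
        refine le_trans (liminf_le_liminf (Eventually.of_forall hfR)) ?_
        simp

end SpectralMeasures

/-! ### Mean-square Hölder bound for the increments. -/

section Increments

variable {d : ℕ} {μ : Measure (Space d)}

/-- The constant in the Hölder bound for the increments of the stochastic convolution. -/
def incrementConst (T q B : ℝ) : ℝ :=
  (12 * energyConst T * B) ^ (1 - q / 2) *
    ((12 * energyConst T * B * 1) ^ (q / 2) + (12 * energyConst T * B) ^ (q / 2))

lemma incrementConst_nonneg (T q : ℝ) {B : ℝ} (hB : 0 ≤ B) : 0 ≤ incrementConst T q B := by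
  have := energyConst_nonneg T
  unfold incrementConst
  positivity

/-- Hölder bound for the increments of the stochastic convolution in mean square. -/
lemma Equation.sq_eLpNorm_convFun_sub_le [IsDalang μ] (eqn : Equation) {T q B δ : ℝ}
    (hq0 : 0 < q) (hq2 : q < 2) (hB : 1 ≤ B) (hδ0 : 0 ≤ δ) (hδ1 : δ ≤ 1) {t t' : ℝ}
    (ht : t ∈ Set.Icc 0 T) (ht' : t' ∈ Set.Icc 0 T) {x x' : Space d}
    (h : |t' - t| + ‖x - x'‖ ^ 2 ≤ B * δ) :
    eLpNorm (fun p => eqn.convFun t x p - eqn.convFun t' x' p) 2 (spaceTime μ) ^ 2 ≤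
      ENNReal.ofReal (incrementConst T q B * δ ^ (1 - q / 2)) *
        ∫⁻ ξ, ENNReal.ofReal (1 / (1 + ‖ξ‖ ^ q)) ∂μ := by
  wlog htt' : t ≤ t' generalizing t t' x x'
  · have := this ht' ht (x := x') (x' := x)
      (by rwa [abs_sub_comm, norm_sub_rev]) (le_of_not_ge htt')
    refine le_trans (le_of_eq ?_) this
    congr 1
    refine eLpNorm_congr_norm_ae (ae_of_all _ fun p => norm_sub_rev _ _)
  rw [sq_eLpNorm_two_spaceTime_swap (f := fun p => eqn.convFun t x p - eqn.convFun t' x' p)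
    ((eqn.measurable_convSymbol t x).sub (eqn.measurable_convSymbol t' x')),
    ← lintegral_const_mul _ (by fun_prop)]
  refine lintegral_mono fun ξ => ?_
  obtain ⟨D, hD0, hD, hD1, hD2⟩ :=
    eqn.exists_lintegral_convSymbol_sub_sq_le ht.1 htt' ht'.2 x x' ξ
  refine hD.trans ?_
  have hE := energyConst_nonneg T
  rw [← ENNReal.ofReal_mul (mul_nonneg (incrementConst_nonneg T q (by linarith))
    (Real.rpow_nonneg hδ0 _))]
  refine ENNReal.ofReal_le_ofReal ?_
  rw [abs_of_nonneg (sub_nonneg.2 htt')] at h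
  -- Interpolation with `A = 12 * energyConst T * B` and `δ₀ = 1`. The condition `1 ≤ B` lets the
  -- weighted bound carry the same constant.
  refine interpolation_le hD0 (by positivity) hδ0 hδ1 (norm_nonneg ξ) hq0 hq2 ?_ ?_
  · refine hD1.trans ?_
    rw [mul_assoc (12 * energyConst T)]
    gcongr
  · refine hD2.trans ?_
    exact le_mul_of_one_le_right (by positivity) hB

end Increments

/-! ### Parametrisation of the domain by Euclidean coordinates. -/

section GridMap

variable {d : ℕ} {T : ℝ}

/-- The parametrisation of `[0,T] × ℝ^d` by `ℝ^{1+d}` that clamps the time coordinate. -/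
def gridMap (hT : 0 ≤ T) (s : Option (Fin d) → ℝ) : Set.Icc (0 : ℝ) T × Space d :=
  (Set.projIcc 0 T hT (s none), WithLp.toLp 2 fun i => s (some i))

/-- The coordinates of a point of `[0,T] × ℝ^d`, a right inverse of `gridMap`. -/
def gridCoord (z : Set.Icc (0 : ℝ) T × Space d) : Option (Fin d) → ℝ :=
  fun o => o.elim (z.1 : ℝ) fun i => z.2 i

lemma gridMap_gridCoord (hT : 0 ≤ T) (z : Set.Icc (0 : ℝ) T × Space d) :
    gridMap hT (gridCoord z) = z := by
  refine Prod.ext (Set.projIcc_val hT z.1) ?_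
  ext i
  rfl

lemma continuous_gridMap (hT : 0 ≤ T) : Continuous (gridMap (d := d) hT) :=
  (continuous_projIcc.comp (continuous_apply none)).prodMk
    ((PiLp.continuous_toLp 2 _).comp (continuous_pi fun i => continuous_apply (some i)))

lemma continuous_gridCoord : Continuous (gridCoord (d := d) (T := T)) := by
  refine continuous_pi fun o => ?_
  cases o with
  | none => exact continuous_subtype_val.comp continuous_fst
  | some i => exact (PiLp.continuous_apply 2 _ i).comp continuous_snd

/-- Clamping is 1-Lipschitz, and `δ² ≤ δ` in each of the `d` space coordinates, so the parabolic
increment is linear in `δ`. -/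
lemma gridMap_increment_le (hT : 0 ≤ T) {s s' : Option (Fin d) → ℝ} {δ : ℝ} (hδ0 : 0 ≤ δ)
    (hδ1 : δ ≤ 1) (h : ∀ o, |s' o - s o| ≤ δ) :
    |((gridMap hT s').1 : ℝ) - (gridMap hT s).1| + ‖(gridMap hT s).2 - (gridMap hT s').2‖ ^ 2 ≤
      (1 + d) * δ := by
  have h1 : |((gridMap hT s').1 : ℝ) - (gridMap hT s).1| ≤ δ := by
    refine le_trans ?_ (h none)
    have := (LipschitzWith.projIcc hT).dist_le_mul (s' none) (s none)
    rw [NNReal.coe_one, one_mul, Subtype.dist_eq, Real.dist_eq, Real.dist_eq] at this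
    exact this
  have h2 : ‖(gridMap hT s).2 - (gridMap hT s').2‖ ^ 2 ≤ d * δ := by
    rw [EuclideanSpace.norm_sq_eq]
    refine (Finset.sum_le_card_nsmul _ _ δ fun i _ => ?_).trans (by simp)
    have : ‖((gridMap hT s).2 - (gridMap hT s').2) i‖ ≤ δ := by
      have := h (some i)
      rw [abs_sub_comm] at this
      exact this
    calc _ ≤ δ ^ 2 := pow_le_pow_left₀ (norm_nonneg _) this 2
      _ ≤ δ := by nlinarith
  linarith

end GridMap

/-! ### Moments of increments and continuous versions. -/

section Existence

variable {d : ℕ} {μ : Measure (Space d)} [IsDalang μ] {Ω : Type*} [MeasurableSpace Ω]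
  {P : Measure Ω} {W : TestFun d → Ω → ℝ}

lemma IsFourierIntegral.lintegral_pow {h : ℝ × Space d → ℂ} {I : Ω → ℝ}
    (hW : IsHomogeneousNoise μ P W) (hI : IsFourierIntegral μ P W h I) (hh : Measurable h)
    (n : ℕ) : ∫⁻ ω, ‖I ω‖ₑ ^ (2 * n) ∂P =
      gaussianMoment n * (eLpNorm h 2 (spaceTime μ) ^ 2) ^ n := by
  have hfin : eLpNorm h 2 (spaceTime μ) ^ 2 ≠ ∞ := ENNReal.pow_ne_top (hI.memLp_symbol hh).2.ne
  rw [← ENNReal.coe_toNNReal hfin, ← lintegral_pow_gaussianReal, ← hI.map_eq hW hh,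
    lintegral_map' (by fun_prop) hI.1.aestronglyMeasurable.aemeasurable]

variable {eqn : Equation} {T q : ℝ} {K : ℝ≥0∞} {I : Set.Icc (0 : ℝ) T × Space d → Ω → ℝ}

lemma lintegral_gridMap_increment_le (hW : IsHomogeneousNoise μ P W)
    (hI : ∀ z, IsFourierIntegral μ P W (eqn.convFun z.1 z.2) (I z)) (hT : 0 ≤ T)
    (hq0 : 0 < q) (hq2 : q < 2) (hK : ∫⁻ ξ, ENNReal.ofReal (1 / (1 + ‖ξ‖ ^ q)) ∂μ ≤ K) (n : ℕ)
    {s s' : Option (Fin d) → ℝ} {δ : ℝ} (hδ0 : 0 ≤ δ) (hδ1 : δ ≤ 1) (h : ∀ o, |s' o - s o| ≤ δ) :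
    ∫⁻ ω, ‖I (gridMap hT s') ω - I (gridMap hT s) ω‖ₑ ^ (2 * n) ∂P ≤
      gaussianMoment n * (ENNReal.ofReal (incrementConst T q (1 + d) * δ ^ (1 - q / 2)) * K) ^ n := by
  have hmeas : ∀ z : Set.Icc (0 : ℝ) T × Space d, Measurable (eqn.convFun (d := d) z.1 z.2) :=
    fun z => eqn.measurable_convSymbol _ _
  have hsub := (hI (gridMap hT s')).sub hW (hI (gridMap hT s)) (hmeas _) (hmeas _)
  rw [hsub.lintegral_pow hW ((hmeas _).sub (hmeas _)) n]
  gcongr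
  refine (eqn.sq_eLpNorm_convFun_sub_le hq0 hq2 (by simp) hδ0 hδ1 (gridMap hT s').1.2
    (gridMap hT s).1.2 (gridMap_increment_le hT hδ0 hδ1 fun o => ?_)).trans ?_
  · rw [abs_sub_comm]; exact h o
  · gcongr

/-- The constant in the moment bound for increments over dyadic neighbours. -/
def momentConst (d n : ℕ) (T q : ℝ) (K : ℝ≥0∞) : ℝ≥0∞ :=
  gaussianMoment n * (ENNReal.ofReal (incrementConst T q (1 + d)) * K) ^ n

lemma momentConst_ne_top (d n : ℕ) (T q : ℝ) {K : ℝ≥0∞} (hK : K ≠ ∞) :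
    momentConst d n T q K ≠ ∞ :=
  ENNReal.mul_ne_top (gaussianMoment_ne_top n)
    (ENNReal.pow_ne_top (ENNReal.mul_ne_top ENNReal.ofReal_ne_top hK))

/-- The exponent `n` is chosen so that `(1 - q/2) n ≥ d + 3`, where `d + 3` is the grid dimension `1
+ d` plus the two powers needed for chaining. The constant involves the spectral measure only
through `K`. -/
lemma lintegral_dyadic_increment_le (hW : IsHomogeneousNoise μ P W)
    (hI : ∀ z, IsFourierIntegral μ P W (eqn.convFun z.1 z.2) (I z)) (hT : 0 ≤ T)
    (hq0 : 0 < q) (hq2 : q < 2) (hK : ∫⁻ ξ, ENNReal.ofReal (1 / (1 + ‖ξ‖ ^ q)) ∂μ ≤ K) {n : ℕ}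
    (hn : ((d + 1 + 2 : ℕ) : ℝ) ≤ (1 - q / 2) * n) (k : ℕ) (z : Option (Fin d) → ℤ) :
    ∀ z' ∈ dyadicNhd z,
      ∫⁻ ω, ‖I (gridMap hT (dyadicPoint k z')) ω - I (gridMap hT (dyadicPoint k z)) ω‖ₑ ^ (2 * n)
        ∂P ≤ momentConst d n T q K * 2⁻¹ ^ (k * (Fintype.card (Option (Fin d)) + 2)) := by
  intro z' hz'
  have hk1 : ((1 : ℝ) / 2) ^ k ≤ 1 := pow_le_one₀ (by norm_num) (by norm_num)
  have hk0 : (0 : ℝ) < (1 / 2) ^ k := by positivity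
  refine (lintegral_gridMap_increment_le hW hI hT hq0 hq2 hK n hk0.le hk1 fun o => ?_).trans ?_
  · rw [mem_dyadicNhd] at hz'
    have h1 : |(z' o : ℝ) - z o| ≤ 1 := by
      rw [abs_le]
      have := hz' o
      constructor
      · have : (z o : ℝ) - 1 ≤ z' o := by exact_mod_cast this.1
        linarith
      · have : (z' o : ℝ) ≤ z o + 1 := by exact_mod_cast this.2
        linarith
    rw [dyadicPoint, dyadicPoint, ← sub_div, abs_div, abs_of_pos (by positivity : (0 : ℝ) < 2 ^ k),
      one_div_pow]
    gcongr
  · have hC := incrementConst_nonneg T q (B := 1 + d) (by positivity)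
    rw [momentConst, mul_assoc, ENNReal.ofReal_mul hC, mul_right_comm, mul_pow _ (ENNReal.ofReal _)]
    refine mul_le_mul' le_rfl (mul_le_mul' le_rfl ?_)
    rw [Fintype.card_option, Fintype.card_fin, ← ENNReal.ofReal_pow (by positivity),
      ← Real.rpow_mul_natCast hk0.le, show (2⁻¹ : ℝ≥0∞) = ENNReal.ofReal (1 / 2) by
        rw [one_div, ENNReal.ofReal_inv_of_pos (by norm_num), ENNReal.ofReal_ofNat],
      ← ENNReal.ofReal_pow (by norm_num), pow_mul]
    refine ENNReal.ofReal_le_ofReal ?_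
    rw [← Real.rpow_natCast (((1 : ℝ) / 2) ^ k)]
    exact Real.rpow_le_rpow_of_exponent_ge hk0 hk1 hn

lemma tendstoInMeasure_gridMap (hW : IsHomogeneousNoise μ P W)
    (hI : ∀ z, IsFourierIntegral μ P W (eqn.convFun z.1 z.2) (I z)) (hT : 0 ≤ T)
    (hq0 : 0 < q) (hq2 : q < 2) (hK : ∫⁻ ξ, ENNReal.ofReal (1 / (1 + ‖ξ‖ ^ q)) ∂μ ≤ K)
    (hKtop : K ≠ ∞) (s : Option (Fin d) → ℝ) :
    TendstoInMeasure P (fun k => I (gridMap hT (dyadicPoint k (dyadicFloor k s)))) atTop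
      (I (gridMap hT s)) := by
  refine tendstoInMeasure_of_tendsto_eLpNorm (p := 2) (by norm_num)
    (fun k => (hI _).1.aestronglyMeasurable) (hI _).1.aestronglyMeasurable ?_
  rw [← tendsto_sq_nhds_zero_iff]
  have hlim : Tendsto (fun k : ℕ => gaussianMoment 1 * (ENNReal.ofReal
      (incrementConst T q (1 + d) * ((1 / 2 : ℝ) ^ k) ^ (1 - q / 2)) * K) ^ 1) atTop (𝓝 0) := by
    have h0 : Tendsto (fun k : ℕ => ((1 / 2 : ℝ) ^ k) ^ (1 - q / 2)) atTop (𝓝 0) := by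
      have := (tendsto_pow_atTop_nhds_zero_of_lt_one (r := (1 / 2 : ℝ)) (by norm_num)
        (by norm_num)).rpow_const (p := 1 - q / 2) (Or.inr (by linarith))
      rwa [Real.zero_rpow (by linarith)] at this
    have h1 := ENNReal.tendsto_ofReal (h0.const_mul (incrementConst T q (1 + d)))
    rw [mul_zero, ENNReal.ofReal_zero] at h1
    have h2 := ENNReal.Tendsto.mul_const (b := K) h1 (Or.inr hKtop)
    have h3 := ENNReal.Tendsto.const_mul (a := gaussianMoment 1) h2
      (Or.inr (gaussianMoment_ne_top 1))
    simpa using h3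
  refine tendsto_of_tendsto_of_tendsto_of_le_of_le tendsto_const_nhds hlim (fun _ => zero_le)
    fun k => ?_
  rw [sq_eLpNorm_two]
  refine lintegral_gridMap_increment_le hW hI hT hq0 hq2 hK 1 (by positivity)
    (pow_le_one₀ (by norm_num) (by norm_num)) fun o => ?_
  rw [one_div_pow]
  exact abs_dyadicPoint_dyadicFloor_sub_le k s o

lemma exists_moment_order (d : ℕ) (hq2 : q < 2) :
    ∃ n : ℕ, n ≠ 0 ∧ ((d + 1 + 2 : ℕ) : ℝ) ≤ (1 - q / 2) * n := by
  have h : 0 < 1 - q / 2 := by linarith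
  obtain ⟨n, hn⟩ := exists_nat_ge (((d + 1 + 2 : ℕ) : ℝ) / (1 - q / 2))
  rw [div_le_iff₀ h] at hn
  refine ⟨n, ?_, by linarith⟩
  rintro rfl
  have : (0 : ℝ) < ((d + 1 + 2 : ℕ) : ℝ) := by positivity
  simp at hn
  linarith

lemma isContStochConv_iff (hadm : eqn.Admissible d) {v : Ω → PathSpace d T} :
    IsContStochConv eqn T μ P W v ↔
      ∀ z : Set.Icc (0 : ℝ) T × Space d,
        IsFourierIntegral μ P W (eqn.convFun z.1 z.2) (fun ω => v ω z) := by
  rw [Prod.forall]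
  exact forall_congr' fun t => forall_congr' fun x =>
    isWienerIntegral_iff (eqn.measurable_convSymbol _ _)
      fun s ξ => eqn.fourierMeas_integrand hadm t x s ξ

/-- The stochastic convolution has a continuous version. -/
theorem exists_isContStochConv (hadm : eqn.Admissible d) (hT : 0 ≤ T)
    (hW : IsHomogeneousNoise μ P W) (hq0 : 0 < q) (hq2 : q < 2)
    (hK : ∫⁻ ξ, ENNReal.ofReal (1 / (1 + ‖ξ‖ ^ q)) ∂μ < ∞) :
    ∃ v : Ω → PathSpace d T, IsContStochConv eqn T μ P W v := by
  choose I hI using fun z : Set.Icc (0 : ℝ) T × Space d =>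
    (eqn.isApproximable_convFun (μ := μ) hadm z.1.2.1 z.2).exists_isFourierIntegral hW
      (eqn.measurable_convSymbol _ _)
  obtain ⟨n, hn0, hn⟩ := exists_moment_order d hq2
  obtain ⟨Z, hZ⟩ := exists_continuous_modification (p := 2 * n) (P := P)
    (Y := fun s => I (gridMap hT s)) (by omega)
    (fun s => (hI _).1.aestronglyMeasurable.aemeasurable)
    (lintegral_dyadic_increment_le hW hI hT hq0 hq2 le_rfl hn)
    (momentConst_ne_top d n T q hK.ne) (tendstoInMeasure_gridMap hW hI hT hq0 hq2 le_rfl hK.ne)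
  -- The modification lives on all of `ℝ^{1+d}` with clamped time. Composition with the coordinates
  -- brings it back to `[0,T] × ℝ^d`.
  refine ⟨fun ω => (Z ω).comp ⟨gridCoord, continuous_gridCoord⟩, ?_⟩
  rw [isContStochConv_iff hadm]
  intro z
  refine (hI z).congr_ae ?_
  have := hZ (gridCoord z)
  rw [gridMap_gridCoord] at this
  exact this.symm

end Existence

/-! ### Measurability, compactness and tightness in the path space. -/

section PathSpace

variable {d : ℕ} {T : ℝ}

/-- A map to the path space with measurable coordinates is measurable. -/
lemma aemeasurable_pathSpace {Ω : Type*} [MeasurableSpace Ω] {P : Measure Ω}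
    {v : Ω → PathSpace d T} (hv : ∀ z, AEMeasurable (fun ω => v ω z) P) : AEMeasurable v P := by
  rcases isEmpty_or_nonempty (Set.Icc (0 : ℝ) T × Space d) with hX | hX
  · have : v = fun _ => 0 := funext fun ω => ContinuousMap.ext fun z => hX.elim z
    rw [this]
    exact aemeasurable_const
  -- Evaluation along a countable dense sequence is a continuous injection into `ℕ → ℝ`, hence a
  -- measurable embedding by the Lusin–Souslin theorem. Measurability of coordinates therefore
  -- suffices.
  let ev : PathSpace d T → ℕ → ℝ := fun f n => f (TopologicalSpace.denseSeq _ n)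
  have hcont : Continuous ev := continuous_pi fun n => continuous_eval_const _
  have hinj : Function.Injective ev := fun f g hfg => by
    refine DFunLike.coe_injective ((TopologicalSpace.denseRange_denseSeq _).equalizer
      f.continuous g.continuous ?_)
    exact funext fun n => congrFun hfg n
  rw [← (hcont.measurableEmbedding hinj).aemeasurable_comp_iff]
  exact aemeasurable_pi_iff.2 fun n => hv _

/-- The paths starting from `0` with prescribed moduli of continuity on the bounded sets. -/
def modulusSet (d : ℕ) (hT : 0 ≤ T) (c : ℕ → ℝ) (r : ℝ) : Set (PathSpace d T) :=
  {f | f (gridMap hT 0) = 0 ∧ ∀ (N : ℕ) (s t : Option (Fin d) → ℝ), ‖s‖ ≤ N → ‖t‖ ≤ N →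
    ∀ k : ℕ, ‖s - t‖ ≤ 1 / 2 ^ k → |f (gridMap hT s) - f (gridMap hT t)| ≤ c N * r ^ k}

/-- The segment from `0` to `s` is walked in `m` steps of length at most one, each costing at most
`c`. The induction removes the last step by shrinking `s` by the factor `m/(m+1)`. -/
lemma abs_le_of_modulus {ι : Type*} [Fintype ι] {g : (ι → ℝ) → ℝ} {N : ℕ} {c : ℝ} (h0 : g 0 = 0)
    (h : ∀ s t : ι → ℝ, ‖s‖ ≤ N → ‖t‖ ≤ N → ‖s - t‖ ≤ 1 → |g s - g t| ≤ c) {m : ℕ}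
    (hm : m ≤ N) {s : ι → ℝ} (hs : ‖s‖ ≤ m) : |g s| ≤ m * c := by
  induction m generalizing s with
  | zero =>
    have : s = 0 := by simpa using hs
    simp [this, h0]
  | succ m ih =>
    push_cast at hs ⊢
    have hm1 : (0 : ℝ) < m + 1 := by positivity
    have ht : ‖((m : ℝ) / (m + 1)) • s‖ ≤ m := by
      rw [norm_smul, Real.norm_eq_abs, abs_of_nonneg (by positivity), div_mul_eq_mul_div,
        div_le_iff₀ hm1]
      gcongr
    have hst : ‖s - ((m : ℝ) / (m + 1)) • s‖ ≤ 1 := by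
      have : s - ((m : ℝ) / (m + 1)) • s = (1 / ((m : ℝ) + 1)) • s := by
        nth_rw 1 [← one_smul ℝ s]
        rw [← sub_smul]
        congr 1
        field_simp
        ring
      rw [this, norm_smul, Real.norm_eq_abs, abs_of_nonneg (by positivity), one_div_mul_eq_div,
        div_le_one hm1]
      exact hs
    have hmN : ((m : ℝ) + 1) ≤ N := by exact_mod_cast hm
    have h1 := ih (by omega) ht
    have h2 := h s _ (hs.trans hmN) (ht.trans (by linarith)) hst
    have h3 := abs_sub_abs_le_abs_sub (g s) (g (((m : ℝ) / (m + 1)) • s))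
    linarith

/-- Arzelà–Ascoli: the moduli give equicontinuity, and together with the fixed value at the origin
they bound the paths pointwise. -/
lemma isCompact_modulusSet (hT : 0 ≤ T) (c : ℕ → ℝ) {r : ℝ} (hr0 : 0 ≤ r) (hr1 : r < 1) :
    IsCompact (modulusSet d hT c r) := by
  refine ArzelaAscoli.isCompact_of_equicontinuous _ ?_ ?_
  -- Continuity need not be imposed in `S`, since it follows from the moduli. This leaves only
  -- closed conditions on evaluations, so `S` is closed for pointwise convergence.
  · let S : Set (Set.Icc (0 : ℝ) T × Space d → ℝ) :=
      {g | g (gridMap hT 0) = 0 ∧ ∀ (N : ℕ) (s t : Option (Fin d) → ℝ), ‖s‖ ≤ N → ‖t‖ ≤ N →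
        ∀ k : ℕ, ‖s - t‖ ≤ 1 / 2 ^ k → |g (gridMap hT s) - g (gridMap hT t)| ≤ c N * r ^ k}
    have himage : ContinuousMap.toFun '' modulusSet d hT c r = S := by
      ext g
      constructor
      · rintro ⟨f, hf, rfl⟩
        exact hf
      · intro hg
        have hcont : Continuous fun s => g (gridMap hT s) :=
          continuous_of_abs_sub_le hr0 hr1 hg.2
        have hcont' : Continuous g := by
          have := hcont.comp (continuous_gridCoord (d := d) (T := T))
          simpa only [Function.comp_def, gridMap_gridCoord] using this
        exact ⟨⟨g, hcont'⟩, hg, rfl⟩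
    rw [himage]
    have hclosed : IsClosed S := by
      simp only [S, Set.ofPred_and, Set.ofPred_forall]
      refine (isClosed_eq (continuous_apply _) continuous_const).inter ?_
      refine isClosed_iInter fun N => isClosed_iInter fun s => isClosed_iInter fun t =>
        isClosed_iInter fun _ => isClosed_iInter fun _ => isClosed_iInter fun k =>
        isClosed_iInter fun _ => isClosed_le ?_ continuous_const
      exact ((continuous_apply (gridMap hT s)).sub (continuous_apply (gridMap hT t))).abs
    let b : Set.Icc (0 : ℝ) T × Space d → ℝ := fun z => ⌈‖gridCoord z‖⌉₊ * c ⌈‖gridCoord z‖⌉₊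
    refine (isCompact_univ_pi fun z => isCompact_Icc (a := -b z) (b := b z)).of_isClosed_subset
      hclosed fun g hg z _ => ?_
    have := abs_le_of_modulus (g := fun s => g (gridMap hT s)) (N := ⌈‖gridCoord z‖⌉₊)
      (c := c ⌈‖gridCoord z‖⌉₊) hg.1
      (fun s t hs ht hst => by simpa using hg.2 _ s t hs ht 0 (by simpa using hst)) le_rfl
      (Nat.le_ceil ‖gridCoord z‖)
    rw [gridMap_gridCoord] at this
    exact abs_le.1 this
  · intro z
    rw [Metric.equicontinuousAt_iff_right]
    intro ε hε
    obtain ⟨N, hN⟩ := exists_nat_ge (‖gridCoord z‖ + 1)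
    have hlim : Tendsto (fun k => c N * r ^ k) atTop (𝓝 0) := by
      simpa using (tendsto_pow_atTop_nhds_zero_of_lt_one hr0 hr1).const_mul (c N)
    obtain ⟨k, hk⟩ := (hlim.eventually (gt_mem_nhds hε)).exists
    have hev : ∀ᶠ z' in 𝓝 z, ‖gridCoord z - gridCoord z'‖ < 1 / 2 ^ k := by
      have h1 : Continuous fun z' : Set.Icc (0 : ℝ) T × Space d =>
          ‖gridCoord z - gridCoord z'‖ :=
        (continuous_const.sub continuous_gridCoord).norm
      refine (h1.tendsto z).eventually (gt_mem_nhds ?_)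
      rw [sub_self, norm_zero]
      positivity
    filter_upwards [hev] with z' hz' f
    have h1 : (1 : ℝ) / 2 ^ k ≤ 1 := by
      rw [div_le_one (by positivity)]
      exact one_le_pow₀ (by norm_num)
    have h2 := norm_sub_norm_le (gridCoord z') (gridCoord z)
    rw [norm_sub_rev] at h2
    have h3 := f.2.2 N (gridCoord z) (gridCoord z') (by linarith) (by linarith) k hz'.le
    rw [gridMap_gridCoord, gridMap_gridCoord] at h3
    rw [Real.dist_eq]
    exact h3.trans_lt hk

/-- **Kolmogorov's tightness criterion** in the path space. -/
theorem isTightMeasureSet_pathSpace (hT : 0 ≤ T) {S : Set (Measure (PathSpace d T))} {p : ℕ}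
    (hp : p ≠ 0) {M : ℝ≥0∞} (hM : M ≠ ∞) (h0 : ∀ ν ∈ S, ∀ᵐ f ∂ν, f (gridMap hT 0) = 0)
    (hS : ∀ ν ∈ S, ∀ (k : ℕ) (z : Option (Fin d) → ℤ), ∀ z' ∈ dyadicNhd z,
      ∫⁻ f, ‖f (gridMap hT (dyadicPoint k z')) - f (gridMap hT (dyadicPoint k z))‖ₑ ^ p ∂ν ≤
        M * 2⁻¹ ^ (k * (Fintype.card (Option (Fin d)) + 2))) :
    IsTightMeasureSet S := by
  rw [isTightMeasureSet_iff_exists_isCompact_measure_compl_le]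
  intro ε hε
  obtain ⟨η, hη0, hη⟩ := ENNReal.exists_pos_sum_of_countable' hε.ne' ℕ
  -- `E N` bounds the mean of the chaining sum over the box of size `N + 1`. By Markov's inequality
  -- the sum exceeds `E N / η N + 1` with probability at most `η N`, and these add up to less than
  -- `ε`. The added `1` keeps the level nonzero.
  let E : ℕ → ℝ≥0∞ := fun N => (9 * (N + 1 : ℕ)) ^ Fintype.card (Option (Fin d)) * M * 2
  have hE : ∀ N, E N ≠ ∞ := fun N => ENNReal.mul_ne_top (ENNReal.mul_ne_top (ENNReal.pow_ne_top
    (ENNReal.mul_ne_top (by norm_num) (ENNReal.natCast_ne_top _))) hM) (by norm_num)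
  have hηtop : ∀ N, η N ≠ ∞ := fun N => ((ENNReal.le_tsum N).trans_lt (hη.trans_le le_top)).ne
  have hA : ∀ N, E N / η N + 1 ≠ ∞ := fun N =>
    ENNReal.add_ne_top.2 ⟨ENNReal.div_ne_top (hE N) (hη0 N).ne', ENNReal.one_ne_top⟩
  have hl : ∀ N, ∃ l : ℝ, 0 ≤ l ∧ E N / η N + 1 = ENNReal.ofReal (l ^ p) := fun N => by
    refine ⟨(E N / η N + 1).toReal ^ (1 / p : ℝ), by positivity, ?_⟩
    rw [← Real.rpow_natCast, ← Real.rpow_mul (by positivity),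
      one_div_mul_cancel (by exact_mod_cast hp), Real.rpow_one, ENNReal.ofReal_toReal (hA N)]
  choose l hl0 hl using hl
  let c : ℕ → ℝ := fun N => l N * (1 + 2 * chainRatio p / (1 - chainRatio p))
  refine ⟨modulusSet d hT c (chainRatio p),
    isCompact_modulusSet hT c (chainRatio_pos p).le (chainRatio_lt_one hp), fun ν hν => ?_⟩
  have hmeas : ∀ s : Option (Fin d) → ℝ,
      AEMeasurable (fun f : PathSpace d T => f (gridMap hT s)) ν := fun s =>
    (continuous_eval_const _).measurable.aemeasurable
  have hsub : (modulusSet d hT c (chainRatio p))ᶜ ⊆ {f | f (gridMap hT 0) ≠ 0} ∪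
      ⋃ N, {f | E N / η N + 1 ≤ chainSum p (N + 1) fun s => f (gridMap hT s)} := by
    intro f hf
    by_contra hcon
    simp only [Set.mem_union, Set.mem_iUnion, Set.mem_ofPred_eq, not_or, not_exists, not_le,
      not_not, ne_eq] at hcon
    refine hf ⟨hcon.1, fun N s t hs ht k hst => ?_⟩
    have hN : (N : ℝ) ≤ (N + 1 : ℕ) := by push_cast; linarith
    have hle : chainSum p (N + 1) (fun s => f (gridMap hT s)) ≤ ENNReal.ofReal (l N ^ p) := by
      rw [← hl N]
      exact (hcon.2 N).le
    have := abs_dyadicLimit_sub_le hp (hl0 N) hle (hs.trans hN) (ht.trans hN) hst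
    -- A continuous path is its own dyadic limit, so the chaining bound is a bound on the path.
    rwa [dyadicLimit_eq_self (y := fun s => f (gridMap hT s))
      (f.continuous.comp (continuous_gridMap hT))] at this
  refine (measure_mono hsub).trans ((measure_union_le _ _).trans ?_)
  rw [ae_iff.1 (h0 ν hν), zero_add]
  refine (measure_iUnion_le _).trans (le_trans (ENNReal.tsum_le_tsum fun N => ?_) hη.le)
  refine (meas_ge_le_lintegral_div (aemeasurable_chainSum hmeas _) (by simp) (hA N)).trans ?_
  refine ENNReal.div_le_of_le_mul ((lintegral_chainSum_le hmeas (hS ν hν) (by omega)).trans ?_)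
  rw [mul_add, ENNReal.mul_div_cancel (hη0 N).ne' (hηtop N)]
  exact le_self_add

end PathSpace

/-! ### Finite-dimensional laws and their spectral variance. -/

section Variance

variable {d : ℕ} {T : ℝ} {eqn : Equation}

/-- The symbol of the linear combination `∑ a_z v(z)` of values of the stochastic convolution. -/
def Equation.combSymbol (eqn : Equation) (w : Set.Icc (0 : ℝ) T × Space d →₀ ℝ)
    (p : ℝ × Space d) : ℂ :=
  ∑ z ∈ w.support, (w z : ℂ) * eqn.convFun z.1 z.2 p

lemma Equation.measurable_combSymbol (eqn : Equation) (w : Set.Icc (0 : ℝ) T × Space d →₀ ℝ) :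
    Measurable (eqn.combSymbol w) :=
  Finset.measurable_fun_sum _ fun _ _ => (eqn.measurable_convSymbol _ _).const_mul _

/-- The spectral density of the variance of `∑ a_z v(z)`. -/
def Equation.specVariance (eqn : Equation) (w : Set.Icc (0 : ℝ) T × Space d →₀ ℝ)
    (ξ : Space d) : ℝ :=
  ∫ s in Set.Ici (0 : ℝ), ‖eqn.combSymbol w (s, ξ)‖ ^ 2

lemma Equation.norm_combSymbol_sq_le (eqn : Equation) (w : Set.Icc (0 : ℝ) T × Space d →₀ ℝ)
    (p : ℝ × Space d) : ‖eqn.combSymbol w p‖ ^ 2 ≤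
      ∑ z ∈ w.support, (w.support.card * w z ^ 2) * ‖eqn.convFun z.1 z.2 p‖ ^ 2 := by
  calc ‖eqn.combSymbol w p‖ ^ 2
      ≤ (∑ z ∈ w.support, |w z| * ‖eqn.convFun z.1 z.2 p‖) ^ 2 := by
        refine pow_le_pow_left₀ (norm_nonneg _) ((norm_sum_le _ _).trans (le_of_eq ?_)) 2
        refine Finset.sum_congr rfl fun z _ => ?_
        rw [norm_mul, Complex.norm_real, Real.norm_eq_abs]
    _ ≤ w.support.card * ∑ z ∈ w.support, (|w z| * ‖eqn.convFun z.1 z.2 p‖) ^ 2 :=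
        sq_sum_le_card_mul_sum_sq
    _ = _ := by
        rw [Finset.mul_sum]
        refine Finset.sum_congr rfl fun z _ => ?_
        rw [mul_pow, sq_abs, mul_assoc]

lemma Equation.norm_combSymbol_sq_le_indicator (eqn : Equation)
    (w : Set.Icc (0 : ℝ) T × Space d →₀ ℝ) (s : ℝ) (ξ : Space d) :
    ‖eqn.combSymbol w (s, ξ)‖ ^ 2 ≤ (Set.Icc 0 T).indicator
      (fun _ => ∑ z ∈ w.support, (w.support.card * w z ^ 2) * (1 + T) ^ 2) s := by
  refine (eqn.norm_combSymbol_sq_le w (s, ξ)).trans ?_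
  by_cases hs : s ∈ Set.Icc 0 T
  · rw [Set.indicator_of_mem hs]
    have hT : 0 ≤ T := hs.1.trans hs.2
    gcongr with z hz
    refine (eqn.norm_convSymbol_le z.2 s ξ).trans ?_
    refine Set.indicator_apply_le' (fun _ => ?_) fun _ => by positivity
    linarith [z.1.2.2]
  · rw [Set.indicator_of_notMem hs]
    refine le_of_eq (Finset.sum_eq_zero fun z _ => ?_)
    have h : ‖eqn.convFun z.1 z.2 (s, ξ)‖ ≤ 0 := by
      refine (eqn.norm_convSymbol_le z.2 s ξ).trans (le_of_eq (Set.indicator_of_notMem ?_ _))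
      exact fun hs' => hs ⟨hs'.1, hs'.2.trans z.1.2.2⟩
    rw [le_antisymm h (norm_nonneg _)]
    simp

lemma integrable_indicator_Icc (C : ℝ) :
    Integrable ((Set.Icc 0 T).indicator fun _ => C) (volume.restrict (Set.Ici (0 : ℝ))) :=
  (integrable_indicator_iff measurableSet_Icc).2
    ((continuous_const.integrableOn_Icc (μ := volume)).mono_measure Measure.restrict_le_self)

lemma Equation.integrable_norm_combSymbol_sq (eqn : Equation)
    (w : Set.Icc (0 : ℝ) T × Space d →₀ ℝ) (ξ : Space d) :
    Integrable (fun s => ‖eqn.combSymbol w (s, ξ)‖ ^ 2) (volume.restrict (Set.Ici (0 : ℝ))) := by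
  refine (integrable_indicator_Icc (T := T)
    (∑ z ∈ w.support, (w.support.card * w z ^ 2) * (1 + T) ^ 2)).mono'
    (((eqn.measurable_combSymbol w).comp measurable_prodMk_right).norm.pow_const
      2).aestronglyMeasurable (ae_of_all _ fun s => ?_)
  rw [Real.norm_eq_abs, abs_of_nonneg (by positivity)]
  exact eqn.norm_combSymbol_sq_le_indicator w s ξ

lemma Equation.specVariance_nonneg (eqn : Equation) (w : Set.Icc (0 : ℝ) T × Space d →₀ ℝ)
    (ξ : Space d) : 0 ≤ eqn.specVariance w ξ :=
  integral_nonneg fun _ => by positivity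

lemma Equation.ofReal_specVariance (eqn : Equation) (w : Set.Icc (0 : ℝ) T × Space d →₀ ℝ)
    (ξ : Space d) : ENNReal.ofReal (eqn.specVariance w ξ) =
      ∫⁻ s in Set.Ici (0 : ℝ), ‖eqn.combSymbol w (s, ξ)‖ₑ ^ 2 := by
  rw [specVariance, ofReal_integral_eq_lintegral_ofReal (eqn.integrable_norm_combSymbol_sq w ξ)
    (ae_of_all _ fun _ => by positivity)]
  exact lintegral_congr fun s => (enorm_sq_eq_ofReal _).symm

/-- Continuity is the first of the two conditions in (H2). It holds by dominated convergence in
time, as the integrand is continuous in `ξ` and bounded on `[0, T]` uniformly in `ξ`. -/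
lemma Equation.continuous_specVariance (eqn : Equation)
    (w : Set.Icc (0 : ℝ) T × Space d →₀ ℝ) : Continuous (eqn.specVariance w) := by
  refine continuous_of_dominated
    (bound := (Set.Icc 0 T).indicator
      (fun _ => ∑ z ∈ w.support, (w.support.card * w z ^ 2) * (1 + T) ^ 2))
    (fun ξ => (eqn.integrable_norm_combSymbol_sq w ξ).aestronglyMeasurable)
    (fun ξ => ae_of_all _ fun s => ?_) (integrable_indicator_Icc _) (ae_of_all _ fun s => ?_)
  · rw [Real.norm_eq_abs, abs_of_nonneg (by positivity)]
    exact eqn.norm_combSymbol_sq_le_indicator w s ξ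
  · unfold combSymbol
    refine (continuous_norm.comp (continuous_finsetSum _ fun z _ => ?_)).pow 2
    refine continuous_const.mul ?_
    simp only [convFun, convSymbol]
    by_cases hs : s ∈ Set.Ico 0 (z.1 : ℝ)
    · simp only [Set.indicator_of_mem hs]
      have := eqn.continuous_symbol.comp (f := fun ξ : Space d => ((z.1 : ℝ) - s, ξ)) (by fun_prop)
      exact (by fun_prop : Continuous _).mul (Complex.continuous_ofReal.comp this)
    · simp only [Set.indicator_of_notMem hs]
      exact continuous_const

/-- The decay condition in (H2). Cauchy–Schwarz reduces the combination to single kernels, whose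
energy is of order `1/(1+|ξ|²)`. -/
lemma Equation.exists_specVariance_le (eqn : Equation) (w : Set.Icc (0 : ℝ) T × Space d →₀ ℝ) :
    ∃ C > 0, ∀ ξ, |eqn.specVariance w ξ| ≤ C * (1 / (1 + ‖ξ‖ ^ 2)) := by
  let C : ℝ := ∑ z ∈ w.support, (w.support.card * w z ^ 2) *
    (energyConst (z.1 : ℝ) * z.1 + energyConst (z.1 : ℝ))
  have hz : ∀ z : Set.Icc (0 : ℝ) T × Space d,
      0 ≤ energyConst (z.1 : ℝ) * z.1 + energyConst (z.1 : ℝ) := fun z => by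
    have := energyConst_nonneg (z.1 : ℝ)
    have := z.1.2.1
    positivity
  have hC : 0 ≤ C := Finset.sum_nonneg fun z _ => mul_nonneg (by positivity) (hz z)
  -- The sum `C` may vanish, so `1` is added to have a positive constant.
  refine ⟨C + 1, by positivity, fun ξ => ?_⟩
  rw [abs_of_nonneg (eqn.specVariance_nonneg w ξ)]
  refine le_trans ?_ (mul_le_mul_of_nonneg_right (le_add_of_nonneg_right zero_le_one) (by positivity))
  rw [← ENNReal.ofReal_le_ofReal_iff (by positivity), eqn.ofReal_specVariance]
  calc ∫⁻ s in Set.Ici (0 : ℝ), ‖eqn.combSymbol w (s, ξ)‖ₑ ^ 2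
      ≤ ∫⁻ s in Set.Ici (0 : ℝ), ∑ z ∈ w.support, ENNReal.ofReal (w.support.card * w z ^ 2) *
          ‖eqn.convSymbol (z.1 : ℝ) z.2 s ξ‖ₑ ^ 2 := by
        refine lintegral_mono fun s => ?_
        simp only [enorm_sq_eq_ofReal]
        refine (ENNReal.ofReal_le_ofReal (eqn.norm_combSymbol_sq_le w (s, ξ))).trans (le_of_eq ?_)
        rw [ENNReal.ofReal_sum_of_nonneg fun z _ => by positivity]
        refine Finset.sum_congr rfl fun z _ => ?_
        rw [ENNReal.ofReal_mul (by positivity)]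
    _ = ∑ z ∈ w.support, ENNReal.ofReal (w.support.card * w z ^ 2) *
          ∫⁻ s in Set.Ici (0 : ℝ), ‖eqn.convSymbol (z.1 : ℝ) z.2 s ξ‖ₑ ^ 2 := by
        have hm : ∀ z : Set.Icc (0 : ℝ) T × Space d,
            Measurable fun s => ‖eqn.convSymbol (z.1 : ℝ) z.2 s ξ‖ₑ ^ 2 := fun z =>
          ((eqn.measurable_convSymbol _ _).comp
            (measurable_prodMk_right (y := ξ))).enorm.pow_const 2
        rw [lintegral_finsetSum _ fun z _ => (hm z).const_mul _]
        exact Finset.sum_congr rfl fun z _ => lintegral_const_mul _ (hm z)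
    _ ≤ ∑ z ∈ w.support, ENNReal.ofReal (w.support.card * w z ^ 2) *
          (ENNReal.ofReal (energyConst (z.1 : ℝ) * z.1 + energyConst (z.1 : ℝ)) *
            ENNReal.ofReal (1 / (1 + ‖ξ‖ ^ 2))) := by
        gcongr with z
        exact eqn.lintegral_convSymbol_sq_le z.1.2.1 z.2 ξ
    _ = ENNReal.ofReal (C * (1 / (1 + ‖ξ‖ ^ 2))) := by
        rw [Finset.sum_mul, ENNReal.ofReal_sum_of_nonneg fun z _ =>
          mul_nonneg (mul_nonneg (by positivity) (hz z)) (by positivity)]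
        refine Finset.sum_congr rfl fun z _ => ?_
        rw [ENNReal.ofReal_mul (mul_nonneg (by positivity) (hz z)),
          ENNReal.ofReal_mul (p := (w.support.card : ℝ) * w z ^ 2) (by positivity), mul_assoc]

lemma Equation.toReal_sq_eLpNorm_combSymbol {μ : Measure (Space d)} [IsDalang μ] (eqn : Equation)
    (w : Set.Icc (0 : ℝ) T × Space d →₀ ℝ) :
    (eLpNorm (eqn.combSymbol w) 2 (spaceTime μ) ^ 2).toReal = ∫ ξ, eqn.specVariance w ξ ∂μ := by
  rw [sq_eLpNorm_two_spaceTime_swap (eqn.measurable_combSymbol w),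
    integral_eq_lintegral_of_nonneg_ae (ae_of_all _ (eqn.specVariance_nonneg w))
      (eqn.continuous_specVariance w).measurable.aestronglyMeasurable]
  simp only [eqn.ofReal_specVariance]

variable {Ω : Type*} [MeasurableSpace Ω] {P : Measure Ω} {W : TestFun d → Ω → ℝ}
  {μ : Measure (Space d)} [IsDalang μ]

/-- The characteristic function of the finite-dimensional laws of the stochastic convolution. -/
lemma IsContStochConv.integral_probChar (hadm : eqn.Admissible d) (hW : IsHomogeneousNoise μ P W)
    {v : Ω → PathSpace d T} (hv : IsContStochConv eqn T μ P W v)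
    (w : Set.Icc (0 : ℝ) T × Space d →₀ ℝ) :
    ∫ ω, (Real.probChar (∑ z ∈ w.support, w z * v ω z) : ℂ) ∂P =
      Complex.exp (-((∫ ξ, eqn.specVariance w ξ ∂μ : ℝ) : ℂ) / 2) := by
  rw [isContStochConv_iff hadm] at hv
  have hI := IsFourierIntegral.sum w.support hW hv (fun z => eqn.measurable_convSymbol _ _) w
  have hmap := hI.map_eq hW (eqn.measurable_combSymbol w)
  -- The coefficients already sit in the linear combination, so its characteristic function is
  -- needed only at `1`.
  have h := charFun_apply_real (μ := P.map fun ω => ∑ z ∈ w.support, w z * v ω z) 1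
  rw [integral_map hI.1.aestronglyMeasurable.aemeasurable
    (by fun_prop : Continuous _).aestronglyMeasurable, hmap, charFun_gaussianReal] at h
  refine Eq.trans ?_ (h.symm.trans ?_)
  · refine integral_congr_ae (ae_of_all _ fun ω => ?_)
    simp only [Real.probChar_apply, Complex.ofReal_one, one_mul]
  · rw [← eqn.toReal_sq_eLpNorm_combSymbol w]
    congr 1
    simp [ENNReal.coe_toNNReal_eq_toReal, neg_div]
    rfl

end Variance

/-! ### From tightness and characteristic functions to weak convergence. -/

section Convergence

variable {d : ℕ} {T : ℝ}

/-- The pairing `⟨f, ∑ a_z δ_z⟩ = ∑ a_z f(z)` of a path with a finitely supported measure. -/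
def pathPairing (d : ℕ) (T : ℝ) :
    PathSpace d T →ₗ[ℝ] (Set.Icc (0 : ℝ) T × Space d →₀ ℝ) →ₗ[ℝ] ℝ :=
  LinearMap.mk₂ ℝ (fun f w => w.sum fun z a => a * f z)
    (fun f g w => by simp [mul_add, Finsupp.sum_add])
    (fun c f w => by
      simp only [Finsupp.sum, Finset.mul_sum, ContinuousMap.smul_apply, smul_eq_mul]
      exact Finset.sum_congr rfl fun z _ => by ring)
    (fun f w w' => Finsupp.sum_add_index' (fun z => zero_mul _) fun z a b => add_mul _ _ _)
    (fun c f w => by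
      rw [Finsupp.sum_smul_index' fun z => zero_mul _, Finsupp.sum, Finsupp.sum, Finset.smul_sum]
      exact Finset.sum_congr rfl fun z _ => by simp only [smul_eq_mul]; ring)

lemma pathPairing_apply (f : PathSpace d T) (w : Set.Icc (0 : ℝ) T × Space d →₀ ℝ) :
    pathPairing d T f w = ∑ z ∈ w.support, w z * f z := rfl

lemma continuous_pathPairing (w : Set.Icc (0 : ℝ) T × Space d →₀ ℝ) :
    Continuous fun f : PathSpace d T => pathPairing d T f w := by
  simp only [pathPairing_apply]
  exact continuous_finsetSum _ fun z _ => continuous_const.mul (continuous_eval_const z)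

/-- A tight sequence of laws on the path space converges weakly as soon as the characteristic
functions of the finite-dimensional marginals converge. -/
theorem tendsto_of_tight_of_tendsto_integral_probChar {ν : ℕ → ProbabilityMeasure (PathSpace d T)}
    {ν₀ : ProbabilityMeasure (PathSpace d T)}
    (htight : IsTightMeasureSet {(ν n : Measure (PathSpace d T)) | n})
    (h : ∀ w : Set.Icc (0 : ℝ) T × Space d →₀ ℝ,
      Tendsto (fun n => ∫ f, (Real.probChar (pathPairing d T f w) : ℂ) ∂(ν n)) atTop
        (𝓝 (∫ f, (Real.probChar (pathPairing d T f w) : ℂ) ∂ν₀))) :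
    Tendsto ν atTop (𝓝 ν₀) := by
  -- With the discrete topology on coefficients, joint continuity of the pairing reduces to
  -- continuity in the path for each fixed combination.
  let _ : TopologicalSpace (Set.Icc (0 : ℝ) T × Space d →₀ ℝ) := ⊥
  have _ : DiscreteTopology (Set.Icc (0 : ℝ) T × Space d →₀ ℝ) := ⟨rfl⟩
  have hL : Continuous fun p : PathSpace d T × (Set.Icc (0 : ℝ) T × Space d →₀ ℝ) =>
      pathPairing d T p.1 p.2 :=
    continuous_prod_of_discrete_right.2 continuous_pathPairing
  refine ProbabilityMeasure.tendsto_of_tight_of_separatesPoints (𝕜 := ℂ) htight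
    (A := BoundedContinuousFunction.charPoly Real.continuous_probChar hL) ?_ ?_
  -- Characters separate points because pairing with a unit mass at `z` recovers the value at `z`.
  · refine BoundedContinuousFunction.separatesPoints_charPoly Real.continuous_probChar
      Real.probChar_ne_one hL fun f hf hzero => hf (ContinuousMap.ext fun z => ?_)
    have := LinearMap.congr_fun hzero (Finsupp.single z 1)
    change (Finsupp.single z (1 : ℝ)).sum (fun z a => a * f z) = 0 at this
    rw [Finsupp.sum_single_index (zero_mul _), one_mul] at this
    exact this
  · intro g hg
    rw [BoundedContinuousFunction.mem_charPoly] at hg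
    obtain ⟨w, hw⟩ := hg
    -- Elements of the algebra are finite combinations of characters, so convergence need only be
    -- known for characters.
    have heq : ∀ (ρ : Measure (PathSpace d T)) [IsProbabilityMeasure ρ], ∫ f, g f ∂ρ =
        w.coeff.sum fun a c => c * ∫ f, (Real.probChar (pathPairing d T f a) : ℂ) ∂ρ := by
      intro ρ _
      simp_rw [hw, Finsupp.sum]
      rw [integral_finsetSum]
      · exact Finset.sum_congr rfl fun a _ => integral_const_mul _ _
      · intro a _
        refine Integrable.const_mul ?_ _
        exact (BoundedContinuousFunction.char Real.continuous_probChar hL a).integrable ρ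
    rw [heq ν₀]
    simp_rw [fun n => heq (ν n : Measure (PathSpace d T))]
    exact tendsto_finsetSum _ fun a _ => (h a).const_mul _

section

variable {μ : Measure (Space d)} [IsDalang μ] {Ω : Type*} [MeasurableSpace Ω] {P : Measure Ω}
  {W : TestFun d → Ω → ℝ} {eqn : Equation} {v : Ω → PathSpace d T}

omit [IsDalang μ] in
lemma IsContStochConv.aemeasurable (hv : IsContStochConv eqn T μ P W v) : AEMeasurable v P :=
  aemeasurable_pathSpace fun z => (hv z.1 z.2).1.aestronglyMeasurable.aemeasurable

/-- At time `0` the integrand vanishes, so the second moment is zero. This fixes the value at the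
origin that compactness of the path sets relies on. -/
lemma IsContStochConv.ae_eq_zero (hadm : eqn.Admissible d) (hT : 0 ≤ T)
    (hW : IsHomogeneousNoise μ P W) (hv : IsContStochConv eqn T μ P W v) :
    ∀ᵐ ω ∂P, v ω (gridMap hT 0) = 0 := by
  rw [isContStochConv_iff hadm] at hv
  have h := (hv (gridMap hT 0)).lintegral_pow hW (eqn.measurable_convSymbol _ _) 1
  have h0 : eqn.convFun ((gridMap (d := d) hT 0).1 : ℝ) (gridMap (d := d) hT 0).2 = fun _ => 0 := by
    funext p
    have : ((gridMap (d := d) hT 0).1 : ℝ) = 0 := by simp [gridMap, Set.projIcc, hT]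
    rw [this]
    simp [Equation.convFun, Equation.convSymbol]
  rw [h0, eLpNorm_zero', zero_pow two_ne_zero, pow_one, mul_zero,
    lintegral_eq_zero_iff' ((hv _).1.aestronglyMeasurable.enorm.pow_const _)] at h
  filter_upwards [h] with ω hω
  simpa using hω

lemma IsContStochConv.integral_map_probChar (hadm : eqn.Admissible d)
    (hW : IsHomogeneousNoise μ P W) (hv : IsContStochConv eqn T μ P W v)
    (w : Set.Icc (0 : ℝ) T × Space d →₀ ℝ) :
    ∫ f, (Real.probChar (pathPairing d T f w) : ℂ) ∂(P.map v) =
      Complex.exp (-((∫ ξ, eqn.specVariance w ξ ∂μ : ℝ) : ℂ) / 2) := by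
  rw [← hv.integral_probChar hadm hW w, integral_map hv.aemeasurable]
  · rfl
  · exact (continuous_subtype_val.comp
      (Real.continuous_probChar.comp (continuous_pathPairing w))).aestronglyMeasurable

end

end Convergence

end StochConv

end

/-! ### The convergence theorem. -/

theorem theorem3p2 (eqn : StochConv.Equation) (d : ℕ) (hd : 1 ≤ d)
    (hwave : eqn = StochConv.Equation.wave → d ≤ 3) (T : ℝ) (hT : 0 < T)
    (μ : ℕ → Measure (StochConv.Space d)) (μlim : Measure (StochConv.Space d))
    (hH1 : StochConv.HypH1 μ) (hH2 : StochConv.HypH2 μ μlim)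
    {Ω : ℕ → Type*} [∀ n, MeasurableSpace (Ω n)]
    (P : (n : ℕ) → Measure (Ω n)) [∀ n, IsProbabilityMeasure (P n)]
    (W : (n : ℕ) → StochConv.TestFun d → Ω n → ℝ)
    (hW : ∀ n, StochConv.IsHomogeneousNoise (μ n) (P n) (W n))
    {Ωlim : Type*} [MeasurableSpace Ωlim]
    (Plim : Measure Ωlim) [IsProbabilityMeasure Plim]
    (Wlim : StochConv.TestFun d → Ωlim → ℝ)
    (hWlim : StochConv.IsHomogeneousNoise μlim Plim Wlim) :
    (∀ n, ∃ v : Ω n → StochConv.PathSpace d T,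
      StochConv.IsContStochConv eqn T (μ n) (P n) (W n) v) ∧
    (∃ v : Ωlim → StochConv.PathSpace d T,
      StochConv.IsContStochConv eqn T μlim Plim Wlim v) ∧
    (∀ (v : (n : ℕ) → Ω n → StochConv.PathSpace d T) (vlim : Ωlim → StochConv.PathSpace d T),
      (∀ n, StochConv.IsContStochConv eqn T (μ n) (P n) (W n) (v n)) →
      StochConv.IsContStochConv eqn T μlim Plim Wlim vlim →
      TendstoInDistribution v atTop vlim P Plim) := by
  have hadm : eqn.Admissible d := ⟨hd, hwave⟩
  obtain ⟨q, hq0, hq2, hsup⟩ := hH1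
  set K := ⨆ n, ∫⁻ ξ, ENNReal.ofReal (1 / (1 + ‖ξ‖ ^ q)) ∂(μ n) with hKdef
  have hK : ∀ n, ∫⁻ ξ, ENNReal.ofReal (1 / (1 + ‖ξ‖ ^ q)) ∂(μ n) ≤ K := fun n =>
    le_iSup (fun n => ∫⁻ ξ, ENNReal.ofReal (1 / (1 + ‖ξ‖ ^ q)) ∂(μ n)) n
  have hKlim := hH2.lintegral_le hq0 hsup.ne hK
  have hdal : ∀ n, StochConv.IsDalang (μ n) := fun n => .of_rpow hq0 hq2 ((hK n).trans_lt hsup)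
  have hdlim : StochConv.IsDalang μlim := .of_rpow hq0 hq2 (hKlim.trans_lt hsup)
  refine ⟨fun n => StochConv.exists_isContStochConv hadm hT.le (hW n) hq0 hq2 ((hK n).trans_lt hsup),
    StochConv.exists_isContStochConv hadm hT.le hWlim hq0 hq2 (hKlim.trans_lt hsup), fun v vlim hv hvlim => ?_⟩
  have hmeas : ∀ n, AEMeasurable (v n) (P n) := fun n => (hv n).aemeasurable
  refine ⟨hmeas, hvlim.aemeasurable, ?_⟩
  -- The moment order depends only on `d` and `q`, and the moment constant on the spectral measures
  -- only through `K`, so one choice serves every `n`.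
  obtain ⟨n₀, hn0, hn⟩ := StochConv.exists_moment_order d hq2
  refine StochConv.tendsto_of_tight_of_tendsto_integral_probChar ?_ fun w => ?_
  · refine StochConv.isTightMeasureSet_pathSpace hT.le (p := 2 * n₀) (by omega)
      (StochConv.momentConst_ne_top d n₀ T q hsup.ne) ?_ ?_
    · rintro _ ⟨n, rfl⟩
      exact (ae_map_iff (hmeas n)
        (measurableSet_eq_fun (continuous_eval_const _).measurable measurable_const)).2
        ((hv n).ae_eq_zero hadm hT.le (hW n))
    · rintro _ ⟨n, rfl⟩ k z z' hz'
      have hm : ∀ z, Measurable fun f : StochConv.PathSpace d T => f z := fun z =>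
        (continuous_eval_const z).measurable
      refine (lintegral_map' (((hm _).sub (hm _)).enorm.pow_const _).aemeasurable (hmeas n)).trans_le
        ?_
      exact StochConv.lintegral_dyadic_increment_le (hW n) ((StochConv.isContStochConv_iff hadm).1 (hv n)) hT.le hq0 hq2
        (hK n) hn k z z' hz'
  -- The spectral variance is an admissible test function in (H2), so the variances of all finite
  -- combinations converge.
  · have hvar := (hH2 (eqn.specVariance w) (eqn.continuous_specVariance w)
      (eqn.exists_specVariance_le w)).2
    refine (Tendsto.congr (fun n => ((hv n).integral_map_probChar hadm (hW n) w).symm) ?_).trans_eq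
      (congrArg 𝓝 (hvlim.integral_map_probChar hadm hWlim w).symm)
    exact ((by fun_prop : Continuous fun x : ℝ => Complex.exp (-(x : ℂ) / 2)).tendsto _).comp hvar
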